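/- All graphs are finite and simple. A graph is \emph{4-critical} if it is not 3-colorable, but all of its proper subgraphs are 3-colorable. The girth of a graph is the length of a shortest cycle (and $\infty$ if there is no cycle). \textbf{Theorem.} If $G$ is a 4-critical graph of girth at least five, then $$|E(G)| \ge \frac{5|V(G)| + 2}{3}.$$ -/

import Mathlib

/-- A graph is `4`-critical if it is not `3`-colorable, but all of its proper subgraphs are.
Proper subgraphs are obtained by deleting vertices, edges, or both. -/
def SimpleGraph.IsFourCritical {V : Type*} (G : SimpleGraph V) : Prop :=
  ¬ G.Colorable 3 ∧ ∀ H : G.Subgraph, H ≠ ⊤ → H.coe.Colorable 3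

/-!
# The number of edges of four-critical graphs of girth at least five

The proof uses the potential method. The potential of a vertex set `S` is `5|S| - 3e(S)`, and the claim
is that a `4`-critical graph without triangles and four-cycles has potential at most `-2`
(`Crit.potG_le_neg_two`).

Small potentials are controlled by contraction: if `R` is a proper vertex set and `φ` a proper
`3`-colouring of it, then `R` may be replaced by a triangle whose vertices represent the colour classes.
The result is not `3`-colourable, and so it contains a smaller critical graph `W`
(`Crit.exists_contr`). The potentials of `R`, of `W`, of the surviving part of the triangle and of the
uncontracted set in `G` satisfy a linear identity, up to the number of edges lost. A vertex,
a triangle and an edge have potential `5`, `6` and `7`, and other sets of up to three vertices have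
more (`pot_card_le_three`); so an inductive bound on the potential of `W` shows that proper sets of `G`
have large potential, or gives precise information on the contraction. Two more reductions are used in the same way: adding an edge between two vertices of
`R` that no colouring separates (`Crit.exists_addEdge`), and identifying two neighbours of a vertex of
degree three (`Crit.exists_ident`).

The induction is about all critical graphs, not only those of girth five. By `bound`, a critical
graph has potential at most `2`, and one of positive potential is complete on four vertices or has a
monochromatic set: a proper set of potential at most `5` each colouring of which is constant on the
boundary. In a counterexample to the latter, sets of potential at most `6` miss at most two vertices
(`NM.card_sdiff_le_two`), there are no diamonds and no triangles of vertices of degree three, and the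
two outer neighbours of the end of a path of three vertices of degree three are adjacent (`NM.star`).
Then counting edges at the vertices of degree three contradicts positivity (`Crit.potG_neg_of_star`).

Monochromatic sets can be contracted or cut out along an added edge, which leaves graphs of positive
potential. By induction, such graphs have many short cycles: there is a triangle off any vertex
(`Crit.tri_erase`), and a triangle or a four-cycle off any two edges (`not_noShort_deleteEdges`). So a
critical graph of girth five has potential at most `0`. The same reductions show that a critical graph of
potential `0` whose triangles and four-cycles all pass through one vertex has six vertices
(`Crit.card_eq_six`), and potential `0` is excluded by the bound `4e² ≤ n²(n - 1)` for graphs without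
triangles and four-cycles (`NoShort.card_le`).

For potential `-1`, these results imply that a vertex of degree three has at most one neighbour of degree
three (`NegOne.card_nb_V3_le_one`). Counting leaves at most two edges between vertices of larger
degree, and hence those vertices have a `3`-colouring with almost all colours equal. It extends to the
vertices of degree three (`NegOne.false`).
-/

namespace FourCrit
open Finset
open scoped Classical
noncomputable section
set_option linter.unusedSectionVars false
variable {V : Type*} [Fintype V]

/-! ### Colourings, critical graphs and potentials -/

/-- `c` is a proper `3`-colouring of the subgraph of `G` induced by `A`. -/
def PC (G : SimpleGraph V) (A : Finset V) (c : V → Fin 3) : Prop :=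
  ∀ a ∈ A, ∀ b ∈ A, G.Adj a b → c a ≠ c b

/-- `G` is not `3`-colourable, but each graph on the same vertex set with fewer edges is.
Isolated vertices are allowed, so that all critical graphs of an argument live on one type. -/
def Crit (G : SimpleGraph V) : Prop :=
  (∀ c, ¬ PC G univ c) ∧ ∀ H ≤ G, H ≠ G → ∃ c, PC H univ c

/-- The non-isolated vertices of `G`. -/
def supp (G : SimpleGraph V) : Finset V := univ.filter fun v => ∃ w, G.Adj v w

/-- The neighbours of `v`. -/
def nb (G : SimpleGraph V) (v : V) : Finset V := univ.filter fun w => G.Adj v w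

/-- The number of edges of `G` with both ends in `S`. -/
def eIn (G : SimpleGraph V) (S : Finset V) : ℕ :=
  (univ.filter fun e : Sym2 V => e ∈ G.edgeSet ∧ ∀ v ∈ e, v ∈ S).card

/-- The potential `5|S| - 3e(S)` of a vertex set. -/
def pot (G : SimpleGraph V) (S : Finset V) : ℤ := 5 * S.card - 3 * eIn G S

/-- The potential of the whole graph, isolated vertices not counted. -/
def potG (G : SimpleGraph V) : ℤ := pot G (supp G)

variable {G H W : SimpleGraph V} {A B R S T : Finset V} {u v w x y z : V}

@[simp] lemma mem_supp : v ∈ supp G ↔ ∃ w, G.Adj v w := by simp [supp]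
@[simp] lemma mem_nb : w ∈ nb G v ↔ G.Adj v w := by simp [nb]

lemma mem_supp_left (h : G.Adj v w) : v ∈ supp G := mem_supp.2 ⟨w, h⟩
lemma mem_supp_right (h : G.Adj v w) : w ∈ supp G := mem_supp.2 ⟨v, h.symm⟩

lemma PC.perm {c : V → Fin 3} (h : PC G A c) (σ : Equiv.Perm (Fin 3)) : PC G A (σ ∘ c) :=
  fun a ha b hb hab he => h a ha b hb hab (σ.injective he)

lemma pc_univ_iff {c : V → Fin 3} : PC G univ c ↔ ∀ a b, G.Adj a b → c a ≠ c b := by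
  simp [PC]

/-- A graph that is not `3`-colourable has a critical subgraph. -/
lemma exists_crit_le (h : ∀ c, ¬ PC H univ c) : ∃ W ≤ H, Crit W := by
  obtain ⟨W, hW, hmin⟩ := WellFounded.has_min (wellFounded_lt (α := SimpleGraph V))
    {W | W ≤ H ∧ ∀ c, ¬ PC W univ c} ⟨H, le_rfl, h⟩
  refine ⟨W, hW.1, hW.2, fun K hK hne => ?_⟩
  by_contra hc
  push Not at hc
  exact hmin K ⟨hK.trans hW.1, hc⟩ (lt_of_le_of_ne hK hne)

lemma Crit.eq_of_le (hG : Crit G) (hW : Crit W) (h : W ≤ G) : W = G := by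
  by_contra hne
  obtain ⟨c, hc⟩ := hG.2 W h hne
  exact hW.1 c hc

/-- A set that misses a non-isolated vertex of a critical graph is `3`-colourable. -/
lemma Crit.exists_pc (hG : Crit G) (hv : v ∈ supp G) (hA : v ∉ A) : ∃ c, PC G A c := by
  obtain ⟨w, hw⟩ := mem_supp.1 hv
  let H : SimpleGraph V :=
    { Adj := fun a b => G.Adj a b ∧ a ∈ A ∧ b ∈ A
      symm := ⟨fun a b h => ⟨h.1.symm, h.2.2, h.2.1⟩⟩
      loopless := ⟨fun a h => G.loopless.irrefl a h.1⟩ }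
  obtain ⟨c, hc⟩ := hG.2 H (fun a b h => h.1) (fun h => hA (by
    have : H.Adj v w := by rw [h]; exact hw
    exact this.2.1))
  exact ⟨c, fun a ha b hb hab => hc a (mem_univ _) b (mem_univ _) ⟨hab, ha, hb⟩⟩

/-- A vertex that sees at most two colours can be coloured. -/
lemma PC.extend_of_image {c : V → Fin 3} (h : PC G A c)
    (hv : ((A.filter (G.Adj v)).image c).card ≤ 2) (hvA : v ∉ A) :
    ∃ c', PC G (insert v A) c' ∧ (∀ a ∈ A, c' a = c a) := by
  obtain ⟨k, hk⟩ : ∃ k : Fin 3, k ∉ (A.filter (G.Adj v)).image c := by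
    by_contra hcon
    push Not at hcon
    have : (univ : Finset (Fin 3)) ⊆ (A.filter (G.Adj v)).image c := fun k _ => hcon k
    have h1 := card_le_card this
    simp only [card_univ, Fintype.card_fin] at h1
    omega
  have hk' : ∀ a ∈ A, G.Adj v a → c a ≠ k := by
    intro a ha hva he
    exact hk (mem_image.2 ⟨a, by simp [ha, hva], he⟩)
  have hne : ∀ a ∈ A, a ≠ v := fun a ha h => hvA (h ▸ ha)
  refine ⟨Function.update c v k, ?_, fun a ha => by simp [hne a ha]⟩
  intro a ha b hb hab
  rcases mem_insert.1 ha with rfl | ha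
  · rcases mem_insert.1 hb with rfl | hb
    · exact (hab.ne rfl).elim
    · simp only [Function.update_self, Function.update_of_ne (hne b hb)]
      exact (hk' b hb hab).symm
  · rcases mem_insert.1 hb with hb | hb
    · rw [hb] at hab ⊢
      simp only [Function.update_self, Function.update_of_ne (hne a ha)]
      exact hk' a ha hab.symm
    · simp only [Function.update_of_ne (hne a ha), Function.update_of_ne (hne b hb)]
      exact h a ha b hb hab

lemma PC.extend {c : V → Fin 3} (h : PC G A c) (hv : (A.filter (G.Adj v)).card ≤ 2) (hvA : v ∉ A) :
    ∃ c', PC G (insert v A) c' ∧ (∀ a ∈ A, c' a = c a) :=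
  h.extend_of_image (card_image_le.trans hv) hvA

/-- A colouring of the non-isolated vertices colours the graph. -/
lemma pc_univ_of_supp {c : V → Fin 3} (h : PC G (supp G) c) : PC G univ c :=
  fun a _ b _ hab => h a (mem_supp_left hab) b (mem_supp_right hab) hab

lemma Crit.not_pc_supp (hG : Crit G) {c : V → Fin 3} : ¬ PC G (supp G) c :=
  fun h => hG.1 c (pc_univ_of_supp h)

lemma nb_subset_supp : nb G v ⊆ supp G := fun _ hw => mem_supp_right (mem_nb.1 hw)

/-- A vertex of smaller degree could be coloured last. -/
lemma Crit.three_le_deg (hG : Crit G) (hv : v ∈ supp G) : 3 ≤ (nb G v).card := by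
  by_contra hlt
  obtain ⟨c, hc⟩ := hG.exists_pc hv (A := (supp G).erase v) (by simp)
  obtain ⟨c', hc', -⟩ := hc.extend (v := v) (by
    refine (card_le_card (t := nb G v) ?_).trans (by omega)
    intro a ha
    simp only [mem_filter] at ha
    exact mem_nb.2 ha.2) (by simp)
  rw [insert_erase hv] at hc'
  exact hG.not_pc_supp hc'

lemma Crit.supp_nonempty (hG : Crit G) : (supp G).Nonempty := by
  by_contra h
  rw [not_nonempty_iff_eq_empty] at h
  exact hG.not_pc_supp (c := fun _ => 0) (by rw [h]; intro a ha; simp at ha)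

lemma Crit.four_le_card (hG : Crit G) : 4 ≤ (supp G).card := by
  obtain ⟨v, hv⟩ := hG.supp_nonempty
  have h1 := hG.three_le_deg hv
  have h2 : insert v (nb G v) ⊆ supp G := insert_subset hv nb_subset_supp
  have h3 := card_le_card h2
  rw [card_insert_of_notMem (by simp)] at h3
  omega

/-! ### Edge counts -/

/-- The edges at a new vertex `x` are counted by its neighbours in `S`. -/
lemma eIn_insert (hx : x ∉ S) : eIn G (insert x S) = eIn G S + (S.filter (G.Adj x)).card := by
  have h1 : (univ.filter fun e : Sym2 V => e ∈ G.edgeSet ∧ ∀ v ∈ e, v ∈ insert x S) =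
      (univ.filter fun e : Sym2 V => e ∈ G.edgeSet ∧ ∀ v ∈ e, v ∈ S) ∪
        (S.filter (G.Adj x)).image (fun y => s(x, y)) := by
    ext e
    induction e using Sym2.ind with
    | _ a b =>
      simp only [mem_filter, mem_univ, true_and, mem_union, mem_image, SimpleGraph.mem_edgeSet,
        Sym2.mem_iff, forall_eq_or_imp, forall_eq, mem_insert, Sym2.eq_iff]
      constructor
      · rintro ⟨hab, ha, hb⟩
        rcases ha with rfl | ha
        · rcases hb with rfl | hb
          · exact (hab.ne rfl).elim
          · exact Or.inr ⟨b, ⟨hb, hab⟩, by simp⟩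
        · rcases hb with rfl | hb
          · exact Or.inr ⟨a, ⟨ha, hab.symm⟩, by simp⟩
          · exact Or.inl ⟨hab, ha, hb⟩
      · rintro (⟨hab, ha, hb⟩ | ⟨y, ⟨hy, hxy⟩, (⟨rfl, rfl⟩ | ⟨rfl, rfl⟩)⟩)
        · exact ⟨hab, Or.inr ha, Or.inr hb⟩
        · exact ⟨hxy, Or.inl rfl, Or.inr hy⟩
        · exact ⟨hxy.symm, Or.inr hy, Or.inl rfl⟩
  unfold eIn
  rw [h1, card_union_of_disjoint, card_image_of_injective]
  · intro a b hab
    exact Sym2.congr_right.1 hab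
  · rw [disjoint_left]
    intro e he he'
    simp only [mem_filter, mem_univ, true_and] at he
    obtain ⟨y, -, rfl⟩ := mem_image.1 he'
    exact hx (he.2 x (by simp))

lemma eIn_empty : eIn G ∅ = 0 := by
  unfold eIn
  rw [card_eq_zero, filter_eq_empty_iff]
  intro e _ he
  induction e using Sym2.ind with
  | _ a b => simpa using he.2 a (by simp)

lemma eIn_mono_graph (h : ∀ a ∈ S, ∀ b ∈ S, G.Adj a b → H.Adj a b) : eIn G S ≤ eIn H S := by
  refine card_le_card fun e he => ?_
  induction e using Sym2.ind with
  | _ a b =>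
    simp only [mem_filter, mem_univ, true_and, SimpleGraph.mem_edgeSet, Sym2.mem_iff,
      forall_eq_or_imp, forall_eq] at he ⊢
    exact ⟨h a he.2.1 b he.2.2 he.1, he.2⟩

lemma eIn_congr (h : ∀ a ∈ S, ∀ b ∈ S, G.Adj a b ↔ H.Adj a b) : eIn G S = eIn H S :=
  le_antisymm (eIn_mono_graph fun a ha b hb => (h a ha b hb).1)
    (eIn_mono_graph fun a ha b hb => (h a ha b hb).2)

lemma pot_congr (h : ∀ a ∈ S, ∀ b ∈ S, G.Adj a b ↔ H.Adj a b) : pot G S = pot H S := by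
  simp [pot, eIn_congr h]

lemma pot_mono_graph (h : ∀ a ∈ S, ∀ b ∈ S, G.Adj a b → H.Adj a b) : pot H S ≤ pot G S := by
  have := eIn_mono_graph h
  simp only [pot]; omega

/-- The handshake identity inside `S`. -/
lemma sum_deg_in : ∑ v ∈ S, (S.filter (G.Adj v)).card = 2 * eIn G S := by
  induction S using Finset.induction with
  | empty => simp [eIn_empty]
  | insert x S hx ih =>
    rw [sum_insert hx, eIn_insert hx, filter_insert, if_neg (G.loopless.irrefl x)]
    have h : ∀ v ∈ S, ((insert x S).filter (G.Adj v)).card =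
        (S.filter (G.Adj v)).card + if G.Adj x v then 1 else 0 := by
      intro v hv
      rw [filter_insert]
      by_cases hvx : G.Adj v x
      · rw [if_pos hvx, if_pos hvx.symm, card_insert_of_notMem (by simp [hx])]
      · rw [if_neg hvx, if_neg (fun h => hvx h.symm)]; rfl
    rw [sum_congr rfl h, sum_add_distrib, ih, ← card_filter]
    ring

lemma pot_insert (hx : x ∉ S) : pot G (insert x S) = pot G S + 5 - 3 * (S.filter (G.Adj x)).card := by
  simp only [pot, eIn_insert hx, card_insert_of_notMem hx]
  push_cast; ring

lemma eIn_le_choose : 2 * eIn G S ≤ S.card * (S.card - 1) := by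
  rw [← sum_deg_in]
  refine (sum_le_card_nsmul S _ (S.card - 1) fun v hv => ?_).trans (by simp)
  rw [← card_erase_of_mem hv]
  refine card_le_card fun a ha => ?_
  simp only [mem_filter, mem_erase] at ha ⊢
  exact ⟨ha.2.ne.symm, ha.1⟩

/-- Sets of two or three vertices have potential at least `6`. -/
lemma four_le_card_of_pot_le (h2 : 2 ≤ S.card) (h : pot G S ≤ 5) : 4 ≤ S.card := by
  by_contra hlt
  have h3 := eIn_le_choose (G := G) (S := S)
  have h4 : S.card = 2 ∨ S.card = 3 := by omega
  rcases h4 with h4 | h4 <;> simp only [pot, h4] at h h3 <;> omega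

lemma filter_adj_eq_nb (h : nb G v ⊆ S) : S.filter (G.Adj v) = nb G v := by
  ext a
  simp only [mem_filter, mem_nb]
  exact ⟨fun h => h.2, fun ha => ⟨h (mem_nb.2 ha), ha⟩⟩

lemma sum_deg : ∑ v ∈ supp G, (nb G v).card = 2 * eIn G (supp G) := by
  rw [← sum_deg_in]
  exact sum_congr rfl fun v _ => by rw [filter_adj_eq_nb nb_subset_supp]

/-- A critical graph on four vertices is complete. -/
lemma potG_of_card_four (hG : Crit G) (h : (supp G).card = 4) :
    potG G = 2 ∧ ∀ a ∈ supp G, ∀ b ∈ supp G, a ≠ b → G.Adj a b := by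
  have h1 : ∀ v ∈ supp G, nb G v = (supp G).erase v := by
    intro v hv
    refine eq_of_subset_of_card_le (fun a ha => ?_) ?_
    · exact mem_erase.2 ⟨(mem_nb.1 ha).ne.symm, nb_subset_supp ha⟩
    · rw [card_erase_of_mem hv, h]; exact hG.three_le_deg hv
  constructor
  · have h2 := sum_deg (G := G)
    rw [sum_congr rfl (fun v hv => by rw [h1 v hv, card_erase_of_mem hv, h]), sum_const, h] at h2
    simp only [potG, pot, h]
    simp at h2
    omega
  · intro a ha b hb hab
    have : b ∈ nb G a := by rw [h1 a ha]; exact mem_erase.2 ⟨hab.symm, hb⟩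
    simpa using this

lemma supp_mono (h : W ≤ G) : supp W ⊆ supp G := fun v hv => by
  obtain ⟨w, hw⟩ := mem_supp.1 hv
  exact mem_supp_left (h hw)

/-! ### Boundaries and added edges -/

/-- The vertices of `R` with a neighbour outside `R`. -/
def bd (G : SimpleGraph V) (R : Finset V) : Finset V := R.filter fun a => ∃ w, w ∉ R ∧ G.Adj a w

@[simp] lemma mem_bd : v ∈ bd G R ↔ v ∈ R ∧ ∃ w, w ∉ R ∧ G.Adj v w := by simp [bd]

lemma exists_mem_notMem (hR : R ⊆ S) (hne : R ≠ S) : ∃ v ∈ S, v ∉ R := by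
  by_contra h
  push Not at h
  exact hne (Subset.antisymm hR h)

/-- Critical graphs are `2`-connected: a proper vertex set has at least two boundary vertices. -/
lemma Crit.exists_bd (hG : Crit G) (hR : R ⊆ supp G) (hne : R ≠ supp G) (h2 : 2 ≤ R.card) :
    ∃ a ∈ bd G R, ∃ b ∈ bd G R, a ≠ b := by
  by_contra hcon
  push Not at hcon
  obtain ⟨a, haR, ha⟩ : ∃ a ∈ R, ∀ b ∈ bd G R, b = a := by
    by_cases hb : (bd G R).Nonempty
    · obtain ⟨a, ha⟩ := hb
      exact ⟨a, (mem_bd.1 ha).1, fun b hb => hcon b hb a ha⟩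
    · rw [not_nonempty_iff_eq_empty] at hb
      obtain ⟨a, ha⟩ := card_pos.1 (by omega : 0 < R.card)
      exact ⟨a, ha, fun b hb' => by rw [hb] at hb'; simp at hb'⟩
  obtain ⟨v, hv, hvR⟩ := exists_mem_notMem hR hne
  obtain ⟨c₁, h₁⟩ := hG.exists_pc hv hvR
  obtain ⟨v', hv', hva⟩ := exists_mem_ne (by omega : 1 < R.card) a
  obtain ⟨c₂, h₂⟩ := hG.exists_pc (A := insert a (supp G \ R)) (hR hv') (by simp [hva, hv'])
  let σ := Equiv.swap (c₂ a) (c₁ a)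
  have h₃ := h₂.perm σ
  have hσ : σ (c₂ a) = c₁ a := Equiv.swap_apply_left _ _
  refine hG.not_pc_supp (c := fun v => if v ∈ R then c₁ v else σ (c₂ v)) ?_
  intro p hp q hq hpq
  by_cases hpR : p ∈ R <;> by_cases hqR : q ∈ R <;> simp only [hpR, hqR, if_true, if_false]
  · exact h₁ p hpR q hqR hpq
  · have : p = a := ha p (mem_bd.2 ⟨hpR, q, hqR, hpq⟩)
    subst this
    rw [← hσ]
    exact h₃ p (by simp) q (by simp [hq, hqR]) hpq
  · have : q = a := ha q (mem_bd.2 ⟨hqR, p, hpR, hpq.symm⟩)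
    subst this
    rw [← hσ]
    exact h₃ p (by simp [hp, hpR]) q (by simp) hpq
  · exact h₃ p (by simp [hp, hpR]) q (by simp [hq, hqR]) hpq

/-- `W` is a critical subgraph of `G[A] + ab` that uses the new edge `ab`. If the edge is the only loss
of potential (field `exact`), then `W` contains all edges of `G` between its vertices. -/
structure AddEdge (G : SimpleGraph V) (A : Finset V) (a b : V) (W : SimpleGraph V) : Prop where
  crit : Crit W
  not_adj : ¬ G.Adj a b
  adj : W.Adj a b
  sub : supp W ⊆ A
  lift : ∀ x y, W.Adj x y → G.Adj x y ∨ (x = a ∧ y = b) ∨ (x = b ∧ y = a)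
  pot_le : pot G (supp W) ≤ potG W + 3
  exact : potG W + 3 ≤ pot G (supp W) →
    ∀ x ∈ supp W, ∀ y ∈ supp W, G.Adj x y → W.Adj x y

/-- If no colouring of a proper set `A` separates `a` and `b`, then `G[A] + ab` contains a critical
graph, which uses the new edge. -/
lemma Crit.exists_addEdge (hG : Crit G) (hv : v ∈ supp G) (hvA : v ∉ A) {a b : V} (ha : a ∈ A)
    (hb : b ∈ A) (hab : a ≠ b) (hsep : ∀ c, PC G A c → c a = c b) :
    ∃ W, AddEdge G A a b W := by
  obtain ⟨c₀, hc₀⟩ := hG.exists_pc hv hvA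
  have hnadj : ¬ G.Adj a b := fun h => hc₀ a ha b hb h (hsep c₀ hc₀)
  let H : SimpleGraph V :=
    { Adj := fun x y => x ∈ A ∧ y ∈ A ∧ (G.Adj x y ∨ (x = a ∧ y = b) ∨ (x = b ∧ y = a))
      symm := ⟨fun x y h => ⟨h.2.1, h.1, by
        rcases h.2.2 with h | h | h
        · exact Or.inl h.symm
        · exact Or.inr (Or.inr ⟨h.2, h.1⟩)
        · exact Or.inr (Or.inl ⟨h.2, h.1⟩)⟩⟩
      loopless := ⟨fun x h => by
        rcases h.2.2 with h | h | h
        · exact h.ne rfl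
        · exact hab (h.1.symm.trans h.2)
        · exact hab (h.2.symm.trans h.1)⟩ }
  obtain ⟨W, hWH, hW⟩ := exists_crit_le (H := H) (fun c hc => by
    have h1 : PC G A c := fun x hx y hy hxy => hc x (mem_univ _) y (mem_univ _) ⟨hx, hy, Or.inl hxy⟩
    exact hc a (mem_univ _) b (mem_univ _) ⟨ha, hb, Or.inr (Or.inl ⟨rfl, rfl⟩)⟩ (hsep c h1))
  have hlift : ∀ x y, W.Adj x y → G.Adj x y ∨ (x = a ∧ y = b) ∨ (x = b ∧ y = a) :=
    fun x y h => (hWH h).2.2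
  have hadj : W.Adj a b := by
    by_contra hn
    refine hW.1 c₀ fun x _ y _ hxy => ?_
    have h := hWH hxy
    rcases h.2.2 with h' | ⟨rfl, rfl⟩ | ⟨rfl, rfl⟩
    · exact hc₀ x h.1 y h.2.1 h'
    · exact (hn hxy).elim
    · exact (hn hxy.symm).elim
  have hsub : (univ.filter fun e : Sym2 V => e ∈ W.edgeSet ∧ ∀ v ∈ e, v ∈ supp W) ⊆
      insert s(a, b) (univ.filter fun e : Sym2 V => e ∈ G.edgeSet ∧ ∀ v ∈ e, v ∈ supp W) := by
    intro e he
    induction e using Sym2.ind with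
    | _ x y =>
      simp only [mem_filter, mem_univ, true_and, SimpleGraph.mem_edgeSet] at he
      simp only [mem_insert, mem_filter, mem_univ, true_and, SimpleGraph.mem_edgeSet]
      rcases hlift x y he.1 with h | ⟨rfl, rfl⟩ | ⟨rfl, rfl⟩
      · exact Or.inr ⟨h, he.2⟩
      · exact Or.inl rfl
      · exact Or.inl Sym2.eq_swap
  have hnot : s(a, b) ∉ (univ.filter fun e : Sym2 V => e ∈ G.edgeSet ∧ ∀ v ∈ e, v ∈ supp W) := by
    simp [hnadj]
  have hcard := card_le_card hsub
  rw [card_insert_of_notMem hnot] at hcard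
  refine ⟨W, hW, hnadj, hadj, fun x hx => ?_, hlift, ?_, fun hpot x hx y hy hxy => ?_⟩
  · obtain ⟨y, hxy⟩ := mem_supp.1 hx
    exact (hWH hxy).1
  · simp only [potG, pot, eIn]
    omega
  · have heq := eq_of_subset_of_card_le hsub (by
      rw [card_insert_of_notMem hnot]
      simp only [potG, pot, eIn] at hpot
      omega)
    have : s(x, y) ∈ (univ.filter fun e : Sym2 V => e ∈ W.edgeSet ∧ ∀ v ∈ e, v ∈ supp W) := by
      rw [heq]
      simp only [mem_insert, mem_filter, mem_univ, true_and, SimpleGraph.mem_edgeSet, Sym2.mem_iff,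
        forall_eq_or_imp, forall_eq]
      exact Or.inr ⟨hxy, hx, hy⟩
    simpa using (mem_filter.1 this).2.1

/-! ### Contracting a coloured set to a triangle -/

/-- The edges of `G` inside `S` that are not inside `R`. -/
def eX (G : SimpleGraph V) (S R : Finset V) : Finset (Sym2 V) :=
  univ.filter fun e => e ∈ G.edgeSet ∧ (∀ v ∈ e, v ∈ S) ∧ ¬ ∀ v ∈ e, v ∈ R

lemma mk_mem_eX : s(x, y) ∈ eX G S R ↔ G.Adj x y ∧ (x ∈ S ∧ y ∈ S) ∧ ¬ (x ∈ R ∧ y ∈ R) := by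
  simp only [eX, mem_filter, mem_univ, true_and, SimpleGraph.mem_edgeSet, Sym2.mem_iff,
    forall_eq_or_imp, forall_eq]

lemma eIn_eq_add (h : R ⊆ S) : eIn G S = eIn G R + (eX G S R).card := by
  unfold eIn eX
  rw [← card_union_of_disjoint]
  · congr 1
    ext e
    simp only [mem_filter, mem_univ, true_and, mem_union]
    constructor
    · rintro ⟨h1, h2⟩
      by_cases h3 : ∀ v ∈ e, v ∈ R
      · exact Or.inl ⟨h1, h3⟩
      · exact Or.inr ⟨h1, h2, h3⟩
    · rintro (⟨h1, h2⟩ | ⟨h1, h2, -⟩)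
      · exact ⟨h1, fun v hv => h (h2 v hv)⟩
      · exact ⟨h1, h2⟩
  · rw [disjoint_left]
    intro e he he'
    simp only [mem_filter, mem_univ, true_and] at he he'
    exact he'.2.2 he.2

/-- Let `W` arise from `G` by shrinking `R` to `Xs`. If the edges of `W` at `B` come from distinct edges of
`G` along a map `f`, then the potentials of `R ∪ B` in `G` and of `Xs ∪ B` in `W` are compared; the
number `l` counts the edges of `G` that are lost, and if none is lost, then `f` is a bijection. -/
lemma pot_union_lift {Xs : Finset V} (hX : Xs ⊆ R) (hB : Disjoint B R)
    {E : Finset (Sym2 V)} {f : Sym2 V → Sym2 V} (hE : E = eX W (Xs ∪ B) Xs)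
    (hf : ∀ e ∈ E, ∃ e' ∈ eX G (R ∪ B) R, f e' = e) :
    ∃ l : ℕ, pot G (R ∪ B) + pot W Xs + 3 * l = pot G R + pot W (Xs ∪ B) ∧
      (l = 0 → (∀ e ∈ eX G (R ∪ B) R, f e ∈ E) ∧
        ∀ e ∈ eX G (R ∪ B) R, ∀ e' ∈ eX G (R ∪ B) R, f e = f e' → e = e') := by
  have hsub : E ⊆ (eX G (R ∪ B) R).image f := fun e he => by
    obtain ⟨e', h, rfl⟩ := hf e he
    exact mem_image_of_mem _ h
  have h1 := card_le_card hsub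
  have h2 := card_image_le (s := eX G (R ∪ B) R) (f := f)
  have h3 := eIn_eq_add (G := G) (subset_union_left (s₁ := R) (s₂ := B))
  have h4 := eIn_eq_add (G := W) (subset_union_left (s₁ := Xs) (s₂ := B))
  rw [← hE] at h4
  have h5 := card_union_of_disjoint hB.symm
  have h6 := card_union_of_disjoint (disjoint_of_subset_left hX hB.symm)
  refine ⟨(eX G (R ∪ B) R).card - E.card, ?_, fun hl => ?_⟩
  · simp only [pot, h3, h4, h5, h6]
    push_cast [Nat.cast_sub (h1.trans h2)]
    ring
  · have h7 : (eX G (R ∪ B) R).card ≤ E.card := by omega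
    have h8 : E = (eX G (R ∪ B) R).image f := eq_of_subset_of_card_le hsub (h2.trans h7)
    refine ⟨fun e he => h8 ▸ mem_image_of_mem _ he, ?_⟩
    have h9 : ((eX G (R ∪ B) R).image f).card = (eX G (R ∪ B) R).card := by
      rw [← h8]; omega
    intro e he e' he' hee
    exact (card_image_iff.1 h9) he he' hee

/-- `W` is critical and arises from a proper colouring `φ` of `G[R]`: the set `R` is replaced by a
triangle with one vertex `ρ r` for each colour class, and `W` is a critical subgraph of the result.
The number `l` counts the edges that meet `W` outside `R` and that `W` does not use. -/
structure Contr (G : SimpleGraph V) (R : Finset V) (φ : V → Fin 3) (ρ : V → V)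
    (W : SimpleGraph V) (l : ℕ) : Prop where
  crit : Crit W
  lt : (supp W).card < (supp G).card
  sub : supp W ⊆ supp G
  rho_mem : ∀ r, ρ r ∈ R
  rho_iff : ∀ r r', ρ r = ρ r' ↔ φ r = φ r'
  ne : (supp W ∩ R).Nonempty
  card_le : (supp W ∩ R).card ≤ 3
  out : ∀ q v, q ∉ R → v ∉ R → W.Adj q v → G.Adj q v
  cross : ∀ q x, q ∉ R → x ∈ R → W.Adj q x → ∃ r ∈ R, ρ r = x ∧ G.Adj q r
  pot_eq : pot G (R ∪ supp W) + pot W (supp W ∩ R) + 3 * l = pot G R + potG W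
  exact : l = 0 → (∀ q ∈ supp W, q ∉ R → ∀ v ∈ supp W, v ∉ R → G.Adj q v → W.Adj q v) ∧
    (∀ q ∈ supp W, q ∉ R → ∀ r ∈ R, G.Adj q r → W.Adj q (ρ r)) ∧
    (∀ q ∈ supp W, q ∉ R → ∀ r ∈ R, ∀ r' ∈ R, G.Adj q r → G.Adj q r' → φ r = φ r' → r = r')

/-- Each proper colouring `φ` of a proper subset `R` of a critical graph gives rise to a smaller critical
graph: if the graph with `R` contracted to a triangle along `φ` were `3`-colourable, then so would be
`G`. -/
lemma Crit.exists_contr (hG : Crit G) (hR : R ⊆ supp G) (hne : R ≠ supp G) (h4 : 4 ≤ R.card)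
    {φ : V → Fin 3} (hφ : PC G R φ) : ∃ ρ W l, Contr G R φ ρ W l := by
  -- three vertices of `R` serve as the vertices of the triangle, so that no new type is needed
  obtain ⟨t, htR, ht3⟩ := exists_subset_card_eq (show 3 ≤ R.card by omega)
  let ι' : Fin 3 ≃ t := (t.equivFinOfCardEq ht3).symm
  let ι : Fin 3 → V := fun i => ι' i
  have hι : Function.Injective ι := fun i j h => ι'.injective (Subtype.ext h)
  have hιR : ∀ i, ι i ∈ R := fun i => htR (ι' i).2
  let f : V → V := fun v => if v ∈ R then ι (φ v) else v
  have hfR : ∀ v ∈ R, f v = ι (φ v) := fun v hv => if_pos hv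
  have hfn : ∀ v, v ∉ R → f v = v := fun v hv => if_neg hv
  have hfmem : ∀ v, f v ∈ R ↔ v ∈ R := fun v => by
    by_cases hv : v ∈ R
    · simp [hfR v hv, hιR, hv]
    · simp [hfn v hv, hv]
  let Y : SimpleGraph V :=
    { Adj := fun a b => a ≠ b ∧ ((∃ a' b', f a' = a ∧ f b' = b ∧ G.Adj a' b' ∧ ¬ (a' ∈ R ∧ b' ∈ R)) ∨
        ∃ i j, a = ι i ∧ b = ι j)
      symm := ⟨by
        rintro a b ⟨hab, h⟩
        refine ⟨hab.symm, ?_⟩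
        rcases h with ⟨a', b', h1, h2, h3, h4⟩ | ⟨i, j, h1, h2⟩
        · exact Or.inl ⟨b', a', h2, h1, h3.symm, fun h => h4 ⟨h.2, h.1⟩⟩
        · exact Or.inr ⟨j, i, h2, h1⟩⟩
      loopless := ⟨fun a h => h.1 rfl⟩ }
  obtain ⟨v₀, hv₀, hv₀R⟩ := exists_mem_notMem hR hne
  -- a colouring of the contracted graph would extend `φ` to `G`, after permuting the colours
  obtain ⟨W, hWY, hW⟩ := exists_crit_le (H := Y) (fun c hc => by
    have hinj : Function.Injective (c ∘ ι) := by
      intro i j hij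
      by_contra hne
      exact hc (ι i) (mem_univ _) (ι j) (mem_univ _)
        ⟨fun h => hne (hι h), Or.inr ⟨i, j, rfl, rfl⟩⟩ hij
    let σ : Equiv.Perm (Fin 3) := Equiv.ofBijective _ (Finite.injective_iff_bijective.1 hinj)
    have hσ : ∀ i, σ.symm (c (ι i)) = i := fun i => σ.symm_apply_apply i
    refine hG.1 (fun v => σ.symm (c (f v))) fun a _ b _ hab => ?_
    by_cases h : a ∈ R ∧ b ∈ R
    · simp only [hfR a h.1, hfR b h.2, hσ]
      exact hφ a h.1 b h.2 hab
    · intro he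
      have hcf : c (f a) = c (f b) := σ.symm.injective he
      have hfab : f a ≠ f b := by
        intro hf
        by_cases haR : a ∈ R
        · exact h ⟨haR, by rw [← hfmem, ← hf, hfmem]; exact haR⟩
        · have hbR : b ∉ R := by rw [← hfmem, ← hf, hfmem]; exact haR
          rw [hfn a haR, hfn b hbR] at hf
          exact hab.ne hf
      exact hc (f a) (mem_univ _) (f b) (mem_univ _)
        ⟨hfab, Or.inl ⟨a, b, rfl, rfl, hab, h⟩⟩ hcf)
  have hout : ∀ q v, q ∉ R → v ∉ R → W.Adj q v → G.Adj q v := by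
    intro q v hq hv hqv
    rcases (hWY hqv).2 with ⟨a', b', h1, h2, h3, h4⟩ | ⟨i, j, h1, -⟩
    · have ha' : a' ∉ R := by rw [← hfmem, h1]; exact hq
      have hb' : b' ∉ R := by rw [← hfmem, h2]; exact hv
      rw [hfn a' ha'] at h1
      rw [hfn b' hb'] at h2
      subst h1 h2
      exact h3
    · exact (hq (h1 ▸ hιR i)).elim
  have hcross : ∀ q x, q ∉ R → x ∈ R → W.Adj q x → ∃ r ∈ R, ι (φ r) = x ∧ G.Adj q r := by
    intro q x hq hx hqx
    rcases (hWY hqx).2 with ⟨a', b', h1, h2, h3, h4⟩ | ⟨i, j, h1, -⟩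
    · have ha' : a' ∉ R := by rw [← hfmem, h1]; exact hq
      have hb' : b' ∈ R := by rw [← hfmem, h2]; exact hx
      rw [hfn a' ha'] at h1
      rw [hfR b' hb'] at h2
      subst h1
      exact ⟨b', hb', h2, h3⟩
    · exact (hq (h1 ▸ hιR i)).elim
  have hmemt : ∀ x ∈ supp W, x ∈ R → x ∈ t := by
    intro x hx hxR
    obtain ⟨y, hxy⟩ := mem_supp.1 hx
    rcases (hWY hxy).2 with ⟨a', b', h1, h2, h3, h4⟩ | ⟨i, j, h1, -⟩
    · have ha' : a' ∈ R := by rw [← hfmem, h1]; exact hxR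
      rw [hfR a' ha'] at h1
      rw [← h1]; exact (ι' _).2
    · rw [h1]; exact (ι' _).2
  have hsub : supp W ⊆ supp G := by
    intro q hq
    by_cases hqR : q ∈ R
    · exact hR hqR
    · obtain ⟨y, hy⟩ := mem_supp.1 hq
      by_cases hyR : y ∈ R
      · obtain ⟨r, -, -, h⟩ := hcross q y hqR hyR hy
        exact mem_supp_left h
      · exact mem_supp_left (hout q y hqR hyR hy)
  have hXt : supp W ∩ R ⊆ t := fun x hx => hmemt x (mem_inter.1 hx).1 (mem_inter.1 hx).2
  have hXne : (supp W ∩ R).Nonempty := by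
    by_contra hem
    rw [not_nonempty_iff_eq_empty] at hem
    have hnR : ∀ x ∈ supp W, x ∉ R := fun x hx hxR => by
      have : x ∈ supp W ∩ R := mem_inter.2 ⟨hx, hxR⟩
      rw [hem] at this; simp at this
    have hWG : W ≤ G := fun a b hab =>
      hout a b (hnR a (mem_supp_left hab)) (hnR b (mem_supp_right hab)) hab
    have := hG.eq_of_le hW hWG
    subst this
    obtain ⟨r, hr⟩ := card_pos.1 (by omega : 0 < R.card)
    exact hnR r (hR hr) hr
  have hX3 : (supp W ∩ R).card ≤ 3 := ht3 ▸ card_le_card hXt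
  have hltc : (supp W).card < (supp G).card := by
    have h1 : supp W ⊆ (supp W ∩ R) ∪ (supp G \ R) := by
      intro x hx
      by_cases hxR : x ∈ R
      · exact mem_union_left _ (mem_inter.2 ⟨hx, hxR⟩)
      · exact mem_union_right _ (mem_sdiff.2 ⟨hsub hx, hxR⟩)
    have h2 := (card_le_card h1).trans (card_union_le _ _)
    rw [card_sdiff_of_subset hR] at h2
    have h3 := card_le_card hR
    omega
  have hB : Disjoint (supp W \ R) R := sdiff_disjoint
  have hlift : ∀ e ∈ eX W ((supp W ∩ R) ∪ (supp W \ R)) (supp W ∩ R),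
      ∃ e' ∈ eX G (R ∪ (supp W \ R)) R, Sym2.map f e' = e := by
    intro e he
    induction e using Sym2.ind with
    | _ a b =>
      rw [mk_mem_eX] at he
      obtain ⟨hab, -, hn⟩ := he
      have ha := mem_supp_left hab
      have hb := mem_supp_right hab
      have hn' : ¬ (a ∈ R ∧ b ∈ R) := fun h => hn ⟨mem_inter.2 ⟨ha, h.1⟩, mem_inter.2 ⟨hb, h.2⟩⟩
      by_cases haR : a ∈ R
      · have hbR : b ∉ R := fun h => hn' ⟨haR, h⟩
        obtain ⟨r, hr, hra, hbr⟩ := hcross b a hbR haR hab.symm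
        refine ⟨s(r, b), mk_mem_eX.2 ⟨hbr.symm, ⟨mem_union_left _ hr,
          mem_union_right _ (mem_sdiff.2 ⟨hb, hbR⟩)⟩, fun h => hbR h.2⟩, ?_⟩
        rw [Sym2.map_mk]; simp [hfR r hr, hra, hfn b hbR]
      · by_cases hbR : b ∈ R
        · obtain ⟨r, hr, hra, har⟩ := hcross a b haR hbR hab
          refine ⟨s(a, r), mk_mem_eX.2 ⟨har, ⟨mem_union_right _ (mem_sdiff.2 ⟨ha, haR⟩),
            mem_union_left _ hr⟩, fun h => haR h.1⟩, ?_⟩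
          rw [Sym2.map_mk]; simp [hfR r hr, hra, hfn a haR]
        · refine ⟨s(a, b), mk_mem_eX.2 ⟨hout a b haR hbR hab,
            ⟨mem_union_right _ (mem_sdiff.2 ⟨ha, haR⟩),
            mem_union_right _ (mem_sdiff.2 ⟨hb, hbR⟩)⟩, fun h => haR h.1⟩, ?_⟩
          rw [Sym2.map_mk]; simp [hfn a haR, hfn b hbR]
  obtain ⟨l, hl, hex⟩ := pot_union_lift (G := G) (W := W) inter_subset_right hB rfl hlift
  have hU1 : (supp W ∩ R) ∪ (supp W \ R) = supp W := by
    ext a; simp only [mem_union, mem_inter, mem_sdiff]; tauto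
  have hU2 : R ∪ (supp W \ R) = R ∪ supp W := union_sdiff_self_eq_union
  rw [hU1, hU2] at hl hex
  refine ⟨fun r => ι (φ r), W, l, hW, hltc, hsub, fun r => hιR _, fun r r' => hι.eq_iff, hXne, hX3,
    hout, hcross, hl, fun hl0 => ?_⟩
  obtain ⟨hex1, hex2⟩ := hex hl0
  refine ⟨fun q hq hqR v hv hvR hqv => ?_, fun q hq hqR r hr hqr => ?_,
    fun q hq hqR r hr r' hr' h h' hrr => ?_⟩
  · have := hex1 s(q, v) (mk_mem_eX.2 ⟨hqv, ⟨mem_union_right _ hq, mem_union_right _ hv⟩,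
      fun h => hqR h.1⟩)
    rw [Sym2.map_mk] at this
    simp only [hfn q hqR, hfn v hvR] at this
    exact (mk_mem_eX.1 this).1
  · have := hex1 s(q, r) (mk_mem_eX.2 ⟨hqr, ⟨mem_union_right _ hq, mem_union_left _ hr⟩,
      fun h => hqR h.1⟩)
    rw [Sym2.map_mk] at this
    simp only [hfn q hqR, hfR r hr] at this
    exact (mk_mem_eX.1 this).1
  · have := hex2 s(q, r) (mk_mem_eX.2 ⟨h, ⟨mem_union_right _ hq, mem_union_left _ hr⟩,
      fun h => hqR h.1⟩) s(q, r') (mk_mem_eX.2 ⟨h', ⟨mem_union_right _ hq, mem_union_left _ hr'⟩,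
      fun h => hqR h.1⟩) (by
        rw [Sym2.map_mk, Sym2.map_mk]; simp [hfR r hr, hfR r' hr', hrr])
    exact Sym2.congr_right.1 this

/-- Sets that are added to `R` lower its potential as they lower that of a part of the triangle. -/
lemma Contr.pot_union_le {φ : V → Fin 3} {ρ : V → V} {l : ℕ} (h : Contr G R φ ρ W l)
    {Xs : Finset V} (hX : Xs ⊆ R) (hB : Disjoint B R) :
    pot G (R ∪ B) + pot W Xs ≤ pot G R + pot W (Xs ∪ B) := by
  let f : V → V := fun v => if v ∈ R then ρ v else v
  have hfR : ∀ v ∈ R, f v = ρ v := fun v hv => if_pos hv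
  have hfn : ∀ v, v ∉ R → f v = v := fun v hv => if_neg hv
  obtain ⟨l', hl, -⟩ := pot_union_lift (G := G) (W := W) (f := Sym2.map f) hX hB rfl (by
    intro e he
    induction e using Sym2.ind with
    | _ a b =>
      rw [mk_mem_eX] at he
      obtain ⟨hab, ⟨ha, hb⟩, hn⟩ := he
      by_cases haX : a ∈ Xs
      · have hbB : b ∈ B := (mem_union.1 hb).resolve_left fun h => hn ⟨haX, h⟩
        have hbR := disjoint_left.1 hB hbB
        obtain ⟨r, hr, hra, hbr⟩ := h.cross b a hbR (hX haX) hab.symm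
        refine ⟨s(r, b), mk_mem_eX.2 ⟨hbr.symm, ⟨mem_union_left _ hr,
          mem_union_right _ hbB⟩, fun h => hbR h.2⟩, ?_⟩
        rw [Sym2.map_mk]; simp [hfR r hr, hra, hfn b hbR]
      · have haB : a ∈ B := (mem_union.1 ha).resolve_left haX
        have haR := disjoint_left.1 hB haB
        by_cases hbX : b ∈ Xs
        · obtain ⟨r, hr, hra, har⟩ := h.cross a b haR (hX hbX) hab
          refine ⟨s(a, r), mk_mem_eX.2 ⟨har, ⟨mem_union_right _ haB,
            mem_union_left _ hr⟩, fun h => haR h.1⟩, ?_⟩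
          rw [Sym2.map_mk]; simp [hfR r hr, hra, hfn a haR]
        · have hbB : b ∈ B := (mem_union.1 hb).resolve_left hbX
          have hbR := disjoint_left.1 hB hbB
          refine ⟨s(a, b), mk_mem_eX.2 ⟨h.out a b haR hbR hab,
            ⟨mem_union_right _ haB, mem_union_right _ hbB⟩, fun h => haR h.1⟩, ?_⟩
          rw [Sym2.map_mk]; simp [hfn a haR, hfn b hbR])
  omega

/-! ### Identifying two neighbours of a vertex of degree three -/

/-- `W` is a critical subgraph of the graph obtained by deleting `x` and `y` and identifying the
neighbours `u` and `v` of `x`; the new vertex is called `u`. -/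
structure Ident (G : SimpleGraph V) (x y u v : V) (W : SimpleGraph V) : Prop where
  crit : Crit W
  mem : u ∈ supp W
  sub : supp W ⊆ supp G
  x_notMem : x ∉ supp W
  y_notMem : y ∉ supp W
  v_notMem : v ∉ supp W
  out : ∀ a b, a ≠ u → b ≠ u → W.Adj a b → G.Adj a b
  cross : ∀ a, W.Adj u a → G.Adj u a ∨ G.Adj v a
  pot_le : pot G (insert x (insert v (supp W))) ≤ potG W + 4
  exact : potG W + 4 ≤ pot G (insert x (insert v (supp W))) →
    (∀ a ∈ supp W, ∀ b ∈ supp W, G.Adj a b → W.Adj a b) ∧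
    (∀ a ∈ supp W, G.Adj v a → W.Adj u a) ∧ ∀ a ∈ supp W, ¬ (G.Adj u a ∧ G.Adj v a)
  deg_three : ∀ t, (nb G t).card = 3 → t ≠ x → G.Adj t y → t ≠ u → t ≠ v → t ∉ supp W

lemma pot_singleton : pot G {x} = 5 := by
  have h := pot_insert (G := G) (x := x) (S := ∅) (by simp)
  simpa [pot, eIn_empty] using h

/-- A colouring of the identified graph would colour `G`: first `u` and `v` get the same colour, then `y`
has two coloured neighbours, and finally `x` sees two colours only. -/
lemma Crit.exists_ident (hG : Crit G) (hxy : G.Adj x y) (hy : (nb G y).card = 3)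
    (hx : nb G x = {y, u, v}) (huv : u ≠ v) (huy : u ≠ y) (hvy : v ≠ y) (hn : ¬ G.Adj u v) :
    ∃ W, Ident G x y u v W := by
  have hxu : G.Adj x u := by rw [← mem_nb, hx]; simp
  have hxv : G.Adj x v := by rw [← mem_nb, hx]; simp
  let f : V → V := fun a => if a = v then u else a
  have hfv : f v = u := if_pos rfl
  have hfn : ∀ a, a ≠ v → f a = a := fun a ha => if_neg ha
  let I : SimpleGraph V :=
    { Adj := fun a b => (a ≠ b ∧ (a ≠ x ∧ a ≠ y ∧ a ≠ v) ∧ (b ≠ x ∧ b ≠ y ∧ b ≠ v)) ∧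
        (G.Adj a b ∨ (a = u ∧ G.Adj v b) ∨ (b = u ∧ G.Adj v a))
      symm := ⟨fun a b h => ⟨⟨h.1.1.symm, h.1.2.2, h.1.2.1⟩, by
        rcases h.2 with h | h | h
        · exact Or.inl h.symm
        · exact Or.inr (Or.inr h)
        · exact Or.inr (Or.inl h)⟩⟩
      loopless := ⟨fun a h => h.1.1 rfl⟩ }
  obtain ⟨W, hWI, hW⟩ := exists_crit_le (H := I) (fun c hc => by
    rw [pc_univ_iff] at hc
    let c₁ : V → Fin 3 := fun a => c (f a)
    have h1 : PC G ((supp G).erase x |>.erase y) c₁ := by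
      intro a ha b hb hab
      simp only [mem_erase] at ha hb
      by_cases hav : a = v
      · subst hav
        have hba : b ≠ a := hab.ne.symm
        simp only [c₁, hfv, hfn b hba]
        refine hc u b ⟨⟨fun h => hn (h ▸ hab.symm), ⟨hxu.ne.symm, huy, huv⟩,
          ⟨hb.2.1, hb.1, hba⟩⟩, Or.inr (Or.inl ⟨rfl, hab⟩)⟩
      · by_cases hbv : b = v
        · subst hbv
          simp only [c₁, hfv, hfn a hav]
          refine hc a u ⟨⟨fun h => hn (h ▸ hab), ⟨ha.2.1, ha.1, hav⟩, ⟨hxu.ne.symm, huy, huv⟩⟩,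
            Or.inr (Or.inr ⟨rfl, hab.symm⟩)⟩
        · simp only [c₁, hfn a hav, hfn b hbv]
          exact hc a b ⟨⟨hab.ne, ⟨ha.2.1, ha.1, hav⟩, ⟨hb.2.1, hb.1, hbv⟩⟩, Or.inl hab⟩
    obtain ⟨c₂, h2, h2'⟩ := h1.extend (v := y) (by
      have : (((supp G).erase x).erase y).filter (G.Adj y) ⊆ (nb G y).erase x := by
        intro a ha
        simp only [mem_filter, mem_erase] at ha
        simp [ha.1.2.1, ha.2]
      refine (card_le_card this).trans ?_
      rw [card_erase_of_mem (mem_nb.2 hxy.symm), hy]) (by simp)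
    rw [insert_erase (by simp [hxy.ne.symm, -mem_supp, mem_supp_right hxy])] at h2
    obtain ⟨c₃, h3, -⟩ := h2.extend_of_image (v := x) (by
      have : (((supp G).erase x).filter (G.Adj x)).image c₂ ⊆ {c₂ y, c₂ u} := by
        intro k hk
        obtain ⟨a, ha, rfl⟩ := mem_image.1 hk
        have ha' : a ∈ nb G x := mem_nb.2 (mem_filter.1 ha).2
        rw [hx] at ha'
        simp only [mem_insert, mem_singleton] at ha'
        rcases ha' with rfl | rfl | rfl
        · simp
        · simp
        · have e1 : c₂ a = c₁ a := h2' a (by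
            simp [hvy, hxv.ne.symm, -mem_supp, mem_supp_right hxv])
          have e2 : c₂ u = c₁ u := h2' u (by
            simp [huy, hxu.ne.symm, -mem_supp, mem_supp_right hxu])
          have e3 : c₁ a = c₁ u := by simp only [c₁, hfv, hfn u huv]
          simp [e1, e2, e3]
      exact (card_le_card this).trans card_le_two) (by simp)
    rw [insert_erase (mem_supp_left hxy)] at h3
    exact hG.not_pc_supp h3)
  have hxn : x ∉ supp W := fun h => by
    obtain ⟨a, ha⟩ := mem_supp.1 h; exact (hWI ha).1.2.1.1 rfl
  have hyn : y ∉ supp W := fun h => by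
    obtain ⟨a, ha⟩ := mem_supp.1 h; exact (hWI ha).1.2.1.2.1 rfl
  have hvn : v ∉ supp W := fun h => by
    obtain ⟨a, ha⟩ := mem_supp.1 h; exact (hWI ha).1.2.1.2.2 rfl
  have hout : ∀ a b, a ≠ u → b ≠ u → W.Adj a b → G.Adj a b := by
    intro a b ha hb hab
    rcases (hWI hab).2 with h | h | h
    · exact h
    · exact (ha h.1).elim
    · exact (hb h.1).elim
  have hcross : ∀ a, W.Adj u a → G.Adj u a ∨ G.Adj v a := by
    intro a ha
    rcases (hWI ha).2 with h | h | h
    · exact Or.inl h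
    · exact Or.inr h.2
    · exact ((hWI ha).1.1 h.1.symm).elim
  have hu : u ∈ supp W := by
    by_contra hu
    have hWG : W ≤ G := fun a b hab => hout a b (fun h => hu (h ▸ mem_supp_left hab))
      (fun h => hu (h ▸ mem_supp_right hab)) hab
    have := hG.eq_of_le hW hWG
    subst this
    exact hxn (mem_supp_left hxy)
  have hsub : supp W ⊆ supp G := by
    intro a ha
    by_cases hau : a = u
    · subst hau; exact mem_supp_right hxu
    · obtain ⟨b, hb⟩ := mem_supp.1 ha
      by_cases hbu : b = u
      · subst hbu
        rcases hcross a hb.symm with h | h <;> exact mem_supp_right h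
      · exact mem_supp_left (hout a b hau hbu hb)
  -- the contraction of `{u, v}` to `u` maps edges of `G` onto the edges of `W`
  have hB : Disjoint ((supp W).erase u) {u, v} := by
    rw [disjoint_left]
    intro a ha hb
    simp only [mem_insert, mem_singleton] at hb
    rcases hb with rfl | rfl
    · simp at ha
    · exact hvn (mem_of_mem_erase ha)
  have hU1 : ({u} : Finset V) ∪ (supp W).erase u = supp W := by
    rw [← insert_eq, insert_erase hu]
  have hU2 : ({u, v} : Finset V) ∪ (supp W).erase u = insert v (supp W) := by
    conv_rhs => rw [← insert_erase hu]
    ext a; simp; tauto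
  obtain ⟨l, hl, hex⟩ := pot_union_lift (G := G) (W := W) (R := {u, v}) (Xs := {u})
    (f := Sym2.map f) (by simp) hB rfl (by
    intro e he
    induction e using Sym2.ind with
    | _ a b =>
      rw [hU1, mk_mem_eX] at he
      obtain ⟨hab, ⟨ha, hb⟩, hne⟩ := he
      have hav : a ≠ v := fun h => hvn (h ▸ ha)
      have hbv : b ≠ v := fun h => hvn (h ▸ hb)
      rw [hU2]
      by_cases hau : a = u
      · subst hau
        have hba : b ≠ a := hab.ne.symm
        rcases hcross b hab with h | h
        · refine ⟨s(a, b), mk_mem_eX.2 ⟨h, ⟨by simp [hu, -mem_supp], by simp [hb, -mem_supp]⟩, ?_⟩, ?_⟩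
          · simp [hba, hbv]
          · rw [Sym2.map_mk]; simp [hfn _ hav, hfn _ hbv]
        · refine ⟨s(v, b), mk_mem_eX.2 ⟨h, ⟨by simp, by simp [hb, -mem_supp]⟩, ?_⟩, ?_⟩
          · simp [hba, hbv]
          · rw [Sym2.map_mk]; simp [hfv, hfn _ hbv]
      · by_cases hbu : b = u
        · subst hbu
          rcases hcross a hab.symm with h | h
          · refine ⟨s(a, b), mk_mem_eX.2 ⟨h.symm, ⟨by simp [ha, -mem_supp],
              by simp [hu, -mem_supp]⟩, ?_⟩, ?_⟩
            · simp [hau, hav]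
            · rw [Sym2.map_mk]; simp [hfn _ hav, hfn _ hbv]
          · refine ⟨s(a, v), mk_mem_eX.2 ⟨h.symm, ⟨by simp [ha, -mem_supp], by simp⟩, ?_⟩, ?_⟩
            · simp [hau, hav]
            · rw [Sym2.map_mk]; simp [hfv, hfn _ hav]
        · refine ⟨s(a, b), mk_mem_eX.2 ⟨hout a b hau hbu hab, ⟨by simp [ha, -mem_supp],
            by simp [hb, -mem_supp]⟩, ?_⟩, ?_⟩
          · simp [hau, hav]
          · rw [Sym2.map_mk]; simp [hfn _ hav, hfn _ hbv])
  rw [hU2, hU1] at hl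
  have hp2 : pot G {u, v} = 10 := by
    rw [pot_insert (by simpa using huv), pot_singleton, filter_singleton, if_neg hn]; simp
  rw [pot_singleton, hp2] at hl
  have hxi : x ∉ insert v (supp W) := by simp [hxn, hxv.ne, -mem_supp]
  have hpx := pot_insert (G := G) hxi
  have hpx2 : 2 ≤ ((insert v (supp W)).filter (G.Adj x)).card := by
    rw [← card_pair huv]
    refine card_le_card fun a ha => ?_
    simp only [mem_insert, mem_singleton] at ha
    rcases ha with rfl | rfl
    · simp [hu, hxu, -mem_supp]
    · simp [hxv]
  -- adding `v` and `x` to `supp W` costs `5 + 5` and gains two edges at `x`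
  refine ⟨W, hW, hu, hsub, hxn, hyn, hvn, hout, hcross, ?_, fun hpot => ?_, ?_⟩
  · simp only [potG]; omega
  · simp only [potG] at hpot
    obtain ⟨hex1, hex2⟩ := hex (by omega)
    rw [hU2] at hex1 hex2
    rw [hU1] at hex1
    have hnv : ∀ a ∈ supp W, a ≠ v := fun a ha h => hvn (h ▸ ha)
    refine ⟨fun a ha b hb hab => ?_, fun a ha hva => ?_, fun a ha hva => ?_⟩
    · have := hex1 s(a, b) (mk_mem_eX.2 ⟨hab, ⟨by simp [ha, -mem_supp], by simp [hb, -mem_supp]⟩, by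
        intro h
        simp only [mem_insert, mem_singleton, hnv a ha, hnv b hb, or_false] at h
        exact hab.ne (h.1.trans h.2.symm)⟩)
      rw [Sym2.map_mk] at this
      simp only [hfn a (hnv a ha), hfn b (hnv b hb)] at this
      exact (mk_mem_eX.1 this).1
    · have hau : a ≠ u := fun h => hn (h ▸ hva).symm
      have := hex1 s(v, a) (mk_mem_eX.2 ⟨hva, ⟨by simp, by simp [ha, -mem_supp]⟩, by
        simp [hau, hnv a ha]⟩)
      rw [Sym2.map_mk] at this
      simp only [hfn a (hnv a ha), hfv] at this
      exact (mk_mem_eX.1 this).1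
    · have hau : a ≠ u := hva.1.ne.symm
      have := hex2 s(u, a) (mk_mem_eX.2 ⟨hva.1, ⟨by simp [hu, -mem_supp], by simp [ha, -mem_supp]⟩, by
        simp [hau, hnv a ha]⟩) s(v, a) (mk_mem_eX.2 ⟨hva.2, ⟨by simp, by simp [ha, -mem_supp]⟩, by
        simp [hau, hnv a ha]⟩) (by
          rw [Sym2.map_mk, Sym2.map_mk]; simp [hfv, hfn u huv])
      exact huv (Sym2.congr_left.1 this)
  · intro t ht htx hty htu htv htW
    have h1 := hW.three_le_deg htW
    have h2 : nb W t ⊆ ((nb G t).erase y).image f := by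
      intro a ha
      rw [mem_nb] at ha
      have haW := mem_supp_right ha
      have hav : a ≠ v := fun h => hvn (h ▸ haW)
      have hay : a ≠ y := fun h => hyn (h ▸ haW)
      by_cases hau : a = u
      · subst hau
        rcases hcross t ha.symm with h | h
        · exact mem_image.2 ⟨a, by simp [huy, h.symm], hfn a hav⟩
        · exact mem_image.2 ⟨v, by simp [hvy, h.symm], hfv⟩
      · exact mem_image.2 ⟨a, by simp [hay, hout t a htu hau ha], hfn a hav⟩
    have h3 := (card_le_card h2).trans card_image_le
    rw [card_erase_of_mem (mem_nb.2 hty), ht] at h3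
    omega

/-! ### Exact contractions, monochromatic sets and emeralds -/

/-- The contraction of `R` along `ρ` is the critical graph `W`, with no edge lost. -/
structure Exact (G : SimpleGraph V) (R : Finset V) (ρ : V → V) (W : SimpleGraph V) : Prop where
  crit : Crit W
  lt : (supp W).card < (supp G).card
  supp_union : R ∪ supp W = supp G
  rho_mem : ∀ r, ρ r ∈ R
  out : ∀ q v, q ∉ R → v ∉ R → (W.Adj q v ↔ G.Adj q v)
  cross_to : ∀ q r, q ∉ R → r ∈ R → G.Adj q r → W.Adj q (ρ r)
  cross : ∀ q x, q ∉ R → x ∈ R → W.Adj q x → ∃ r ∈ R, ρ r = x ∧ G.Adj q r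
  inj : ∀ q r r', q ∉ R → r ∈ R → r' ∈ R → G.Adj q r → G.Adj q r' → ρ r = ρ r' → r = r'

lemma Contr.toExact {φ : V → Fin 3} {ρ : V → V} (h : Contr G R φ ρ W 0)
    (hU : R ∪ supp W = supp G) : Exact G R ρ W := by
  obtain ⟨h1, h2, h3⟩ := h.exact rfl
  have hmem : ∀ q, q ∉ R → q ∈ supp G → q ∈ supp W := fun q hq hqG =>
    (mem_union.1 (hU ▸ hqG)).resolve_left hq
  refine ⟨h.crit, h.lt, hU, h.rho_mem, fun q v hq hv => ⟨h.out q v hq hv, fun hqv => ?_⟩,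
    fun q r hq hr hqr => h2 q (hmem q hq (mem_supp_left hqr)) hq r hr hqr, h.cross,
    fun q r r' hq hr hr' hqr hqr' he => h3 q (hmem q hq (mem_supp_left hqr)) hq r hr r' hr' hqr hqr'
      ((h.rho_iff r r').1 he)⟩
  exact h1 q (hmem q hq (mem_supp_left hqv)) hq v (hmem v hv (mem_supp_right hqv)) hv hqv

namespace Exact
variable {ρ : V → V}

lemma mem_iff (h : Exact G R ρ W) {q : V} (hq : q ∉ R) : q ∈ supp W ↔ q ∈ supp G := by
  rw [← h.supp_union, mem_union]; tauto

/-- Degrees outside `R` are preserved, since no edge is lost and no two edges are merged. -/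
lemma deg (h : Exact G R ρ W) {q : V} (hq : q ∉ R) : (nb W q).card = (nb G q).card := by
  let f : V → V := fun v => if v ∈ R then ρ v else v
  have hfR : ∀ v ∈ R, f v = ρ v := fun v hv => if_pos hv
  have hfn : ∀ v, v ∉ R → f v = v := fun v hv => if_neg hv
  have himg : nb W q = (nb G q).image f := by
    ext a
    rw [mem_nb, mem_image]
    constructor
    · intro hqa
      by_cases haR : a ∈ R
      · obtain ⟨r, hr, hra, hqr⟩ := h.cross q a hq haR hqa
        exact ⟨r, mem_nb.2 hqr, by rw [hfR r hr, hra]⟩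
      · exact ⟨a, mem_nb.2 ((h.out q a hq haR).1 hqa), hfn a haR⟩
    · rintro ⟨b, hb, rfl⟩
      rw [mem_nb] at hb
      by_cases hbR : b ∈ R
      · rw [hfR b hbR]; exact h.cross_to q b hq hbR hb
      · rw [hfn b hbR]; exact (h.out q b hq hbR).2 hb
  rw [himg, card_image_of_injOn]
  intro a ha b hb hab
  simp only [coe_filter, nb, mem_univ, true_and, Set.mem_ofPred_eq] at ha hb
  by_cases haR : a ∈ R <;> by_cases hbR : b ∈ R
  · rw [hfR a haR, hfR b hbR] at hab
    exact h.inj q a b hq haR hbR ha hb hab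
  · rw [hfR a haR, hfn b hbR] at hab
    exact (hbR (hab ▸ h.rho_mem a)).elim
  · rw [hfn a haR, hfR b hbR] at hab
    exact (haR (hab ▸ h.rho_mem b)).elim
  · rwa [hfn a haR, hfn b hbR] at hab

lemma pot_eq (h : Exact G R ρ W) (hS : Disjoint S R) : pot W S = pot G S :=
  pot_congr fun a ha b hb => h.out a b (disjoint_left.1 hS ha) (disjoint_left.1 hS hb)

end Exact

/-- A proper vertex set of potential at most `5` each colouring of which is constant on the
boundary. Such a set can be contracted to a single vertex. -/
structure Mono (G : SimpleGraph V) (R : Finset V) : Prop where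
  sub : R ⊆ supp G
  ne : R ≠ supp G
  two_le : 2 ≤ R.card
  pot_le : pot G R ≤ 5
  const : ∀ c, PC G R c → ∀ a ∈ bd G R, ∀ b ∈ bd G R, c a = c b

/-- A triangle of vertices of degree three. -/
structure Emerald (G : SimpleGraph V) (d e f : V) : Prop where
  de : G.Adj d e
  ef : G.Adj e f
  df : G.Adj d f
  deg_d : (nb G d).card = 3
  deg_e : (nb G e).card = 3
  deg_f : (nb G f).card = 3

/-- Some monochromatic set or emerald of `G` avoids `S`. -/
def Good (G : SimpleGraph V) (S : Finset V) : Prop :=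
  (∃ M, Mono G M ∧ Disjoint M S) ∨ ∃ d e f, Emerald G d e f ∧ d ∉ S ∧ e ∉ S ∧ f ∉ S

lemma Mono.four_le (h : Mono G R) : 4 ≤ R.card := four_le_card_of_pot_le h.two_le h.pot_le

lemma Exact.mono {ρ : V → V} (h : Exact G R ρ W) (hR : R.Nonempty) (hS : Mono W S)
    (hd : Disjoint S R) : Mono G S := by
  have hn : ∀ a ∈ S, a ∉ R := fun a ha => disjoint_left.1 hd ha
  refine ⟨fun a ha => (h.mem_iff (hn a ha)).1 (hS.sub ha), fun he => ?_, hS.two_le, ?_, ?_⟩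
  · obtain ⟨r, hr⟩ := hR
    exact hn r (he ▸ h.supp_union ▸ mem_union_left _ hr) hr
  · rw [← h.pot_eq hd]; exact hS.pot_le
  · have hb : ∀ a ∈ bd G S, a ∈ bd W S := by
      intro a ha
      obtain ⟨haS, w, hw, haw⟩ := mem_bd.1 ha
      by_cases hwR : w ∈ R
      · exact mem_bd.2 ⟨haS, ρ w, fun hc => hn _ hc (h.rho_mem w), h.cross_to a w (hn a haS) hwR haw⟩
      · exact mem_bd.2 ⟨haS, w, hw, (h.out a w (hn a haS) hwR).2 haw⟩
    intro c hc a ha b hb'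
    exact hS.const c (fun p hp q hq hpq => hc p hp q hq ((h.out p q (hn p hp) (hn q hq)).1 hpq))
      a (hb a ha) b (hb b hb')

lemma Exact.emerald {ρ : V → V} (h : Exact G R ρ W) {d e f : V} (hE : Emerald W d e f)
    (hd : d ∉ R) (he : e ∉ R) (hf : f ∉ R) : Emerald G d e f :=
  ⟨(h.out d e hd he).1 hE.de, (h.out e f he hf).1 hE.ef, (h.out d f hd hf).1 hE.df,
    h.deg hd ▸ hE.deg_d, h.deg he ▸ hE.deg_e, h.deg hf ▸ hE.deg_f⟩

/-- Good configurations survive the reversal of an exact contraction, if they avoid the vertices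
of the contracted graph that lie in `R`. -/
lemma Exact.good {ρ : V → V} (h : Exact G R ρ W) (hR : R.Nonempty)
    (hg : Good W (supp W ∩ R ∪ S)) : Good G (R ∪ S) := by
  rcases hg with ⟨M, hM, hd⟩ | ⟨d, e, f, hE, hd, he, hf⟩
  · rw [disjoint_union_right] at hd
    have hdR : Disjoint M R := by
      rw [disjoint_left]
      exact fun a ha haR => disjoint_left.1 hd.1 ha (mem_inter.2 ⟨hM.sub ha, haR⟩)
    exact Or.inl ⟨M, h.mono hR hM hdR, disjoint_union_right.2 ⟨hdR, hd.2⟩⟩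
  · simp only [mem_union, mem_inter, not_or, not_and] at hd he hf
    have hd' := hd.1 (mem_supp_left hE.de)
    have he' := he.1 (mem_supp_left hE.ef)
    have hf' := hf.1 (mem_supp_right hE.ef)
    exact Or.inr ⟨d, e, f, h.emerald hE hd' he' hf', by simp [hd', hd.2], by simp [he', he.2],
      by simp [hf', hf.2]⟩

lemma Good.mono (h : Good G S) (hT : T ⊆ S) : Good G T := by
  rcases h with ⟨M, hM, hd⟩ | ⟨d, e, f, hE, hd, he, hf⟩
  · exact Or.inl ⟨M, hM, disjoint_of_subset_right hT hd⟩
  · exact Or.inr ⟨d, e, f, hE, fun h => hd (hT h), fun h => he (hT h), fun h => hf (hT h)⟩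

/-! ### Critical graphs of positive potential, inductively -/

/-- Critical graphs with fewer than `n` vertices have potential at most `2`, and those of positive
potential are complete graphs on four vertices or contain a monochromatic set. -/
def Bound (V : Type*) [Fintype V] (n : ℕ) : Prop :=
  ∀ W : SimpleGraph V, Crit W → (supp W).card < n →
    potG W ≤ 2 ∧ (1 ≤ potG W → (supp W).card = 4 ∨ ∃ M, Mono W M)

variable {n : ℕ}

/-- The potential of at most three vertices. The small values `5`, `6`, `7` occur for one vertex, for a
triangle and for an edge. -/
lemma pot_card_le_three (h1 : S.Nonempty) (h3 : S.card ≤ 3) :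
    (S.card = 1 ∧ pot W S = 5) ∨
    (S.card = 3 ∧ pot W S = 6 ∧ ∀ a ∈ S, ∀ b ∈ S, a ≠ b → W.Adj a b) ∨
    (S.card = 2 ∧ pot W S = 7 ∧ ∀ a ∈ S, ∀ b ∈ S, a ≠ b → W.Adj a b) ∨ 9 ≤ pot W S := by
  have h0 := card_pos.2 h1
  have hc : S.card = 1 ∨ S.card = 2 ∨ S.card = 3 := by omega
  rcases hc with hc | hc | hc
  · obtain ⟨a, rfl⟩ := card_eq_one.1 hc
    exact Or.inl ⟨hc, pot_singleton⟩
  · obtain ⟨a, b, hab, rfl⟩ := card_eq_two.1 hc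
    have hp : pot W {a, b} = 10 - 3 * (({b} : Finset V).filter (W.Adj a)).card := by
      rw [pot_insert (by simpa using hab), pot_singleton]; ring
    rw [filter_singleton] at hp
    by_cases h : W.Adj a b
    · refine Or.inr (Or.inr (Or.inl ⟨hc, by rw [hp, if_pos h]; simp, ?_⟩))
      intro p hp q hq hpq
      simp only [mem_insert, mem_singleton] at hp hq
      rcases hp with rfl | rfl <;> rcases hq with rfl | rfl <;> first | exact (hpq rfl).elim | exact h | exact h.symm
    · refine Or.inr (Or.inr (Or.inr ?_))
      rw [hp, if_neg h]; simp
  · obtain ⟨a, b, d, hab, had, hbd, rfl⟩ := card_eq_three.1 hc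
    have hp : pot W {a, b, d} = 15 - 3 * (({b, d} : Finset V).filter (W.Adj a)).card -
        3 * (({d} : Finset V).filter (W.Adj b)).card := by
      rw [pot_insert (by simp [hab, had]), pot_insert (by simpa using hbd), pot_singleton]; ring
    rw [filter_insert, filter_singleton, filter_singleton] at hp
    by_cases h1 : W.Adj a b ∧ W.Adj a d ∧ W.Adj b d
    · obtain ⟨h1, h2, h3⟩ := h1
      refine Or.inr (Or.inl ⟨hc, ?_, ?_⟩)
      · rw [hp, if_pos h1, if_pos h2, if_pos h3, card_insert_of_notMem (by simpa using hbd)]; simp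
      · intro p hp q hq hpq
        simp only [mem_insert, mem_singleton] at hp hq
        rcases hp with rfl | rfl | rfl <;> rcases hq with rfl | rfl | rfl <;>
          first | exact (hpq rfl).elim | assumption | (apply SimpleGraph.Adj.symm; assumption)
    · refine Or.inr (Or.inr (Or.inr ?_))
      rw [hp]
      by_cases h1 : W.Adj a b <;> by_cases h2 : W.Adj a d <;> by_cases h3 : W.Adj b d <;>
        first | (exfalso; tauto) | skip
      all_goals simp [h1, h2, h3]
      all_goals norm_num [card_insert_of_notMem, hbd]

/-- Proper vertex sets of a critical graph of positive potential have potential at least `4`. -/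
lemma Crit.four_le_pot (hG : Crit G) (hB : Bound V (supp G).card) (hP : 1 ≤ potG G)
    (hR : R ⊆ supp G) (hne : R ≠ supp G) (h2 : 2 ≤ R.card) : 4 ≤ pot G R := by
  by_contra hlt
  obtain ⟨M, hM, hmin⟩ := exists_min_image
    ((supp G).powerset.filter fun S => S ≠ supp G ∧ 2 ≤ S.card) (pot G) ⟨R, by simp [hR, hne, h2]⟩
  have hMR := hmin R (by simp [hR, hne, h2])
  simp only [mem_filter, mem_powerset] at hM hmin
  obtain ⟨hMs, hMne, hM2⟩ := hM
  obtain ⟨v, hv, hvM⟩ := exists_mem_notMem hMs hMne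
  obtain ⟨φ, hφ⟩ := hG.exists_pc hv hvM
  obtain ⟨ρ, W, l, h⟩ := hG.exists_contr hMs hMne (four_le_card_of_pot_le (G := G) hM2 (by omega)) hφ
  have h1 := h.pot_eq
  have h3 := (hB W h.crit h.lt).1
  have h4 : 5 ≤ pot W (supp W ∩ M) := by
    rcases pot_card_le_three (W := W) h.ne h.card_le with h | h | h | h <;> omega
  by_cases hT : M ∪ supp W = supp G
  · rw [hT] at h1
    simp only [potG] at h1 h3 hP
    omega
  · have := hmin _ ⟨union_subset hMs h.sub, hT, hM2.trans (card_le_card subset_union_left)⟩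
    omega

/-- If only one vertex of the triangle survives and no edge is lost, then all edges that leave `R` do so
at vertices of the colour of that vertex. -/
lemma Contr.const_of_card_one {φ : V → Fin 3} {ρ : V → V} (h : Contr G R φ ρ W 0)
    (hU : R ∪ supp W = supp G) (h1 : (supp W ∩ R).card = 1) :
    ∀ a ∈ bd G R, ∀ b ∈ bd G R, φ a = φ b := by
  have hE := h.toExact hU
  obtain ⟨x, hx⟩ := card_eq_one.1 h1
  have key : ∀ a ∈ bd G R, ρ a = x := by
    intro a ha
    obtain ⟨haR, q, hq, haq⟩ := mem_bd.1 ha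
    have := hE.cross_to q a hq haR haq.symm
    rw [← mem_singleton, ← hx]
    exact mem_inter.2 ⟨mem_supp_right this, h.rho_mem a⟩
  intro a ha b hb
  rw [← h.rho_iff, key a ha, key b hb]

/-- A proper set of potential at most `5` is monochromatic, up to an exceptional situation in which
it contracts to a triangle. -/
lemma Crit.mono_or_exact (hG : Crit G) (hB : Bound V (supp G).card) (hP : 1 ≤ potG G)
    (hR : R ⊆ supp G) (hne : R ≠ supp G) (h2 : 2 ≤ R.card) (h5 : pot G R ≤ 5) :
    Mono G R ∨ (potG G = 1 ∧ pot G R = 5 ∧ ∃ ρ W, Exact G R ρ W ∧ potG W = 2 ∧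
      (supp W ∩ R).card = 3 ∧ ∀ a ∈ supp W ∩ R, ∀ b ∈ supp W ∩ R, a ≠ b → W.Adj a b) := by
  by_contra hcon
  push Not at hcon
  obtain ⟨hcon1, hcon2⟩ := hcon
  refine hcon1 ⟨hR, hne, h2, h5, fun φ hφ => ?_⟩
  obtain ⟨ρ, W, l, h⟩ := hG.exists_contr hR hne (four_le_card_of_pot_le h2 h5) hφ
  have h1 := h.pot_eq
  have h3 := (hB W h.crit h.lt).1
  have h4 := pot_card_le_three (W := W) h.ne h.card_le
  have h6 : 5 ≤ pot W (supp W ∩ R) := by rcases h4 with h | h | h | h <;> omega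
  have hT : R ∪ supp W = supp G := by
    by_contra hT
    have := hG.four_le_pot hB hP (union_subset hR h.sub) hT
      (h2.trans (card_le_card subset_union_left))
    omega
  have hTP : pot G (R ∪ supp W) = potG G := by rw [hT, potG]
  rw [hTP] at h1
  obtain rfl : l = 0 := by omega
  rcases h4 with h4 | h4 | h4 | h4
  · exact h.const_of_card_one hT h4.1
  · obtain ⟨a, ha, b, hb, hab, hn⟩ := hcon2 (by omega) (by omega) ρ W (h.toExact hT) (by omega) h4.1
    exact (hn (h4.2.2 a ha b hb hab)).elim
  · omega
  · omega

/-- In a critical graph of potential `2`, the exceptional situation does not occur. -/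
lemma Crit.mono_of_pot_le (hG : Crit G) (hB : Bound V (supp G).card) (hP : potG G = 2)
    (hR : R ⊆ supp G) (hne : R ≠ supp G) (h2 : 2 ≤ R.card) (h5 : pot G R ≤ 5) : Mono G R := by
  rcases hG.mono_or_exact hB (by omega) hR hne h2 h5 with h | h
  · exact h
  · omega

/-- `W` is obtained from `G` by contracting the monochromatic set `R` to its vertex `x`. -/
structure Split (G : SimpleGraph V) (R : Finset V) (ρ : V → V) (W : SimpleGraph V) (x : V) :
    Prop extends Exact G R ρ W where
  inter : supp W ∩ R = {x}
  rho_bd : ∀ a ∈ bd G R, ρ a = x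
  pot_add : potG W + pot G R = potG G + 5

lemma Split.adj_iff {ρ : V → V} (h : Split G R ρ W x) {q : V} (hq : q ∉ R) :
    W.Adj q x ↔ ∃ r ∈ R, G.Adj q r := by
  have hxR : x ∈ R := (mem_inter.1 (h.inter ▸ mem_singleton_self x : x ∈ supp W ∩ R)).2
  constructor
  · intro hqx
    obtain ⟨r, hr, -, hqr⟩ := h.cross q x hq hxR hqx
    exact ⟨r, hr, hqr⟩
  · rintro ⟨r, hr, hqr⟩
    rw [← h.rho_bd r (mem_bd.2 ⟨hr, q, hq, hqr.symm⟩)]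
    exact h.cross_to q r hq hr hqr

lemma Split.mem {ρ : V → V} (h : Split G R ρ W x) : x ∈ supp W ∧ x ∈ R :=
  mem_inter.1 (h.inter ▸ mem_singleton_self x : x ∈ supp W ∩ R)

/-- A vertex outside `R` has at most one neighbour in `R`. -/
lemma Split.unique {ρ : V → V} (h : Split G R ρ W x) {q r r' : V} (hq : q ∉ R) (hr : r ∈ R)
    (hr' : r' ∈ R) (hqr : G.Adj q r) (hqr' : G.Adj q r') : r = r' :=
  h.inj q r r' hq hr hr' hqr hqr' (by
    rw [h.rho_bd r (mem_bd.2 ⟨hr, q, hq, hqr.symm⟩), h.rho_bd r' (mem_bd.2 ⟨hr', q, hq, hqr'.symm⟩)])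

lemma Split.supp_eq {ρ : V → V} (h : Split G R ρ W x) : supp W = insert x (supp G \ R) := by
  ext a
  by_cases ha : a ∈ R
  · have : a ∈ supp W ↔ a ∈ supp W ∩ R := by simp [ha]
    rw [this, h.inter]; simp [ha]
  · rw [h.mem_iff ha]
    have : a ≠ x := fun hx => ha (hx ▸ h.mem.2)
    simp [ha, this]

lemma Split.card_eq {ρ : V → V} (h : Split G R ρ W x) :
    (supp W).card = (supp G \ R).card + 1 := by
  rw [h.supp_eq, card_insert_of_notMem (by simp [h.mem.2])]

/-- A monochromatic set contracts to a single vertex. The other vertices of the triangle have degree at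
most two in the contracted graph, and no edge is lost, as `R` has small potential. -/
lemma Mono.exists_split (hG : Crit G) (hB : Bound V (supp G).card) (hP : 1 ≤ potG G)
    (hR : Mono G R) : ∃ ρ W x, Split G R ρ W x := by
  obtain ⟨v, hv, hvM⟩ := exists_mem_notMem hR.sub hR.ne
  obtain ⟨φ, hφ⟩ := hG.exists_pc hv hvM
  obtain ⟨ρ, W, l, h⟩ := hG.exists_contr hR.sub hR.ne hR.four_le hφ
  -- a vertex of the contracted triangle has a neighbour outside `R`
  have hX : ∀ x ∈ supp W ∩ R, ∃ r ∈ bd G R, ρ r = x := by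
    intro x hx
    obtain ⟨hxW, hxR⟩ := mem_inter.1 hx
    have hn : ¬ nb W x ⊆ (supp W ∩ R).erase x := by
      intro hs
      have h1 := card_le_card hs
      rw [card_erase_of_mem hx] at h1
      have := h.card_le
      have := h.crit.three_le_deg hxW
      omega
    obtain ⟨q, hq, hq'⟩ := not_subset.1 hn
    rw [mem_nb] at hq
    have hqR : q ∉ R := fun hqR =>
      hq' (mem_erase.2 ⟨hq.ne.symm, mem_inter.2 ⟨mem_supp_right hq, hqR⟩⟩)
    obtain ⟨r, hr, hrx, hqr⟩ := h.cross q x hqR hxR hq.symm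
    exact ⟨r, mem_bd.2 ⟨hr, q, hqR, hqr.symm⟩, hrx⟩
  obtain ⟨x, hx⟩ := h.ne
  have hXx : supp W ∩ R = {x} := by
    refine eq_singleton_iff_unique_mem.2 ⟨hx, fun y hy => ?_⟩
    obtain ⟨r, hr, rfl⟩ := hX x hx
    obtain ⟨s, hs, rfl⟩ := hX y hy
    rw [h.rho_iff]
    exact hR.const φ hφ s hs r hr
  have h1 := h.pot_eq
  have h3 := (hB W h.crit h.lt).1
  have h5 := hR.pot_le
  rw [hXx, pot_singleton] at h1
  have hT : R ∪ supp W = supp G := by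
    by_contra hT
    have := hG.four_le_pot hB hP (union_subset hR.sub h.sub) hT
      (hR.two_le.trans (card_le_card subset_union_left))
    omega
  have hTP : pot G (R ∪ supp W) = potG G := by rw [hT, potG]
  rw [hTP] at h1
  obtain rfl : l = 0 := by omega
  have hE := h.toExact hT
  refine ⟨ρ, W, x, hE, hXx, fun a ha => ?_, by push_cast at h1; omega⟩
  obtain ⟨haR, q, hq, haq⟩ := mem_bd.1 ha
  rw [← mem_singleton, ← hXx]
  exact mem_inter.2 ⟨mem_supp_right (hE.cross_to q a hq haR haq.symm), h.rho_mem a⟩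

/-- Two boundary vertices of a monochromatic set cannot be separated by a colouring, and the resulting
critical graph has positive potential again. -/
lemma Mono.exists_addEdge (hG : Crit G) (hB : Bound V (supp G).card) (hP : 1 ≤ potG G)
    (hR : Mono G R) {a b : V} (ha : a ∈ bd G R) (hb : b ∈ bd G R) (hab : a ≠ b) :
    ∃ W, AddEdge G R a b W ∧ 1 ≤ potG W ∧ (supp W).card < (supp G).card := by
  obtain ⟨v, hv, hvM⟩ := exists_mem_notMem hR.sub hR.ne
  obtain ⟨W, hW⟩ := hG.exists_addEdge hv hvM (mem_bd.1 ha).1 (mem_bd.1 hb).1 hab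
    (fun c hc => hR.const c hc a ha b hb)
  have hlt : supp W ⊂ supp G := (Finset.ssubset_iff_subset_ne.2
    ⟨hW.sub.trans hR.sub, fun h => hvM (hW.sub (h ▸ hv))⟩)
  refine ⟨W, hW, ?_, card_lt_card hlt⟩
  have := hG.four_le_pot hB hP hlt.subset hlt.ne (by have := hW.crit.four_le_card; omega)
  have := hW.pot_le
  omega

lemma Split.one_le {ρ : V → V} (h : Split G R ρ W x) (hR : Mono G R) (hP : 1 ≤ potG G) :
    1 ≤ potG W := by
  have := h.pot_add
  have := hR.pot_le
  omega

lemma Bound.mono (h : Bound V n) {m : ℕ} (hm : m ≤ n) : Bound V m :=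
  fun W hW hc => h W hW (hc.trans_le hm)

lemma emerald_of_card_four (hG : Crit G) (h4 : (supp G).card = 4) {a b c : V} (ha : a ∈ supp G)
    (hb : b ∈ supp G) (hc : c ∈ supp G) (hab : a ≠ b) (hbc : b ≠ c) (hac : a ≠ c) :
    Emerald G a b c := by
  have h := (potG_of_card_four hG h4).2
  have hd : ∀ v ∈ supp G, (nb G v).card = 3 := by
    intro v hv
    refine le_antisymm ?_ (hG.three_le_deg hv)
    have : nb G v ⊆ (supp G).erase v := fun a ha =>
      mem_erase.2 ⟨(mem_nb.1 ha).ne.symm, nb_subset_supp ha⟩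
    have := card_le_card this
    rwa [card_erase_of_mem hv, h4] at this
  exact ⟨h a ha b hb hab, h b hb c hc hbc, h a ha c hc hac, hd a ha, hd b hb, hd c hc⟩

/-- A critical graph of positive potential has a monochromatic set or an emerald off any given
vertex. -/
lemma good_singleton : ∀ (m : ℕ) (G : SimpleGraph V), (supp G).card = m → m < n → Bound V n →
    Crit G → 1 ≤ potG G → ∀ v, Good G {v} := by
  intro m
  induction m using Nat.strong_induction_on with
  | _ m ih =>
  intro G hm hmn hB hG hP v
  rcases (hB G hG (hm ▸ hmn)).2 hP with h4 | ⟨R, hR⟩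
  · obtain ⟨t, ht, htc⟩ := exists_subset_card_eq (show 3 ≤ ((supp G).erase v).card by
      have := pred_card_le_card_erase (s := supp G) (a := v); omega)
    obtain ⟨a, b, c, hab, hac, hbc, rfl⟩ := card_eq_three.1 htc
    simp only [insert_subset_iff, singleton_subset_iff, mem_erase] at ht
    exact Or.inr ⟨a, b, c, emerald_of_card_four hG h4 ht.1.2 ht.2.1.2 ht.2.2.2 hab hbc hac,
      by simpa using ht.1.1, by simpa using ht.2.1.1, by simpa using ht.2.2.1⟩
  · by_cases hv : v ∈ R
    · obtain ⟨ρ, W, x, h⟩ := hR.exists_split hG (hB.mono (by omega)) hP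
      have hg := ih _ (hm ▸ h.lt) W rfl (h.lt.trans (by omega)) hB h.crit (h.one_le hR hP) x
      have := h.toExact.good ⟨v, hv⟩ (S := ∅) (by rw [union_empty, h.inter]; exact hg)
      exact this.mono (by simpa using hv)
    · exact Or.inl ⟨R, hR, by simpa using hv⟩

lemma Crit.good (hG : Crit G) (hB : Bound V n) (hn : (supp G).card < n) (hP : 1 ≤ potG G) (v : V) :
    Good G {v} :=
  good_singleton _ G rfl hn hB hG hP v

/-- `G[A] + ab` is critical: the added edge creates a graph with no other edge missing. -/
structure Full (G : SimpleGraph V) (A : Finset V) (a b : V) (W : SimpleGraph V) : Prop where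
  crit : Crit W
  not_adj : ¬ G.Adj a b
  adj : W.Adj a b
  supp_eq : supp W = A
  adj_iff : ∀ x ∈ A, ∀ y ∈ A, W.Adj x y ↔ G.Adj x y ∨ (x = a ∧ y = b) ∨ (x = b ∧ y = a)

lemma AddEdge.full {a b : V} (h : AddEdge G A a b W) (hs : supp W = A)
    (hp : potG W + 3 ≤ pot G (supp W)) : Full G A a b W := by
  refine ⟨h.crit, h.not_adj, h.adj, hs, fun x hx y hy => ⟨h.lift x y, ?_⟩⟩
  rintro (hxy | ⟨rfl, rfl⟩ | ⟨rfl, rfl⟩)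
  · exact h.exact hp x (hs ▸ hx) y (hs ▸ hy) hxy
  · exact h.adj
  · exact h.adj.symm

lemma Full.mem_right {a b : V} (h : Full G A a b W) : b ∈ A := h.supp_eq ▸ mem_supp_right h.adj

lemma Full.adj_of_ne {a b : V} (h : Full G A a b W) (hx : x ∈ A) (hy : y ∈ A) (hxa : x ≠ a)
    (hya : y ≠ a) : W.Adj x y ↔ G.Adj x y := by
  rw [h.adj_iff x hx y hy]; simp [hxa, hya]

lemma Full.pot_eq {a b : V} (h : Full G A a b W) (hS : S ⊆ A) (ha : a ∉ S) : pot W S = pot G S :=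
  pot_congr fun _ hx _ hy => h.adj_of_ne (hS hx) (hS hy) (fun e => ha (e ▸ hx)) (fun e => ha (e ▸ hy))

/-- Degrees in `G[A] + ab` agree with those in `G` at vertices whose only edge leaving `A` is
replaced by the new edge. -/
lemma Full.deg_of_leave {a b : V} (h : Full G A a b W) {f : V} (hf : f ∉ A)
    (hb : ∀ q, q ∉ A → (G.Adj b q ↔ q = f)) : (nb W b).card = (nb G b).card := by
  have hbA := h.mem_right
  have h1 : nb W b = insert a ((nb G b).erase f) := by
    ext q
    simp only [mem_nb, mem_insert, mem_erase]
    constructor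
    · intro hq
      have hqA : q ∈ A := h.supp_eq ▸ mem_supp_right hq
      rcases (h.adj_iff b hbA q hqA).1 hq with h1 | ⟨h1, h2⟩ | h1
      · exact Or.inr ⟨fun e => hf (e ▸ hqA), h1⟩
      · exact Or.inl (h2.trans h1)
      · exact Or.inl h1.2
    · rintro (rfl | ⟨h1, h2⟩)
      · exact h.adj.symm
      · have hqA : q ∈ A := by
          by_contra hqA
          exact h1 ((hb q hqA).1 h2)
        exact (h.adj_iff b hbA q hqA).2 (Or.inl h2)
  have hbf : G.Adj b f := (hb f hf).2 rfl
  rw [h1, card_insert_of_notMem (fun e => h.not_adj (mem_nb.1 (mem_of_mem_erase e)).symm),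
    card_erase_of_mem (mem_nb.2 hbf)]
  have : 0 < (nb G b).card := card_pos.2 ⟨f, mem_nb.2 hbf⟩
  omega

lemma Full.nb_of_ne {a b : V} (h : Full G A a b W) (hx : x ∈ A) (hxa : x ≠ a) (hxb : x ≠ b) :
    nb W x = (nb G x).filter (· ∈ A) := by
  ext q
  simp only [mem_nb, mem_filter]
  constructor
  · intro hq
    have hqA : q ∈ A := h.supp_eq ▸ mem_supp_right hq
    exact ⟨by simpa [hxa, hxb] using (h.adj_iff x hx q hqA).1 hq, hqA⟩
  · rintro ⟨hq, hqA⟩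
    exact (h.adj_iff x hx q hqA).2 (Or.inl hq)

lemma Full.deg_of_ne {a b : V} (h : Full G A a b W) (hx : x ∈ A) (hxa : x ≠ a) (hxb : x ≠ b)
    (hb : ∀ q, q ∉ A → ¬ G.Adj x q) : (nb W x).card = (nb G x).card := by
  rw [h.nb_of_ne hx hxa hxb, filter_true_of_mem]
  intro q hq
  by_contra hqA
  exact hb q hqA (mem_nb.1 hq)

/-- A critical graph of potential `2` with more than four vertices has a monochromatic set or an
emerald off any given triangle. -/
lemma good_triangle : ∀ (m : ℕ) (G : SimpleGraph V), (supp G).card = m → m < n → Bound V n →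
    Crit G → potG G = 2 → m ≠ 4 → ∀ X : Finset V, X.card = 3 → X ⊆ supp G →
    (∀ a ∈ X, ∀ b ∈ X, a ≠ b → G.Adj a b) → Good G X := by
  intro m
  induction m using Nat.strong_induction_on with
  | _ m ih =>
  intro G hm hmn hB hG hP hm4 X hX3 hXs hX
  have hBG : Bound V (supp G).card := hB.mono (by omega)
  have hex : ∃ R, Mono G R := ((hB G hG (hm ▸ hmn)).2 (by omega)).resolve_left (by omega)
  obtain ⟨R, hR, hmin⟩ := exists_min_image (univ.filter (Mono G)) card
    (by obtain ⟨R, hR⟩ := hex; exact ⟨R, by simpa using hR⟩)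
  simp only [mem_filter, mem_univ, true_and] at hR hmin
  -- `R` is a smallest monochromatic set; it may be assumed to meet the triangle `X`
  by_cases hdis : Disjoint R X
  · exact Or.inl ⟨R, hR, hdis⟩
  rw [not_disjoint_iff] at hdis
  obtain ⟨r, hrR, hrX⟩ := hdis
  obtain ⟨ρ, W, x, h⟩ := hR.exists_split hG hBG (by omega)
  have hRne : R.Nonempty := ⟨r, hrR⟩
  by_cases hXR : X ⊆ R
  · have hg := h.crit.good hB (h.lt.trans (by omega)) (h.one_le hR (by omega)) x
    have := h.toExact.good hRne (S := ∅) (by rw [union_empty, h.inter]; exact hg)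
    exact this.mono (by simpa using hXR)
  obtain ⟨q, hqX, hqR⟩ := not_subset.1 hXR
  have honly : ∀ s ∈ X, s ∈ R → s = r := by
    intro s hs hsR
    have hqs : q ≠ s := fun e => hqR (e ▸ hsR)
    have hqr : q ≠ r := fun e => hqR (e ▸ hrR)
    exact h.unique hqR hsR hrR (hX q hqX s hs hqs) (hX q hqX r hrX hqr)
  have hpW := h.pot_add
  have hpW2 := (hB W h.crit (h.lt.trans (by omega))).1
  have hR5 := hR.pot_le
  have hout : ∀ s ∈ X.erase r, s ∉ R ∧ s ∈ X := fun s hs =>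
    ⟨fun hsR => (mem_erase.1 hs).1 (honly s (mem_erase.1 hs).2 hsR), (mem_erase.1 hs).2⟩
  have hrem : ∀ s ∈ X.erase r, W.Adj s x := fun s hs =>
    (h.adj_iff (hout s hs).1).2 ⟨r, hrR, hX s (hout s hs).2 r hrX (mem_erase.1 hs).1⟩
  have hX'c : (X.erase r).card = 2 := by rw [card_erase_of_mem hrX, hX3]
  by_cases hW4 : (supp W).card = 4
  · -- here `G - R` is a triangle `d`, `e`, `f` with `d` and `e` adjacent to `r`
    obtain ⟨b, hb, hbr⟩ : ∃ b ∈ bd G R, b ≠ r := by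
      obtain ⟨a, ha, b, hb, hab⟩ := hG.exists_bd hR.sub hR.ne hR.two_le
      by_cases har : a = r
      · exact ⟨b, hb, fun e => hab (har.trans e.symm)⟩
      · exact ⟨a, ha, har⟩
    obtain ⟨hbR, f, hfR, hbf⟩ := mem_bd.1 hb
    have hfX : f ∉ X.erase r := fun hf =>
      hbr (h.unique hfR hbR hrR hbf.symm (hX f (hout f hf).2 r hrX (mem_erase.1 hf).1))
    have hUR : supp G \ R = insert f (X.erase r) := by
      symm
      apply eq_of_subset_of_card_le
      · rw [insert_subset_iff]
        refine ⟨mem_sdiff.2 ⟨mem_supp_right hbf, hfR⟩, fun s hs => mem_sdiff.2 ⟨hXs (hout s hs).2, (hout s hs).1⟩⟩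
      · rw [card_insert_of_notMem hfX, hX'c]
        have := h.card_eq; omega
    have hrb : r ∈ bd G R := mem_bd.2 ⟨hrR, q, hqR, hX r hrX q hqX (fun e => hqR (e ▸ hrR))⟩
    have honlyf : ∀ p ∈ R, p ≠ r → ∀ q, q ∉ R → G.Adj p q → q = f ∧ p = b := by
      intro p hpR hpr q hq hpq
      have hqU : q ∈ supp G \ R := mem_sdiff.2 ⟨mem_supp_right hpq, hq⟩
      rw [hUR, mem_insert] at hqU
      rcases hqU with rfl | hqX
      · exact ⟨rfl, h.unique hq hpR hbR hpq.symm hbf.symm⟩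
      · exact (hpr (h.unique hq hpR hrR hpq.symm
          (hX q (hout q hqX).2 r hrX (mem_erase.1 hqX).1))).elim
    obtain ⟨W', hW', hP', hlt'⟩ := hR.exists_addEdge hG hBG (by omega) hrb hb hbr.symm
    have hP'2 := (hB W' hW'.crit (by omega)).1
    have hpl := hW'.pot_le
    -- by minimality of `R`, the critical graph with the added edge uses all of `R`
    have hS : supp W' = R := by
      refine eq_of_subset_of_card_le hW'.sub (hmin _ (hG.mono_of_pot_le hBG hP
        (hW'.sub.trans hR.sub) (fun e => ?_) ?_ (by omega)))
      · rw [e] at hlt'; omega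
      · have := hW'.crit.four_le_card; omega
    have hF := hW'.full hS (by rw [hS]; omega)
    have hne : ∀ t ∈ R, t ≠ r → (nb W' t).card = (nb G t).card := by
      intro t ht htr
      by_cases htb : t = b
      · subst htb
        refine hF.deg_of_leave hfR fun q hq => ⟨fun hbq => (honlyf t hbR hbr q hq hbq).1, ?_⟩
        rintro rfl; exact hbf
      · exact hF.deg_of_ne ht htr htb fun q hq htq => htb (honlyf t ht htr q hq htq).2
    have hXr : ∀ t ∈ R, t ≠ r → t ∉ X := fun t ht htr htX => htr (honly t htX ht)
    rcases hF.crit.good hB (by omega) hP' r with ⟨M, hM, hd⟩ | ⟨d, e, f', hE, hd, he, hf⟩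
    · have hMR : M ⊆ R := hS ▸ hM.sub
      have hrM : r ∉ M := by simpa using hd
      refine Or.inl ⟨M, ⟨hMR.trans hR.sub, ?_, hM.two_le, hF.pot_eq hMR hrM ▸ hM.pot_le, ?_⟩, ?_⟩
      · rintro rfl
        exact hrM (hR.sub hrR)
      · have hbM : ∀ a ∈ bd G M, a ∈ bd W' M := by
          intro a ha
          obtain ⟨haM, w, hw, haw⟩ := mem_bd.1 ha
          have har : a ≠ r := fun e => hrM (e ▸ haM)
          by_cases hwR : w ∈ R
          · exact mem_bd.2 ⟨haM, w, hw, (hF.adj_iff a (hMR haM) w hwR).2 (Or.inl haw)⟩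
          · obtain ⟨-, rfl⟩ := honlyf a (hMR haM) har w hwR haw
            exact mem_bd.2 ⟨haM, r, hrM, hF.adj.symm⟩
        intro c hc a ha a' ha'
        refine hM.const c (fun p hp q hq hpq => hc p hp q hq ?_) a (hbM a ha) a' (hbM a' ha')
        exact (hF.adj_of_ne (hMR hp) (hMR hq) (fun e => hrM (e ▸ hp)) (fun e => hrM (e ▸ hq))).1 hpq
      · rw [disjoint_left]
        exact fun a ha => hXr a (hMR ha) (fun e => hrM (e ▸ ha))
    · simp only [mem_singleton] at hd he hf
      have hdR : d ∈ R := hS ▸ mem_supp_left hE.de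
      have heR : e ∈ R := hS ▸ mem_supp_left hE.ef
      have hfR : f' ∈ R := hS ▸ mem_supp_right hE.ef
      exact Or.inr ⟨d, e, f', ⟨(hF.adj_of_ne hdR heR hd he).1 hE.de,
        (hF.adj_of_ne heR hfR he hf).1 hE.ef, (hF.adj_of_ne hdR hfR hd hf).1 hE.df,
        hne d hdR hd ▸ hE.deg_d, hne e heR he ▸ hE.deg_e, hne f' hfR hf ▸ hE.deg_f⟩,
        hXr d hdR hd, hXr e heR he, hXr f' hfR hf⟩
  · have hxX : x ∉ X.erase r := fun hx => (hout x hx).1 h.mem.2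
    have hg := ih _ (hm ▸ h.lt) W rfl (h.lt.trans (by omega)) hB h.crit (by omega) hW4
      (insert x (X.erase r)) (by rw [card_insert_of_notMem hxX, hX'c]) (by
        rw [insert_subset_iff]
        exact ⟨h.mem.1, fun s hs => mem_supp_left (hrem s hs)⟩) (by
        intro a ha b hb hab
        rw [mem_insert] at ha hb
        rcases ha with rfl | ha <;> rcases hb with rfl | hb
        · exact (hab rfl).elim
        · exact (hrem b hb).symm
        · exact hrem a ha
        · exact (h.out a b (hout a ha).1 (hout b hb).1).2 (hX a (hout a ha).2 b (hout b hb).2 hab))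
    have := h.toExact.good hRne (S := X.erase r) (by
      rw [h.inter, ← insert_eq]; exact hg)
    refine this.mono fun a ha => ?_
    by_cases har : a = r
    · subst har; exact mem_union_left _ hrR
    · exact mem_union_right _ (mem_erase.2 ⟨har, ha⟩)

lemma Crit.good_of_triangle (hG : Crit G) (hB : Bound V n) (hn : (supp G).card < n)
    (hP : potG G = 2) (h4 : (supp G).card ≠ 4) {X : Finset V} (hX3 : X.card = 3) (hXs : X ⊆ supp G)
    (hX : ∀ a ∈ X, ∀ b ∈ X, a ≠ b → G.Adj a b) : Good G X :=
  good_triangle _ G rfl hn hB hG hP h4 X hX3 hXs hX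

/-! ### Discharging -/

/-- The vertices of degree three. -/
def V3 (G : SimpleGraph V) : Finset V := univ.filter fun v => (nb G v).card = 3

/-- The non-isolated vertices of degree other than three. -/
def V4 (G : SimpleGraph V) : Finset V := (supp G).filter fun v => (nb G v).card ≠ 3

@[simp] lemma mem_V3 : v ∈ V3 G ↔ (nb G v).card = 3 := by simp [V3]

lemma mem_V4 : v ∈ V4 G ↔ v ∈ supp G ∧ (nb G v).card ≠ 3 := by simp only [V4, mem_filter]

/-- No two distinct vertices are joined to both ends of an edge. -/
def NoDiamond (G : SimpleGraph V) : Prop :=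
  ∀ a b c d, a ≠ b → G.Adj c d → G.Adj a c → G.Adj a d → G.Adj b c → G.Adj b d → False

/-- The first vertex of a path of three vertices of degree three has two further neighbours; they
are required to be adjacent. -/
def Star (G : SimpleGraph V) : Prop :=
  ∀ x y z u v, x ∈ V3 G → y ∈ V3 G → z ∈ V3 G → G.Adj x y → G.Adj y z → z ≠ x → G.Adj x u →
    G.Adj x v → u ≠ v → u ≠ y → v ≠ y → G.Adj u v

lemma nb_eq_of_card_three (hx : (nb G x).card = 3) (hy : G.Adj x y) (hu : G.Adj x u)
    (hv : G.Adj x v) (h1 : y ≠ u) (h2 : y ≠ v) (h3 : u ≠ v) : nb G x = {y, u, v} := by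
  symm
  apply eq_of_subset_of_card_le
  · simp [insert_subset_iff, hy, hu, hv]
  · rw [hx, card_eq_three.2 ⟨y, u, v, h1, h2, h3, rfl⟩]

lemma exists_nb_eq (hx : (nb G x).card = 3) (hy : G.Adj x y) :
    ∃ u v, nb G x = {y, u, v} ∧ y ≠ u ∧ y ≠ v ∧ u ≠ v := by
  have h : ((nb G x).erase y).card = 2 := by rw [card_erase_of_mem (mem_nb.2 hy), hx]
  obtain ⟨u, v, huv, h⟩ := card_eq_two.1 h
  have hu : u ∈ (nb G x).erase y := by simp [h]
  have hv : v ∈ (nb G x).erase y := by simp [h]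
  exact ⟨u, v, by rw [← h, insert_erase (mem_nb.2 hy)], (mem_erase.1 hu).1.symm,
    (mem_erase.1 hv).1.symm, huv⟩

lemma exists_nb_eq' (hx : (nb G x).card = 3) (hy : G.Adj x y) (hz : G.Adj x z) (hyz : y ≠ z) :
    ∃ u, nb G x = {y, z, u} ∧ y ≠ u ∧ z ≠ u := by
  have h : (((nb G x).erase y).erase z).card = 1 := by
    rw [card_erase_of_mem (mem_erase.2 ⟨hyz.symm, mem_nb.2 hz⟩), card_erase_of_mem (mem_nb.2 hy), hx]
  obtain ⟨u, h⟩ := card_eq_one.1 h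
  have hu : u ∈ ((nb G x).erase y).erase z := by simp [h]
  rw [mem_erase, mem_erase] at hu
  refine ⟨u, ?_, hu.2.1.symm, hu.1.symm⟩
  rw [← h, insert_erase (mem_erase.2 ⟨hyz.symm, mem_nb.2 hz⟩), insert_erase (mem_nb.2 hy)]

lemma V3_subset_supp : V3 G ⊆ supp G := by
  intro v hv
  rw [mem_V3] at hv
  obtain ⟨w, hw⟩ := card_pos.1 (by omega : 0 < (nb G v).card)
  exact mem_supp_left (mem_nb.1 hw)

lemma V3_union_V4 : V3 G ∪ V4 G = supp G := by
  ext v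
  rw [mem_union, mem_V4, mem_V3]
  have : v ∈ V3 G → v ∈ supp G := fun h => V3_subset_supp h
  rw [mem_V3] at this
  tauto

lemma disjoint_V3_V4 : Disjoint (V3 G) (V4 G) := by
  rw [disjoint_left]
  intro v hv hv'
  exact (mem_V4.1 hv').2 (mem_V3.1 hv)

lemma card_nb_eq_add : (nb G v).card = (nb G v ∩ V3 G).card + (nb G v ∩ V4 G).card := by
  rw [← card_union_of_disjoint, ← inter_union_distrib_left, V3_union_V4,
    inter_eq_left.2 nb_subset_supp]
  exact disjoint_of_subset_left inter_subset_right
    (disjoint_of_subset_right inter_subset_right disjoint_V3_V4)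

lemma sum_nb_inter_comm : ∑ v ∈ A, (nb G v ∩ B).card = ∑ v ∈ B, (nb G v ∩ A).card := by
  have h := sum_card_bipartiteAbove_eq_sum_card_bipartiteBelow (s := A) (t := B) G.Adj
  convert h using 2 with v hv v hv
  · congr 1; ext a; simp [bipartiteAbove, and_comm]
  · congr 1; ext a; simp [bipartiteBelow, and_comm, G.adj_comm]

/-- The potential as a sum of charges. Initially a vertex of degree `d` has charge `20 - 6d`, so that
the charges sum to `4 (5|V| - 3|E|)`; then each vertex of degree three sends charge `1` to each of its
neighbours in `V4`. -/
lemma four_mul_potG : 4 * potG G = ∑ v ∈ V3 G, (((nb G v ∩ V3 G).card : ℤ) - 1) -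
    ∑ v ∈ V4 G, ((nb G v ∩ V4 G).card : ℤ) - 5 * ∑ v ∈ V4 G, (((nb G v).card : ℤ) - 4) := by
  have h1 : (2 * eIn G (supp G) : ℤ) = ∑ v ∈ supp G, ((nb G v).card : ℤ) := by
    exact_mod_cast (sum_deg (G := G)).symm
  have h2 : (∑ v ∈ V3 G, ((nb G v ∩ V4 G).card : ℤ)) = ∑ v ∈ V4 G, ((nb G v ∩ V3 G).card : ℤ) := by
    exact_mod_cast sum_nb_inter_comm (G := G) (A := V3 G) (B := V4 G)
  have h3 : ∑ v ∈ V3 G, (((nb G v ∩ V3 G).card : ℤ) - 1) =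
      2 * (V3 G).card - ∑ v ∈ V3 G, ((nb G v ∩ V4 G).card : ℤ) := by
    rw [eq_sub_iff_add_eq, ← sum_add_distrib, sum_congr rfl (g := fun _ => (2 : ℤ))]
    · simp [mul_comm]
    · intro v hv
      have := card_nb_eq_add (G := G) (v := v)
      rw [mem_V3.1 hv] at this
      omega
  have h4 : ∑ v ∈ V4 G, ((nb G v).card : ℤ) = ∑ v ∈ V4 G, ((nb G v ∩ V3 G).card : ℤ) +
      ∑ v ∈ V4 G, ((nb G v ∩ V4 G).card : ℤ) := by
    rw [← sum_add_distrib]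
    exact sum_congr rfl fun v _ => by exact_mod_cast card_nb_eq_add
  have h5 : ∑ v ∈ V3 G, ((nb G v).card : ℤ) = 3 * (V3 G).card := by
    rw [sum_congr rfl (g := fun _ => (3 : ℤ))]
    · simp [mul_comm]
    · intro v hv; exact_mod_cast mem_V3.1 hv
  rw [← V3_union_V4, sum_union disjoint_V3_V4] at h1
  have h6 : ((V3 G ∪ V4 G).card : ℤ) = (V3 G).card + (V4 G).card := by
    exact_mod_cast card_union_of_disjoint disjoint_V3_V4
  rw [h3, h2, sum_sub_distrib, potG, pot, ← V3_union_V4, h6]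
  simp only [sum_const, nsmul_eq_mul]
  linarith

lemma Crit.four_le_of_mem_V4 (hG : Crit G) (hv : v ∈ V4 G) : 4 ≤ (nb G v).card := by
  obtain ⟨h1, h2⟩ := mem_V4.1 hv
  have := hG.three_le_deg h1
  omega

/-- A colouring of `A` extends to `B`, if each vertex of `B` sees at most two colours even when its
neighbours in `B` are counted as colours of their own. -/
lemma PC.extend_matching {c : V → Fin 3} (hc : PC G A c) (hd : Disjoint A B)
    (h : ∀ v ∈ B, ((A.filter (G.Adj v)).image c).card + (nb G v ∩ B).card ≤ 2) :
    ∃ c', PC G (A ∪ B) c' ∧ ∀ a ∈ A, c' a = c a := by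
  induction B using Finset.induction with
  | empty => exact ⟨c, by simpa using hc, fun _ _ => rfl⟩
  | insert v B hv ih =>
    rw [disjoint_insert_right] at hd
    have hsub : ∀ w, (nb G w ∩ B).card ≤ (nb G w ∩ insert v B).card := fun w =>
      card_le_card (inter_subset_inter_left (subset_insert _ _))
    obtain ⟨c₁, h2, h3⟩ := ih hd.2 fun w hw => by
      have := h w (mem_insert_of_mem hw)
      have := hsub w
      omega
    obtain ⟨c₂, h4, h5⟩ := h2.extend_of_image (v := v) (by
      have : ((A ∪ B).filter (G.Adj v)).image c₁ ⊆
          (A.filter (G.Adj v)).image c ∪ (nb G v ∩ B).image c₁ := by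
        intro k hk
        obtain ⟨a, ha, rfl⟩ := mem_image.1 hk
        obtain ⟨ha, hva⟩ := mem_filter.1 ha
        rcases mem_union.1 ha with ha | ha
        · rw [h3 a ha]
          exact mem_union_left _ (mem_image_of_mem _ (mem_filter.2 ⟨ha, hva⟩))
        · exact mem_union_right _ (mem_image_of_mem _ (mem_inter.2 ⟨mem_nb.2 hva, ha⟩))
      refine (card_le_card this).trans ((card_union_le _ _).trans ?_)
      have := card_image_le (s := nb G v ∩ B) (f := c₁)
      have := h v (mem_insert_self _ _)
      have := hsub v
      omega) (by simp [hd.1, hv])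
    exact ⟨c₂, by rwa [union_insert], fun a ha => (h5 a (mem_union_left _ ha)).trans (h3 a ha)⟩

/-- Critical graphs without diamonds and with `Star` have negative potential. -/
lemma Crit.potG_neg_of_star (hG : Crit G) (hD : NoDiamond G) (hS : Star G) : potG G < 0 := by
  let L := (V3 G).filter fun x => ∃ y ∈ V3 G, G.Adj x y ∧ 2 ≤ (nb G y ∩ V3 G).card
  -- each `x ∈ L` has a unique neighbour of degree three
  have hL : ∀ x ∈ L, ∃ y u v, nb G x = {y, u, v} ∧ y ∈ V3 G ∧ u ∈ V4 G ∧ v ∈ V4 G ∧ u ≠ v ∧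
      G.Adj u v := by
    intro x hx
    obtain ⟨hx3, y, hy3, hxy, hy2⟩ := mem_filter.1 hx
    obtain ⟨z, hz, hzx⟩ := exists_mem_ne (show 1 < (nb G y ∩ V3 G).card by omega) x
    obtain ⟨hyz, hz3⟩ := mem_inter.1 hz
    rw [mem_nb] at hyz
    obtain ⟨u, v, hnb, hyu, hyv, huv⟩ := exists_nb_eq (mem_V3.1 hx3) hxy
    have hxu : G.Adj x u := by rw [← mem_nb, hnb]; simp
    have hxv : G.Adj x v := by rw [← mem_nb, hnb]; simp
    have huv' := hS x y z u v hx3 hy3 hz3 hxy hyz hzx hxu hxv huv hyu.symm hyv.symm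
    have key : ∀ u v, G.Adj x u → G.Adj x v → u ≠ v → y ≠ u → y ≠ v → G.Adj u v → u ∈ V4 G := by
      intro u v hxu hxv huv hyu hyv huv'
      refine mem_V4.2 ⟨mem_supp_right hxu, fun hu3 => ?_⟩
      obtain ⟨w, hw, hxw, hvw⟩ := exists_nb_eq' hu3 hxu.symm huv' hxv.ne
      have huw : G.Adj u w := by rw [← mem_nb, hw]; simp
      have := hS u x y v w (mem_V3.2 hu3) hx3 hy3 hxu.symm hxy hyu huv' huw hvw hxv.ne.symm hxw.symm
      exact hD x w u v hxw huv' hxu hxv huw.symm this.symm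
    exact ⟨y, u, v, hnb, hy3, key u v hxu hxv huv hyu hyv huv',
      key v u hxv hxu huv.symm hyv hyu huv'.symm, huv, huv'⟩
  have hL3 : ∀ x ∈ L, (nb G x ∩ V3 G).card = 1 := by
    intro x hx
    obtain ⟨y, u, v, hnb, hy, hu, hv, huv, -⟩ := hL x hx
    rw [card_eq_one]
    refine ⟨y, eq_singleton_iff_unique_mem.2 ⟨by simp [hnb, -mem_V3, hy], fun w hw => ?_⟩⟩
    rw [hnb] at hw
    simp only [mem_inter, mem_insert, mem_singleton] at hw
    rcases hw with ⟨rfl | rfl | rfl, hw⟩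
    · rfl
    · exact (disjoint_left.1 disjoint_V3_V4 hw hu).elim
    · exact (disjoint_left.1 disjoint_V3_V4 hw hv).elim
  have hL4 : ∀ x ∈ L, (nb G x ∩ V4 G).card = 2 := by
    intro x hx
    have h1 := card_nb_eq_add (G := G) (v := x)
    have h2 := mem_V3.1 (mem_filter.1 hx).1
    have := hL3 x hx
    omega
  have h1 : ∑ v ∈ V3 G, (((nb G v ∩ V3 G).card : ℤ) - 1) ≤ L.card := by
    have : (L.card : ℤ) = ∑ v ∈ V3 G, ((nb G v ∩ L).card : ℤ) := by
      have h := sum_nb_inter_comm (G := G) (A := V3 G) (B := L)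
      rw [sum_congr rfl hL3] at h
      simp only [sum_const, smul_eq_mul, mul_one] at h
      exact_mod_cast h.symm
    rw [this]
    refine sum_le_sum fun y hy => ?_
    by_cases h2 : 2 ≤ (nb G y ∩ V3 G).card
    · have : nb G y ∩ V3 G ⊆ nb G y ∩ L := by
        intro x hx
        obtain ⟨hx1, hx2⟩ := mem_inter.1 hx
        exact mem_inter.2 ⟨hx1, mem_filter.2 ⟨hx2, y, hy, (mem_nb.1 hx1).symm, h2⟩⟩
      have := card_le_card this
      omega
    · omega
  have h2 : (2 * L.card : ℤ) ≤ ∑ v ∈ V4 G, ((nb G v ∩ V4 G).card : ℤ) := by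
    have h := sum_nb_inter_comm (G := G) (A := L) (B := V4 G)
    rw [sum_congr rfl hL4] at h
    have h' : ∑ v ∈ V4 G, (nb G v ∩ L).card ≤ ∑ v ∈ V4 G, (nb G v ∩ V4 G).card := by
      refine sum_le_sum fun a ha => ?_
      have hex : ∀ x ∈ nb G a ∩ L, ∃ b ∈ nb G a ∩ V4 G, G.Adj x b := by
        intro x hx
        obtain ⟨hx1, hx2⟩ := mem_inter.1 hx
        obtain ⟨y, u, v, hnb, hy, hu, hv, huv, hadj⟩ := hL x hx2
        have hax : a ∈ nb G x := mem_nb.2 (mem_nb.1 hx1).symm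
        rw [hnb] at hax
        simp only [mem_insert, mem_singleton] at hax
        rcases hax with rfl | rfl | rfl
        · exact (disjoint_left.1 disjoint_V3_V4 hy ha).elim
        · exact ⟨v, mem_inter.2 ⟨mem_nb.2 hadj, hv⟩, by rw [← mem_nb, hnb]; simp⟩
        · exact ⟨u, mem_inter.2 ⟨mem_nb.2 hadj.symm, hu⟩, by rw [← mem_nb, hnb]; simp⟩
      choose! f hf1 hf2 using hex
      refine card_le_card_of_injOn f (fun x hx => hf1 x hx) ?_
      intro x hx x' hx' he
      by_contra hne
      have ha1 := mem_nb.1 (mem_inter.1 hx).1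
      have ha2 := mem_nb.1 (mem_inter.1 hx').1
      exact hD x x' a (f x) hne (mem_nb.1 (mem_inter.1 (hf1 x hx)).1) ha1.symm (hf2 x hx) ha2.symm
        (he ▸ hf2 x' hx')
    rw [← h] at h'
    simp only [sum_const, smul_eq_mul] at h'
    have : 2 * L.card ≤ ∑ v ∈ V4 G, (nb G v ∩ V4 G).card := by omega
    exact_mod_cast this
  have h3 : 0 ≤ ∑ v ∈ V4 G, (((nb G v).card : ℤ) - 4) := by
    refine sum_nonneg fun v hv => ?_
    have := hG.four_le_of_mem_V4 hv
    omega
  have h4 := four_mul_potG (G := G)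
  by_contra hneg
  -- now no vertex of degree three has two neighbours of degree three
  have hL0 : L = ∅ := by rw [← card_eq_zero]; omega
  have h5 : ∀ y ∈ V3 G, (nb G y ∩ V3 G).card ≤ 1 := by
    intro y hy
    by_contra h2
    obtain ⟨x, hx⟩ := card_pos.1 (show 0 < (nb G y ∩ V3 G).card by omega)
    obtain ⟨hx1, hx2⟩ := mem_inter.1 hx
    have : x ∈ L := mem_filter.2 ⟨hx2, y, hy, (mem_nb.1 hx1).symm, by omega⟩
    simp [hL0] at this
  have h6 : ∀ v ∈ V4 G, nb G v ∩ V4 G = ∅ := by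
    have h0 : ∑ v ∈ V4 G, ((nb G v ∩ V4 G).card : ℤ) = 0 := by
      refine le_antisymm ?_ (sum_nonneg fun _ _ => by positivity)
      rw [hL0] at h1
      simp only [card_empty] at h1
      omega
    rw [sum_eq_zero_iff_of_nonneg (fun _ _ => by positivity)] at h0
    intro v hv
    exact card_eq_zero.1 (by exact_mod_cast h0 v hv)
  have h7 : PC G (V4 G) (fun _ => 0) := by
    intro a ha b hb hab
    have : b ∈ nb G a ∩ V4 G := mem_inter.2 ⟨mem_nb.2 hab, hb⟩
    simp [h6 a ha] at this
  obtain ⟨c, hc, -⟩ := h7.extend_matching (B := V3 G) disjoint_V3_V4.symm fun v hv => by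
    have h8 : ((V4 G).filter (G.Adj v)).image (fun _ => (0 : Fin 3)) ⊆ {0} := fun k hk => by
      obtain ⟨a, -, rfl⟩ := mem_image.1 hk
      exact mem_singleton_self _
    have := card_le_card h8
    have := h5 v hv
    rw [card_singleton] at *
    omega
  rw [union_comm, V3_union_V4] at hc
  exact hG.not_pc_supp hc

/-! ### Positive potential without monochromatic sets: small potential -/

lemma PC.extend_color {c : V → Fin 3} (h : PC G A c) (k : Fin 3)
    (hk : ∀ a ∈ A, G.Adj v a → c a ≠ k) (hvA : v ∉ A) :
    ∃ c', PC G (insert v A) c' ∧ c' v = k ∧ ∀ a ∈ A, c' a = c a := by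
  have hne : ∀ a ∈ A, a ≠ v := fun a ha e => hvA (e ▸ ha)
  refine ⟨Function.update c v k, ?_, by simp, fun a ha => Function.update_of_ne (hne a ha) _ _⟩
  intro a ha b hb hab
  rcases mem_insert.1 ha with hav | ha' <;> rcases mem_insert.1 hb with hbv | hb'
  · exact (hab.ne (hav.trans hbv.symm)).elim
  · rw [hav, Function.update_self, Function.update_of_ne (hne b hb')]
    exact (hk b hb' (hav ▸ hab)).symm
  · rw [hbv, Function.update_self, Function.update_of_ne (hne a ha')]
    exact hk a ha' (hbv ▸ hab).symm
  · rw [Function.update_of_ne (hne a ha'), Function.update_of_ne (hne b hb')]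
    exact h a ha' b hb' hab

lemma PC.extend_erase {c : V → Fin 3} (h : PC G (A.erase v) c) (hv : v ∈ A) (hS : S.card ≤ 2)
    (hn : ∀ a ∈ A, a ≠ v → G.Adj v a → a ∈ S) :
    ∃ c', PC G A c' ∧ ∀ a ∈ A, a ≠ v → c' a = c a := by
  obtain ⟨c', h1, h2⟩ := h.extend (v := v) (by
    refine (card_le_card fun a ha => ?_).trans hS
    simp only [mem_filter, mem_erase] at ha
    exact hn a ha.1.2 ha.1.1 ha.2) (by simp)
  rw [insert_erase hv] at h1
  exact ⟨c', h1, fun a ha hav => h2 a (mem_erase.2 ⟨hav, ha⟩)⟩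

/-- Two adjacent vertices of degree three with a common neighbour can be coloured last, if their
third neighbours have different colours. -/
lemma PC.extend_pair {c : V → Fin 3} {d e f e' f' : V} (h : PC G (((supp G).erase e).erase f) c)
    (he : nb G e = {d, f, e'}) (hf : nb G f = {d, e, f'}) (hc : c e' ≠ c f') :
    ∃ c', PC G (supp G) c' := by
  have hef : G.Adj e f := by rw [← mem_nb, he]; simp
  have hde : d ≠ e := by
    have : d ∈ nb G e := by rw [he]; simp
    exact (mem_nb.1 this).ne.symm
  have hdf : G.Adj f d := by rw [← mem_nb, hf]; simp
  have hee' : G.Adj e e' := by rw [← mem_nb, he]; simp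
  have hff' : G.Adj f f' := by rw [← mem_nb, hf]; simp
  by_cases hfe : e' = f
  · -- degenerate: then `e` has only two neighbours
    subst hfe
    obtain ⟨c₁, h1, -⟩ := h.extend_erase (S := {d, f'}) (by simp [hef.ne.symm, -mem_supp, mem_supp_right hef])
      card_le_two (fun a ha _ hva => by
        have : a ∈ nb G e' := mem_nb.2 hva
        rw [hf] at this
        simp only [mem_insert, mem_singleton] at this
        rcases this with rfl | rfl | rfl
        · simp
        · simp at ha
        · simp)
    obtain ⟨c₂, h2, -⟩ := h1.extend_erase (S := {d, e'}) (mem_supp_left hef) card_le_two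
      (fun a ha _ hva => by
        have : a ∈ nb G e := mem_nb.2 hva
        rw [he] at this
        simpa using this)
    exact ⟨c₂, h2⟩
  have hfs : f ∈ (supp G).erase e := mem_erase.2 ⟨hef.ne.symm, mem_supp_right hef⟩
  have hdB : d ∈ ((supp G).erase e).erase f :=
    mem_erase.2 ⟨hdf.ne.symm, mem_erase.2 ⟨hde, mem_supp_right hdf⟩⟩
  have he'B : e' ∈ ((supp G).erase e).erase f :=
    mem_erase.2 ⟨hfe, mem_erase.2 ⟨hee'.ne.symm, mem_supp_right hee'⟩⟩
  have hfnb : ∀ a ∈ ((supp G).erase e).erase f, G.Adj f a → a = d ∨ a = f' := by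
    intro a ha hfa
    have : a ∈ nb G f := mem_nb.2 hfa
    rw [hf] at this
    simp only [mem_insert, mem_singleton] at this
    rcases this with rfl | rfl | rfl
    · exact Or.inl rfl
    · simp at ha
    · exact Or.inr rfl
  obtain ⟨c₁, h1, h2, h3⟩ : ∃ c₁, PC G ((supp G).erase e) c₁ ∧
      (∀ a ∈ ((supp G).erase e).erase f, c₁ a = c a) ∧ ∃ k, ∀ a ∈ (supp G).erase e, G.Adj e a →
        c₁ a = c d ∨ c₁ a = k := by
    have hnb : ∀ a, G.Adj e a → a = d ∨ a = f ∨ a = e' := by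
      intro a ha
      have : a ∈ nb G e := mem_nb.2 ha
      rw [he] at this
      simpa using this
    by_cases hde' : c d = c e'
    · obtain ⟨c₁, h1, h2⟩ := h.extend (v := f) (by
        refine (card_le_card (t := {d, f'}) fun a ha => ?_).trans card_le_two
        obtain ⟨ha, hfa⟩ := mem_filter.1 ha
        simpa using hfnb a ha hfa) (by simp)
      rw [insert_erase hfs] at h1
      refine ⟨c₁, h1, h2, c₁ f, fun a ha hea => ?_⟩
      rcases hnb a hea with rfl | rfl | rfl
      · exact Or.inl (h2 a hdB)
      · exact Or.inr rfl
      · exact Or.inl ((h2 a he'B).trans hde'.symm)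
    · obtain ⟨c₁, h1, h3, h2⟩ := h.extend_color (v := f) (c e') (by
        intro a ha hfa
        rcases hfnb a ha hfa with rfl | rfl
        · exact hde'
        · exact hc.symm) (by simp)
      rw [insert_erase hfs] at h1
      refine ⟨c₁, h1, h2, c e', fun a ha hea => ?_⟩
      rcases hnb a hea with rfl | rfl | rfl
      · exact Or.inl (h2 a hdB)
      · exact Or.inr h3
      · exact Or.inr (h2 a he'B)
  obtain ⟨k, hk⟩ := h3
  obtain ⟨c₂, h4, -⟩ := h1.extend_of_image (v := e) (by
    refine (card_le_card (t := {c d, k}) fun i hi => ?_).trans card_le_two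
    obtain ⟨a, ha, rfl⟩ := mem_image.1 hi
    obtain ⟨ha, hea⟩ := mem_filter.1 ha
    simpa using hk a ha hea) (by simp)
  rw [insert_erase (mem_supp_left hef)] at h4
  exact ⟨c₂, h4⟩

lemma Emerald.rot {d e f : V} (h : Emerald G d e f) : Emerald G e f d :=
  ⟨h.ef, h.df.symm, h.de.symm, h.deg_e, h.deg_f, h.deg_d⟩

/-- Deleting an emerald deletes three vertices and six edges. -/
lemma Emerald.pot_sdiff {d e f : V} (h : Emerald G d e f) :
    pot G (supp G \ {d, e, f}) = potG G + 3 := by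
  have hd := mem_supp_left h.de
  have he := mem_supp_left h.ef
  have hf := mem_supp_right h.ef
  set A := supp G \ {d, e, f} with hA
  have hU : supp G = insert d (insert e (insert f A)) := by
    ext a
    simp only [hA, mem_insert, mem_sdiff, mem_singleton]
    constructor
    · intro ha; tauto
    · rintro (rfl | rfl | rfl | ha)
      exacts [hd, he, hf, ha.1]
  have h1 : f ∉ A := by simp [hA]
  have h2 : e ∉ insert f A := by simp [hA, h.ef.ne]
  have h3 : d ∉ insert e (insert f A) := by simp [hA, h.de.ne, h.df.ne]
  have c3 : ((insert e (insert f A)).filter (G.Adj d)).card = 3 := by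
    rw [filter_adj_eq_nb, h.deg_d]
    intro a ha
    have := nb_subset_supp ha
    rw [hU, mem_insert] at this
    exact this.resolve_left (mem_nb.1 ha).ne.symm
  have c2 : ((insert f A).filter (G.Adj e)).card = 2 := by
    have : (insert f A).filter (G.Adj e) = (nb G e).erase d := by
      ext a
      simp only [mem_filter, mem_erase, mem_nb]
      constructor
      · rintro ⟨ha, hea⟩
        exact ⟨fun hd => h3 (mem_insert_of_mem (hd ▸ ha)), hea⟩
      · rintro ⟨had, hea⟩
        have := mem_supp_right hea
        rw [hU, mem_insert, mem_insert] at this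
        exact ⟨(this.resolve_left had).resolve_left hea.ne.symm, hea⟩
    rw [this, card_erase_of_mem (mem_nb.2 h.de.symm), h.deg_e]
  have c1 : (A.filter (G.Adj f)).card = 1 := by
    have : A.filter (G.Adj f) = ((nb G f).erase d).erase e := by
      ext a
      simp only [hA, mem_filter, mem_erase, mem_sdiff, mem_nb, mem_insert, mem_singleton]
      constructor
      · rintro ⟨ha, hea⟩; tauto
      · rintro ⟨hae, had, hfa⟩
        exact ⟨⟨mem_supp_right hfa, by simp [had, hae, hfa.ne.symm]⟩, hfa⟩
    rw [this, card_erase_of_mem (mem_erase.2 ⟨h.de.ne.symm, mem_nb.2 h.ef.symm⟩),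
      card_erase_of_mem (mem_nb.2 h.df.symm), h.deg_f]
  have := pot_insert (G := G) h1
  have := pot_insert (G := G) h2
  have := pot_insert (G := G) h3
  rw [← hU] at this
  rw [potG]
  omega

lemma card_diamond {a b c d : V} (hab : a ≠ b) (hcd : G.Adj c d) (hac : G.Adj a c)
    (had : G.Adj a d) (hbc : G.Adj b c) (hbd : G.Adj b d) : ({a, b, c, d} : Finset V).card = 4 := by
  rw [card_insert_of_notMem (by simp [hab, hac.ne, had.ne]),
    card_eq_three.2 ⟨b, c, d, hbc.ne, hbd.ne, hcd.ne, rfl⟩]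

lemma pot_diamond {a b c d : V} (hab : a ≠ b) (hcd : G.Adj c d) (hac : G.Adj a c)
    (had : G.Adj a d) (hbc : G.Adj b c) (hbd : G.Adj b d) :
    pot G {a, b, c, d} = 5 - if G.Adj a b then 3 else 0 := by
  rw [pot_insert (by simp [hab, hac.ne, had.ne]), pot_insert (by simp [hbc.ne, hbd.ne]),
    pot_insert (by simpa using hcd.ne), pot_singleton]
  rw [filter_insert, filter_insert, filter_insert, filter_singleton, filter_singleton,
    filter_singleton, if_pos hcd, if_pos hbc, if_pos hbd, if_pos hac, if_pos had,
    insert_eq c {d}, ← insert_eq, card_pair hcd.ne, card_singleton]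
  split_ifs with hadj
  · rw [card_eq_three.2 ⟨b, c, d, hbc.ne, hbd.ne, hcd.ne, rfl⟩]; norm_num
  · rw [card_pair hcd.ne]; norm_num

lemma diamond_subset_supp {a b c d : V} (hcd : G.Adj c d) (hac : G.Adj a c) (hbc : G.Adj b c) :
    ({a, b, c, d} : Finset V) ⊆ supp G := by
  simp only [insert_subset_iff, singleton_subset_iff]
  exact ⟨mem_supp_left hac, mem_supp_left hbc, mem_supp_left hcd, mem_supp_right hcd⟩

/-- A critical graph of positive potential, not complete on four vertices, without monochromatic
sets. There is none, as shown below. -/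
structure NM (G : SimpleGraph V) : Prop where
  crit : Crit G
  bound : Bound V (supp G).card
  pos : 1 ≤ potG G
  card_ne : (supp G).card ≠ 4
  none : ∀ M, ¬ Mono G M

namespace NM

lemma five_le (h : NM G) : 5 ≤ (supp G).card := by
  have := h.crit.four_le_card
  have := h.card_ne
  omega

/-- Since there is no monochromatic set, a set of potential at most `5` contracts to a triangle of a graph
`W` of potential `2`. Good configurations of `W` off the triangle transfer to `G`, where they do not
exist; so `W` has four vertices. -/
lemma card_sdiff_le_one (h : NM G) (hR : R ⊆ supp G) (h2 : 2 ≤ R.card) (h5 : pot G R ≤ 5) :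
    (supp G \ R).card ≤ 1 := by
  by_cases hne : R = supp G
  · simp [hne]
  rcases h.crit.mono_or_exact h.bound h.pos hR hne h2 h5 with hM | ⟨hP, -, ρ, W, hE, hW, hX3, hX⟩
  · exact (h.none R hM).elim
  by_cases h4 : (supp W).card = 4
  · have hs : supp G \ R ⊆ supp W \ (supp W ∩ R) := by
      intro a ha
      obtain ⟨ha, haR⟩ := mem_sdiff.1 ha
      exact mem_sdiff.2 ⟨(hE.mem_iff haR).2 ha, fun h => haR (mem_inter.1 h).2⟩
    have := card_le_card hs
    rw [card_sdiff_of_subset inter_subset_left] at this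
    omega
  · exfalso
    have hg := hE.crit.good_of_triangle h.bound hE.lt hW h4 hX3 inter_subset_left hX
    have hR0 : R.Nonempty := card_pos.1 (by omega)
    rcases hE.good hR0 (S := ∅) (by simpa using hg) with ⟨M, hM, -⟩ | ⟨d, e, f, hEm, -⟩
    · exact h.none M hM
    · have hp := hEm.pot_sdiff
      have hc : ({d, e, f} : Finset V).card = 3 :=
        card_eq_three.2 ⟨d, e, f, hEm.de.ne, hEm.df.ne, hEm.ef.ne, rfl⟩
      have hs : {d, e, f} ⊆ supp G := by
        simp only [insert_subset_iff, singleton_subset_iff]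
        exact ⟨mem_supp_left hEm.de, mem_supp_left hEm.ef, mem_supp_right hEm.ef⟩
      have hc2 := card_sdiff_of_subset hs
      have := h.five_le
      rcases h.crit.mono_or_exact h.bound h.pos (R := supp G \ {d, e, f}) sdiff_subset
        (fun he => by rw [he] at hc2; omega) (by omega) (by omega) with hM | hX
      · exact h.none _ hM
      · omega

/-- A diamond has potential at most `5`, and so there is at most one further vertex `v`. The remaining
possibilities are `3`-colourable, because `a` and `b` may share a colour. -/
lemma noDiamond (h : NM G) : NoDiamond G := by
  intro a b c d hab hcd hac had hbc hbd
  have hs := diamond_subset_supp hcd hac hbc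
  have hcard := card_diamond hab hcd hac had hbc hbd
  have hp1 := pot_diamond hab hcd hac had hbc hbd
  have hne : ({a, b, c, d} : Finset V) ≠ supp G := by
    intro e; rw [e] at hcard; exact h.card_ne hcard
  have h4 := h.crit.four_le_pot h.bound h.pos hs hne (by omega)
  have hnab : ¬ G.Adj a b := fun hab => by rw [if_pos hab] at hp1; omega
  rw [if_neg hnab] at hp1
  have h1 := h.card_sdiff_le_one hs (by omega) (by omega)
  obtain ⟨v, hv, hvn⟩ := exists_mem_notMem hs hne
  have hU : ∀ q ∈ supp G, q = v ∨ q = a ∨ q = b ∨ q = c ∨ q = d := by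
    intro q hq
    by_contra hcon
    push Not at hcon
    have := card_le_one.1 h1 q (by simp [hcon, -mem_supp, hq]) v (mem_sdiff.2 ⟨hv, hvn⟩)
    exact hcon.1 this
  have hav : G.Adj a v := by
    by_contra hav
    have h3 := h.crit.three_le_deg (mem_supp_left hac)
    have : nb G a ⊆ {c, d} := by
      intro q hq
      rw [mem_nb] at hq
      rcases hU q (mem_supp_right hq) with rfl | rfl | rfl | rfl | rfl
      · exact (hav hq).elim
      · exact (hq.ne rfl).elim
      · exact (hnab hq).elim
      · simp
      · simp
    have := (card_le_card this).trans card_le_two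
    omega
  have hbv : G.Adj b v := by
    by_contra hav
    have h3 := h.crit.three_le_deg (mem_supp_left hbc)
    have : nb G b ⊆ {c, d} := by
      intro q hq
      rw [mem_nb] at hq
      rcases hU q (mem_supp_right hq) with rfl | rfl | rfl | rfl | rfl
      · exact (hav hq).elim
      · exact (hnab hq.symm).elim
      · exact (hq.ne rfl).elim
      · simp
      · simp
    have := (card_le_card this).trans card_le_two
    omega
  have hUe : supp G = insert v {a, b, c, d} := by
    apply Subset.antisymm
    · intro q hq; simpa using hU q hq
    · exact insert_subset hv hs
  have hpv := pot_insert (G := G) hvn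
  rw [← hUe] at hpv
  have hpos := h.pos
  rw [potG] at hpos
  have hncd : ¬ (G.Adj v c ∧ G.Adj v d) := by
    rintro ⟨h1, h2⟩
    have : ({a, b, c, d} : Finset V).filter (G.Adj v) = {a, b, c, d} := by
      rw [filter_eq_self]
      intro q hq
      simp only [mem_insert, mem_singleton] at hq
      rcases hq with rfl | rfl | rfl | rfl
      exacts [hav.symm, hbv.symm, h1, h2]
    rw [this, hcard] at hpv
    omega
  -- colourings of `G - v` give `a` and `b` the same colour
  obtain ⟨φ, hφ⟩ := h.crit.exists_pc hv hvn
  have hφab : φ a = φ b := by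
    have e1 := hφ a (by simp) c (by simp) hac
    have e2 := hφ a (by simp) d (by simp) had
    have e3 := hφ b (by simp) c (by simp) hbc
    have e4 := hφ b (by simp) d (by simp) hbd
    have e5 := hφ c (by simp) d (by simp) hcd
    generalize φ a = i at *
    generalize φ b = j at *
    generalize φ c = k at *
    generalize φ d = l at *
    revert i j k l
    decide
  obtain ⟨c', hc', -⟩ := hφ.extend_of_image (v := v) (by
    by_cases hvc : G.Adj v c
    · refine (card_le_card (t := {φ a, φ c}) fun k hk => ?_).trans card_le_two
      obtain ⟨q, hq, rfl⟩ := mem_image.1 hk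
      obtain ⟨hq, hvq⟩ := mem_filter.1 hq
      simp only [mem_insert, mem_singleton] at hq
      rcases hq with rfl | rfl | rfl | rfl
      · simp
      · simp [hφab]
      · simp
      · exact (hncd ⟨hvc, hvq⟩).elim
    · refine (card_le_card (t := {φ a, φ d}) fun k hk => ?_).trans card_le_two
      obtain ⟨q, hq, rfl⟩ := mem_image.1 hk
      obtain ⟨hq, hvq⟩ := mem_filter.1 hq
      simp only [mem_insert, mem_singleton] at hq
      rcases hq with rfl | rfl | rfl | rfl
      · simp
      · simp [hφab]
      · exact (hvc hvq).elim
      · simp) hvn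
  rw [← hUe] at hc'
  exact h.crit.not_pc_supp hc'

/-- Two vertices of a set that misses two vertices of the graph can be separated by a colouring. -/
lemma exists_separating (h : NM G) (hA : A ⊆ supp G) (hx : x ∈ supp G) (hxA : x ∉ A)
    (hy : y ∈ supp G) (hyA : y ∉ A) (hxy : x ≠ y) {a b : V} (ha : a ∈ A) (hb : b ∈ A)
    (hab : a ≠ b) : ∃ c, PC G A c ∧ c a ≠ c b := by
  by_contra hcon
  push Not at hcon
  obtain ⟨W, hW⟩ := h.crit.exists_addEdge hx hxA ha hb hab hcon
  have hsub := hW.sub.trans hA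
  have hlt : (supp W).card < (supp G).card :=
    card_lt_card (Finset.ssubset_iff_subset_ne.2 ⟨hsub, fun e => hxA (hW.sub (e ▸ hx))⟩)
  have h1 := (h.bound W hW.crit hlt).1
  have h2 := hW.pot_le
  have h3 := h.card_sdiff_le_one hsub (by have := hW.crit.four_le_card; omega) (by omega)
  exact hxy (card_le_one.1 h3 x (mem_sdiff.2 ⟨hx, fun e => hxA (hW.sub e)⟩) y
    (mem_sdiff.2 ⟨hy, fun e => hyA (hW.sub e)⟩))

/-- Two adjacent vertices `e`, `f` of degree three with a common neighbour are reducible, if each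
colouring of a set that contains their third neighbours extends to all vertices but `e` and `f`. -/
lemma false_of_extend (h : NM G) {d e f e' f' : V} (he : nb G e = {d, f, e'})
    (hf : nb G f = {d, e, f'}) (hde : d ≠ e') (hA : A ⊆ ((supp G).erase e).erase f)
    (he' : e' ∈ A) (hf' : f' ∈ A)
    (hext : ∀ c, PC G A c → ∃ c', PC G (((supp G).erase e).erase f) c' ∧ ∀ a ∈ A, c' a = c a) :
    False := by
  have hef : G.Adj e f := by rw [← mem_nb, he]; simp
  have hef' : e' ≠ f' := by
    rintro rfl
    have h1 : ∀ a ∈ ({d, e'} : Finset V), G.Adj a e ∧ G.Adj a f := by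
      intro a ha
      simp only [mem_insert, mem_singleton] at ha
      constructor <;> apply SimpleGraph.Adj.symm <;> rw [← mem_nb]
      · rw [he]; rcases ha with rfl | rfl <;> simp
      · rw [hf]; rcases ha with rfl | rfl <;> simp
    exact h.noDiamond d e' e f hde hef (h1 d (by simp)).1 (h1 d (by simp)).2 (h1 e' (by simp)).1
      (h1 e' (by simp)).2
  obtain ⟨c, hc, hne⟩ := h.exists_separating (hA.trans ((erase_subset _ _).trans (erase_subset _ _)))
    (mem_supp_left hef) (fun h => by simpa using hA h) (mem_supp_right hef)
    (fun h => by simpa using hA h) hef.ne he' hf' hef'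
  obtain ⟨c', h1, h2⟩ := hext c hc
  obtain ⟨c₂, h3⟩ := h1.extend_pair he hf (by rwa [h2 _ he', h2 _ hf'])
  exact h.crit.not_pc_supp h3

/-- The third neighbours of `e` and `f` can be given different colours, and the vertex `d` then still
allows a colour. -/
lemma not_emerald (h : NM G) {d e f : V} : ¬ Emerald G d e f := by
  intro hE
  obtain ⟨e', he, hde', hfe'⟩ := exists_nb_eq' hE.deg_e hE.de.symm hE.ef hE.df.ne
  obtain ⟨f', hf, hdf', hef'⟩ := exists_nb_eq' hE.deg_f hE.df.symm hE.ef.symm hE.de.ne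
  have hee' : G.Adj e e' := by rw [← mem_nb, he]; simp
  have hff' : G.Adj f f' := by rw [← mem_nb, hf]; simp
  refine h.false_of_extend he hf hde' (A := (((supp G).erase e).erase f).erase d) (erase_subset _ _)
    ?_ ?_ ?_
  · simp only [mem_erase]
    exact ⟨hde'.symm, hfe'.symm, hee'.ne.symm, mem_supp_right hee'⟩
  · simp only [mem_erase]
    exact ⟨hdf'.symm, hff'.ne.symm, hef'.symm, mem_supp_right hff'⟩
  · intro c hc
    obtain ⟨c', h1, h2⟩ := hc.extend_erase (S := ((nb G d).erase e).erase f) (by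
      simp only [mem_erase]
      exact ⟨hE.df.ne, hE.de.ne, mem_supp_left hE.de⟩) (by
      rw [card_erase_of_mem (mem_erase.2 ⟨hE.ef.ne.symm, mem_nb.2 hE.df⟩),
        card_erase_of_mem (mem_nb.2 hE.de), hE.deg_d]; omega) (by
      intro a ha _ hda
      simp only [mem_erase] at ha ⊢
      exact ⟨ha.1, ha.2.1, mem_nb.2 hda⟩)
    exact ⟨c', h1, fun a ha => h2 a (mem_of_mem_erase ha) (ne_of_mem_erase ha)⟩

end NM

/-! ### Positive potential without monochromatic sets: sets of potential six -/

/-- A maximal set of potential six that misses at least three vertices. -/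
structure Bad (G : SimpleGraph V) (R : Finset V) : Prop where
  sub : R ⊆ supp G
  four_le : 4 ≤ R.card
  three_le : 3 ≤ (supp G \ R).card
  pot_le : pot G R ≤ 6
  max : ∀ S ⊆ supp G, R ⊂ S → pot G S ≤ 6 → (supp G \ S).card ≤ 2

/-- A contraction of a bad set along a colouring that is not constant on the boundary. No edge is lost,
and the two or three remaining vertices of the contracted triangle span a clique. -/
structure BadContr (G : SimpleGraph V) (R : Finset V) (φ : V → Fin 3) (ρ : V → V)
    (W : SimpleGraph V) : Prop where
  nm : NM G
  bad : Bad G R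
  contr : Contr G R φ ρ W 0
  union : R ∪ supp W = supp G
  clique : ∀ a ∈ supp W ∩ R, ∀ b ∈ supp W ∩ R, a ≠ b → W.Adj a b
  cases : ((supp W ∩ R).card = 3 ∧ potG W = potG G) ∨
    ((supp W ∩ R).card = 2 ∧ potG W = 2 ∧ potG G = 1)

namespace NM

/-- Adding a vertex with two neighbours in a bad set would lower the potential to at most `5`. -/
lemma bad_unique (h : NM G) (hb : Bad G R) {q r r' : V} (hq : q ∉ R) (hr : r ∈ R) (hr' : r' ∈ R)
    (hqr : G.Adj q r) (hqr' : G.Adj q r') : r = r' := by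
  by_contra hne
  have h2 : 2 ≤ (R.filter (G.Adj q)).card := by
    rw [← card_pair hne]
    refine card_le_card fun a ha => ?_
    simp only [mem_insert, mem_singleton] at ha
    rcases ha with rfl | rfl
    · exact mem_filter.2 ⟨hr, hqr⟩
    · exact mem_filter.2 ⟨hr', hqr'⟩
  have h1 := pot_insert (G := G) hq
  have h3 := hb.pot_le
  have h4 := hb.four_le
  have h5 := h.card_sdiff_le_one (R := insert q R) (insert_subset (mem_supp_left hqr) hb.sub)
    (by rw [card_insert_of_notMem hq]; omega) (by omega)
  have h6 : supp G \ R ⊆ insert q (supp G \ insert q R) := by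
    intro a ha
    simp only [mem_insert, mem_sdiff, not_or] at ha ⊢
    tauto
  have h7 := (card_le_card h6).trans (card_insert_le _ _)
  have := hb.three_le
  omega

/-- Two boundary vertices of a bad set can be separated by a colouring; the contraction along it is
determined by its potential up to the cases listed in `BadContr`. -/
lemma exists_badContr (h : NM G) (hb : Bad G R) : ∃ φ ρ W, BadContr G R φ ρ W := by
  have h3 := hb.three_le
  have hne : R ≠ supp G := by
    rintro rfl; simp at h3
  obtain ⟨x, hx, y, hy, hxy⟩ := one_lt_card.1 (show 1 < (supp G \ R).card by omega)
  rw [mem_sdiff] at hx hy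
  have h4 := hb.four_le
  have h6 := hb.pot_le
  obtain ⟨a, ha, b, hb', hab⟩ := h.crit.exists_bd hb.sub hne (by omega)
  obtain ⟨φ, hφ, hφab⟩ := h.exists_separating hb.sub hx.1 hx.2 hy.1 hy.2 hxy (mem_bd.1 ha).1
    (mem_bd.1 hb').1 hab
  obtain ⟨ρ, W, l, hC⟩ := h.crit.exists_contr hb.sub hne h4 hφ
  have hp := hC.pot_eq
  have hW := (h.bound W hC.crit hC.lt).1
  have hpi := pot_card_le_three (W := W) hC.ne hC.card_le
  have h5 : 5 ≤ pot W (supp W ∩ R) := by rcases hpi with h | h | h | h <;> omega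
  have hT : R ∪ supp W = supp G := by
    by_contra hT
    have := h.crit.four_le_pot h.bound h.pos (union_subset hb.sub hC.sub) hT
      (le_trans (by omega) (card_le_card subset_union_left))
    omega
  have hTP : pot G (R ∪ supp W) = potG G := by rw [hT, potG]
  rw [hTP] at hp
  have hpos := h.pos
  have h6' : 6 ≤ pot G R := by
    by_contra hlt
    have := h.card_sdiff_le_one hb.sub (by omega) (by omega)
    omega
  obtain rfl : l = 0 := by omega
  rcases hpi with h7 | h7 | h7 | h7
  · exact (hφab (hC.const_of_card_one hT h7.1 a ha b hb')).elim
  · exact ⟨φ, ρ, W, h, hb, hC, hT, h7.2.2, Or.inl ⟨h7.1, by omega⟩⟩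
  · exact ⟨φ, ρ, W, h, hb, hC, hT, h7.2.2, Or.inr ⟨h7.1, by omega, by omega⟩⟩
  · omega

end NM

namespace BadContr
variable {φ : V → Fin 3} {ρ ρ₁ : V → V} {R₁ : Finset V} {W₁ : SimpleGraph V} {x₁ : V}

lemma exact (h : BadContr G R φ ρ W) : Exact G R ρ W := h.contr.toExact h.union

/-- A vertex outside `R` has at most one neighbour in the contracted triangle. -/
lemma unique (h : BadContr G R φ ρ W) {q a b : V} (hq : q ∉ R) (ha : a ∈ R) (hb : b ∈ R)
    (hqa : W.Adj q a) (hqb : W.Adj q b) : a = b := by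
  obtain ⟨r, hr, hra, hqr⟩ := h.exact.cross q a hq ha hqa
  obtain ⟨s, hs, hsb, hqs⟩ := h.exact.cross q b hq hb hqb
  rw [← hra, ← hsb, h.nm.bad_unique h.bad hq hr hs hqr hqs]

lemma bound (h : BadContr G R φ ρ W) : Bound V (supp W).card := h.nm.bound.mono h.contr.lt.le

lemma one_le (h : BadContr G R φ ρ W) : 1 ≤ potG W := by
  have := h.nm.pos
  rcases h.cases with h | h <;> omega

/-- Uncontracting `S` costs potential only for the vertices that `S` misses in the triangle. -/
lemma pot_union_le (h : BadContr G R φ ρ W) :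
    pot G (R ∪ S) + pot W (S ∩ R) ≤ 6 + pot W S := by
  have h1 := h.contr.pot_union_le (Xs := S ∩ R) (B := S \ R) inter_subset_right sdiff_disjoint
  rw [union_sdiff_self_eq_union, union_comm (S ∩ R), sdiff_union_inter] at h1
  have := h.bad.pot_le
  omega

/-- The last case: the contracted triangle has lost a vertex, a monochromatic set `R₁` of `W`
meets it in the single vertex `a`, and `W/R₁` is complete on four vertices. -/
lemma false_of_two (h : BadContr G R φ ρ W) (hR₁ : Mono W R₁) (hs : Split W R₁ ρ₁ W₁ x₁)
    {a b : V} (hab : a ≠ b) (hX : supp W ∩ R = {a, b}) (hPW : potG W = 2) (hi : R₁ ∩ R = {a})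
    (h4 : (supp W₁).card = 4) : False := by
  have hE := h.exact
  have haX : a ∈ supp W ∩ R := by simp [hX]
  have hbX : b ∈ supp W ∩ R := by simp [hX]
  obtain ⟨haW, haR⟩ := mem_inter.1 haX
  obtain ⟨hbW, hbR⟩ := mem_inter.1 hbX
  have hadj := h.clique a haX b hbX hab
  have haR₁ : a ∈ R₁ := (mem_inter.1 (hi ▸ mem_singleton_self a : a ∈ R₁ ∩ R)).1
  have honly : ∀ t ∈ R₁, t ∈ R → t = a := fun t h1 h2 => by
    rw [← mem_singleton, ← hi]; exact mem_inter.2 ⟨h1, h2⟩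
  have hbR₁ : b ∉ R₁ := fun hb => hab (honly b hb hbR).symm
  have hc3 : (supp W \ R₁).card = 3 := by have := hs.card_eq; omega
  have hbY : b ∈ supp W \ R₁ := mem_sdiff.2 ⟨hbW, hbR₁⟩
  obtain ⟨y₁, y₂, hy, hY⟩ := card_eq_two.1 (show ((supp W \ R₁).erase b).card = 2 by
    rw [card_erase_of_mem hbY, hc3])
  have hYmem : ∀ q ∈ ({y₁, y₂} : Finset V), q ∈ supp W ∧ q ∉ R₁ ∧ q ∉ R ∧ q ≠ b := by
    intro q hq
    rw [← hY, mem_erase, mem_sdiff] at hq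
    refine ⟨hq.2.1, hq.2.2, fun hqR => ?_, hq.1⟩
    have : q ∈ supp W ∩ R := mem_inter.2 ⟨hq.2.1, hqR⟩
    rw [hX] at this
    simp only [mem_insert, mem_singleton] at this
    rcases this with rfl | rfl
    · exact hq.2.2 haR₁
    · exact hq.1 rfl
  obtain ⟨hy1W, hy1R₁, hy1R, hy1b⟩ := hYmem y₁ (by simp)
  obtain ⟨hy2W, hy2R₁, hy2R, hy2b⟩ := hYmem y₂ (by simp)
  have hW₁ : ∀ q, q ∈ supp W → q ∉ R₁ → q ∈ supp W₁ := fun q h1 h2 => (hs.mem_iff h2).2 h1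
  have hK := (potG_of_card_four hs.crit h4).2
  have hEm := emerald_of_card_four hs.crit h4 (hW₁ _ hy1W hy1R₁) (hW₁ _ hy2W hy2R₁)
    (hW₁ _ hbW hbR₁) hy hy2b hy1b
  have hyy : G.Adj y₁ y₂ := (hE.out _ _ hy1R hy2R).1 ((hs.out _ _ hy1R₁ hy2R₁).1 hEm.de)
  have hdeg1 : (nb G y₁).card = 3 := by
    rw [← hE.deg hy1R, ← hs.deg hy1R₁]; exact hEm.deg_d
  have hdeg2 : (nb G y₂).card = 3 := by
    rw [← hE.deg hy2R, ← hs.deg hy2R₁]; exact hEm.deg_e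
  have hyb : ∀ q ∈ ({y₁, y₂} : Finset V), W.Adj q b := by
    intro q hq
    obtain ⟨h1, h2, h3, h5⟩ := hYmem q hq
    exact (hs.out q b h2 hbR₁).1 (hK q (hW₁ q h1 h2) b (hW₁ b hbW hbR₁) h5)
  -- the neighbours of `y₁` and `y₂` in `R₁`
  have hr : ∀ q ∈ ({y₁, y₂} : Finset V), ∃ r ∈ R₁, W.Adj q r ∧ r ≠ a ∧ r ∉ R := by
    intro q hq
    obtain ⟨h1, h2, h3, h5⟩ := hYmem q hq
    obtain ⟨r, hr, hqr⟩ := (hs.adj_iff h2).1 (hK q (hW₁ q h1 h2) x₁ hs.mem.1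
      (fun e => h2 (e ▸ hs.mem.2)))
    have hra : r ≠ a := fun e => hab (h.unique h3 haR hbR (e ▸ hqr) (hyb q hq))
    exact ⟨r, hr, hqr, hra, fun hrR => hra (honly r hr hrR)⟩
  obtain ⟨r₁, hr1, hyr1, hr1a, hr1R⟩ := hr y₁ (by simp)
  obtain ⟨r₂, hr2, hyr2, hr2a, hr2R⟩ := hr y₂ (by simp)
  have hleave : ∀ t ∈ R₁, t ≠ a → ∀ q, q ∉ R₁ → W.Adj t q →
      (q = y₁ ∧ t = r₁) ∨ (q = y₂ ∧ t = r₂) := by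
    intro t ht hta q hq htq
    have hqb : q ≠ b := by
      rintro rfl
      exact hta (hs.unique hq ht haR₁ htq.symm hadj.symm)
    have : q ∈ (supp W \ R₁).erase b := mem_erase.2 ⟨hqb, mem_sdiff.2 ⟨mem_supp_right htq, hq⟩⟩
    rw [hY] at this
    simp only [mem_insert, mem_singleton] at this
    rcases this with rfl | rfl
    · exact Or.inl ⟨rfl, hs.unique hq ht hr1 htq.symm hyr1⟩
    · exact Or.inr ⟨rfl, hs.unique hq ht hr2 htq.symm hyr2⟩
  have hUy : ∀ S ⊆ R₁, (∀ q ∈ ({y₁, y₂} : Finset V), q ∈ supp G \ (R ∪ S)) := by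
    intro S hS q hq
    obtain ⟨h1, h2, h3, h5⟩ := hYmem q hq
    rw [mem_sdiff, mem_union]
    exact ⟨h.contr.sub h1, fun h => h.elim h3 fun h => h2 (hS h)⟩
  have hWP := hs.pot_add
  have hP1 := (potG_of_card_four hs.crit h4).1
  -- by maximality of `R`, the critical graph in `W[R₁] + a r` uses all of `R₁`
  have hfull : ∀ r ∈ R₁, r ≠ a → r ∈ bd W R₁ →
      ∃ W', Full W R₁ a r W' ∧ 1 ≤ potG W' ∧ (supp W').card < (supp W).card := by
    intro r hr hra hrb
    obtain ⟨W', hW', hP', hlt⟩ := hR₁.exists_addEdge h.contr.crit h.bound h.one_le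
      (mem_bd.2 ⟨haR₁, b, hbR₁, hadj⟩) hrb hra.symm
    have h2 := (h.bound W' hW'.crit hlt).1
    have hpl := hW'.pot_le
    have haS : a ∈ supp W' := mem_supp_left hW'.adj
    have hSR : supp W' ∩ R = {a} := by
      apply Subset.antisymm
      · rw [← hi]; exact inter_subset_inter_right hW'.sub
      · simpa only [singleton_subset_iff] using mem_inter.2 ⟨haS, haR⟩
    have h5 := h.pot_union_le (S := supp W')
    rw [hSR, pot_singleton] at h5
    have hss : R ⊂ R ∪ supp W' := by
      refine Finset.ssubset_iff_subset_ne.2 ⟨subset_union_left, fun e => ?_⟩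
      have h6 : supp W' ∩ R = supp W' := inter_eq_left.2 (e ▸ subset_union_right)
      have h7 := hW'.crit.four_le_card
      rw [← h6, hSR, card_singleton] at h7
      omega
    have h6 := h.bad.max _ (union_subset h.bad.sub ((hW'.sub.trans hR₁.sub).trans h.contr.sub)) hss
      (by omega)
    have hS : supp W' = R₁ := by
      refine Subset.antisymm hW'.sub fun t ht => ?_
      by_contra htS
      have hta : t ≠ a := fun e => htS (e ▸ haS)
      have h7 : ({t, y₁, y₂} : Finset V) ⊆ supp G \ (R ∪ supp W') := by
        rw [insert_subset_iff]
        refine ⟨?_, fun q hq => hUy _ hW'.sub q hq⟩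
        rw [mem_sdiff, mem_union]
        exact ⟨h.contr.sub (hR₁.sub ht), fun h => h.elim (fun h => hta (honly t ht h)) htS⟩
      have h8 := card_le_card h7
      rw [card_eq_three.2 ⟨t, y₁, y₂, fun e => hy1R₁ (e ▸ ht), fun e => hy2R₁ (e ▸ ht), hy, rfl⟩] at h8
      omega
    exact ⟨W', hW'.full hS (by rw [hS]; omega), hP', hlt⟩
  have hr1b : r₁ ∈ bd W R₁ := mem_bd.2 ⟨hr1, y₁, hy1R₁, hyr1.symm⟩
  have hr2b : r₂ ∈ bd W R₁ := mem_bd.2 ⟨hr2, y₂, hy2R₁, hyr2.symm⟩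
  -- the argument continues in `W[R₁] + a r₁`, with a good configuration off `a`
  obtain ⟨W', hF, hP', hlt⟩ := hfull r₁ hr1 hr1a hr1b
  -- `r₁` has large degree in `W'`, unless `r₁ = r₂`
  have hdr : r₁ ≠ r₂ → (nb W' r₁).card ≠ 3 := by
    intro hne
    obtain ⟨W'', hF', -, -⟩ := hfull r₂ hr2 hr2a hr2b
    have h1 := hF'.crit.three_le_deg (v := r₁) (by rw [hF'.supp_eq]; exact hr1)
    rw [hF'.nb_of_ne hr1 hr1a hne] at h1
    have h2 : insert a ((nb W r₁).filter (· ∈ R₁)) ⊆ nb W' r₁ := by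
      rw [insert_subset_iff]
      refine ⟨mem_nb.2 hF.adj.symm, fun q hq => ?_⟩
      obtain ⟨hq, hqR⟩ := mem_filter.1 hq
      exact mem_nb.2 ((hF.adj_iff r₁ hr1 q hqR).2 (Or.inl (mem_nb.1 hq)))
    have h3 := card_le_card h2
    rw [card_insert_of_notMem (fun hc => hF.not_adj (mem_nb.1 (mem_filter.1 hc).1).symm)] at h3
    omega
  have hlt' := hlt.trans h.contr.lt
  rcases hF.crit.good h.nm.bound hlt' hP' a with ⟨M, hM, hd⟩ | ⟨d, e, f, hEm', hda, hea, hfa⟩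
  · have haM : a ∉ M := by simpa using hd
    have hMR₁ : M ⊆ R₁ := hF.supp_eq ▸ hM.sub
    have hMR : Disjoint M R := by
      rw [disjoint_left]
      exact fun t ht htR => haM (honly t (hMR₁ ht) htR ▸ ht)
    have hp : pot G M ≤ 5 := by
      rw [← hE.pot_eq hMR, ← hF.pot_eq hMR₁ haM]; exact hM.pot_le
    have h1 := h.nm.card_sdiff_le_one ((hMR₁.trans hR₁.sub).trans h.contr.sub) hM.two_le hp
    refine hy (card_le_one.1 h1 _ ?_ _ ?_)
    · exact mem_sdiff.2 ⟨h.contr.sub hy1W, fun hc => hy1R₁ (hMR₁ hc)⟩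
    · exact mem_sdiff.2 ⟨h.contr.sub hy2W, fun hc => hy2R₁ (hMR₁ hc)⟩
  · have hmemR : ∀ t ∈ R₁, t ≠ a → t ∉ R := fun t ht hta htR => hta (honly t ht htR)
    have hadjG : ∀ p ∈ R₁, ∀ q ∈ R₁, p ≠ a → q ≠ a → W'.Adj p q → G.Adj p q := by
      intro p hp q hq hpa hqa hpq
      exact (hE.out p q (hmemR p hp hpa) (hmemR q hq hqa)).1 ((hF.adj_of_ne hp hq hpa hqa).1 hpq)
    -- away from `a` and `r₂`, vertices of degree three have degree three in `G` as well
    have hdegG : ∀ t ∈ R₁, t ≠ a → t ≠ r₂ → (nb W' t).card = 3 →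
        (nb G t).card = 3 ∧ t ≠ r₁ := by
      intro t ht hta ht2 h3
      have ht1 : t ≠ r₁ := by
        rintro rfl
        exact hdr ht2 h3
      refine ⟨?_, ht1⟩
      rw [← hE.deg (hmemR t ht hta), ← hF.deg_of_ne ht hta ht1 ?_, h3]
      intro q hq htq
      rcases hleave t ht hta q hq htq with h | h
      · exact ht1 h.2
      · exact ht2 h.2
    -- a vertex `r₂` of degree three can have one more neighbour in `G`
    have hdeg4 : (nb W' r₂).card = 3 → (nb G r₂).card ≤ 4 := by
      intro h3
      rw [← hE.deg hr2R]
      have h1 : nb W r₂ = (nb W r₂).filter (· ∈ R₁) ∪ (nb W r₂).filter (· ∉ R₁) :=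
        (filter_union_filter_not_eq _ _).symm
      have h2 := card_union_le ((nb W r₂).filter (· ∈ R₁)) ((nb W r₂).filter (· ∉ R₁))
      rw [← h1] at h2
      by_cases he : r₁ = r₂
      · have h5 : insert a ((nb W r₂).filter (· ∈ R₁)) ⊆ nb W' r₂ := by
          rw [insert_subset_iff]
          refine ⟨mem_nb.2 (he ▸ hF.adj.symm), fun q hq => ?_⟩
          obtain ⟨hq, hqR⟩ := mem_filter.1 hq
          exact mem_nb.2 ((hF.adj_iff r₂ hr2 q hqR).2 (Or.inl (mem_nb.1 hq)))
        have h6 := card_le_card h5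
        rw [card_insert_of_notMem
          (fun hc => hF.not_adj (he ▸ (mem_nb.1 (mem_filter.1 hc).1).symm))] at h6
        have h7 : (nb W r₂).filter (· ∉ R₁) ⊆ {y₁, y₂} := by
          intro q hq
          obtain ⟨hq, hqR⟩ := mem_filter.1 hq
          rcases hleave r₂ hr2 hr2a q hqR (mem_nb.1 hq) with h | h <;> simp [h.1]
        have h8 := (card_le_card h7).trans card_le_two
        omega
      · have h5 : (nb W r₂).filter (· ∈ R₁) ⊆ nb W' r₂ := by
          intro q hq
          obtain ⟨hq, hqR⟩ := mem_filter.1 hq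
          exact mem_nb.2 ((hF.adj_iff r₂ hr2 q hqR).2 (Or.inl (mem_nb.1 hq)))
        have h6 := card_le_card h5
        have h7 : (nb W r₂).filter (· ∉ R₁) ⊆ {y₂} := by
          intro q hq
          obtain ⟨hq, hqR⟩ := mem_filter.1 hq
          rcases hleave r₂ hr2 hr2a q hqR (mem_nb.1 hq) with h | h
          · exact (he h.2.symm).elim
          · simp [h.1]
        have h8 := card_le_card h7
        rw [card_singleton] at h8
        omega
    -- an emerald of `W'` through `r₂` is reducible in `G`
    have main : ∀ e f, Emerald W' r₂ e f → e ≠ a → f ≠ a → False := by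
      intro e f hEm hea hfa
      have he : e ∈ R₁ := hF.supp_eq ▸ mem_supp_left hEm.ef
      have hf : f ∈ R₁ := hF.supp_eq ▸ mem_supp_right hEm.ef
      obtain ⟨hde, her⟩ := hdegG e he hea hEm.de.ne.symm hEm.deg_e
      obtain ⟨hdf, hfr⟩ := hdegG f hf hfa hEm.df.ne.symm hEm.deg_f
      have ade := hadjG _ hr2 _ he hr2a hea hEm.de
      have adf := hadjG _ hr2 _ hf hr2a hfa hEm.df
      have aef := hadjG _ he _ hf hea hfa hEm.ef
      obtain ⟨e', hne, hde', hfe'⟩ := exists_nb_eq' hde ade.symm aef adf.ne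
      obtain ⟨f', hnf, hdf', hef'⟩ := exists_nb_eq' hdf adf.symm aef.symm ade.ne
      have hee' : G.Adj e e' := by rw [← mem_nb, hne]; simp
      have hff' : G.Adj f f' := by rw [← mem_nb, hnf]; simp
      have hny : ∀ t ∈ R₁, t ≠ a → t ≠ r₁ → t ≠ r₂ → ∀ q, G.Adj t q → q ≠ y₁ ∧ q ≠ y₂ := by
        intro t ht hta ht1 ht2 q htq
        constructor
        · rintro rfl
          rcases hleave t ht hta q hy1R₁ ((hE.out t q (hmemR t ht hta) hy1R).2 htq) with h | h
          exacts [ht1 h.2, ht2 h.2]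
        · rintro rfl
          rcases hleave t ht hta q hy2R₁ ((hE.out t q (hmemR t ht hta) hy2R).2 htq) with h | h
          exacts [ht1 h.2, ht2 h.2]
      obtain ⟨he'1, he'2⟩ := hny e he hea her hEm.de.ne.symm e' hee'
      obtain ⟨hf'1, hf'2⟩ := hny f hf hfa hfr hEm.df.ne.symm f' hff'
      have hyR : ∀ t ∈ R₁, t ≠ y₁ ∧ t ≠ y₂ := fun t ht =>
        ⟨fun e => hy1R₁ (e ▸ ht), fun e => hy2R₁ (e ▸ ht)⟩
      have hy2r2 : G.Adj y₂ r₂ := (hE.out _ _ hy2R hr2R).1 hyr2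
      refine h.nm.false_of_extend hne hnf hde'
        (A := (((((supp G).erase e).erase f).erase r₂).erase y₂).erase y₁) ?_ ?_ ?_ ?_
      · exact (erase_subset _ _).trans ((erase_subset _ _).trans (erase_subset _ _))
      · simp only [mem_erase]
        exact ⟨he'1, he'2, hde'.symm, hfe'.symm, hee'.ne.symm, mem_supp_right hee'⟩
      · simp only [mem_erase]
        exact ⟨hf'1, hf'2, hdf'.symm, hff'.ne.symm, hef'.symm, mem_supp_right hff'⟩
      · intro c hc
        obtain ⟨c₁, h1, e1⟩ := hc.extend_erase (S := (nb G y₁).erase y₂) (by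
          simp only [mem_erase]
          exact ⟨hy, (hyR _ hr2).1.symm, (hyR _ hf).1.symm, (hyR _ he).1.symm, h.contr.sub hy1W⟩) (by
          rw [card_erase_of_mem (mem_nb.2 hyy), hdeg1]) (by
          intro q hq _ hqy
          simp only [mem_erase] at hq
          exact mem_erase.2 ⟨hq.1, mem_nb.2 hqy⟩)
        obtain ⟨c₂, h2, e2⟩ := h1.extend_erase (S := (nb G y₂).erase r₂) (by
          simp only [mem_erase]
          exact ⟨(hyR _ hr2).2.symm, (hyR _ hf).2.symm, (hyR _ he).2.symm, h.contr.sub hy2W⟩) (by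
          rw [card_erase_of_mem (mem_nb.2 hy2r2), hdeg2]) (by
          intro q hq _ hqy
          simp only [mem_erase] at hq
          exact mem_erase.2 ⟨hq.1, mem_nb.2 hqy⟩)
        obtain ⟨c₃, h3, e3⟩ := h2.extend_erase (S := ((nb G r₂).erase e).erase f) (by
          simp only [mem_erase]
          exact ⟨adf.ne, ade.ne, mem_supp_left ade⟩) (by
          rw [card_erase_of_mem (mem_erase.2 ⟨aef.ne.symm, mem_nb.2 adf⟩),
            card_erase_of_mem (mem_nb.2 ade)]
          have := hdeg4 hEm.deg_d
          omega) (by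
          intro q hq _ hqy
          simp only [mem_erase] at hq ⊢
          exact ⟨hq.1, hq.2.1, mem_nb.2 hqy⟩)
        refine ⟨c₃, h3, fun t ht => ?_⟩
        simp only [mem_erase] at ht
        obtain ⟨t1, t2, t3, t4, t5, t6⟩ := ht
        rw [e3 t (by simp only [mem_erase]; exact ⟨t4, t5, t6⟩) t3,
          e2 t (by simp only [mem_erase]; exact ⟨t3, t4, t5, t6⟩) t2,
          e1 t (by simp only [mem_erase]; exact ⟨t2, t3, t4, t5, t6⟩) t1]
    simp only [mem_singleton] at hda hea hfa
    by_cases hd2 : d = r₂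
    · exact main e f (hd2 ▸ hEm') hea hfa
    by_cases he2 : e = r₂
    · exact main f d (he2 ▸ hEm'.rot) hfa hda
    by_cases hf2 : f = r₂
    · exact main d e (hf2 ▸ hEm'.rot.rot) hda hea
    have hd' : d ∈ R₁ := hF.supp_eq ▸ mem_supp_left hEm'.de
    have he' : e ∈ R₁ := hF.supp_eq ▸ mem_supp_left hEm'.ef
    have hf' : f ∈ R₁ := hF.supp_eq ▸ mem_supp_right hEm'.ef
    exact h.nm.not_emerald ⟨hadjG _ hd' _ he' hda hea hEm'.de, hadjG _ he' _ hf' hea hfa hEm'.ef,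
      hadjG _ hd' _ hf' hda hfa hEm'.df, (hdegG d hd' hda hd2 hEm'.deg_d).1,
      (hdegG e he' hea he2 hEm'.deg_e).1, (hdegG f hf' hfa hf2 hEm'.deg_f).1⟩

/-- A bad contraction `W` has potential `2` and a triangle, or a monochromatic set `R₁`. According to its
intersection with the contracted triangle, `R₁` gives a monochromatic set of `G`, or a set of small
potential, or it meets the triangle in one vertex and `W/R₁` is complete on four vertices. -/
lemma false (h : BadContr G R φ ρ W) : False := by
  have hE := h.exact
  have hR0 : R.Nonempty := card_pos.1 (by have := h.bad.four_le; omega)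
  have hk : (supp W ∩ R).card = 2 ∨ (supp W ∩ R).card = 3 := by
    rcases h.cases with h | h
    exacts [Or.inr h.1, Or.inl h.1]
  have hWc : (supp G \ R).card + (supp W ∩ R).card = (supp W).card := by
    have : supp G \ R = supp W \ R := by
      ext q; simp only [mem_sdiff]
      exact ⟨fun hq => ⟨(hE.mem_iff hq.2).2 hq.1, hq.2⟩, fun hq => ⟨(hE.mem_iff hq.2).1 hq.1, hq.2⟩⟩
    rw [this, card_sdiff_add_card_inter]
  have h3 := h.bad.three_le
  by_cases hc : (supp W ∩ R).card = 3 ∧ potG W = 2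
  · have hg := h.contr.crit.good_of_triangle h.nm.bound h.contr.lt hc.2 (by omega) hc.1
      inter_subset_left h.clique
    rcases hE.good hR0 (S := ∅) (by simpa using hg) with ⟨M, hM, -⟩ | ⟨d, e, f, hEm, -⟩
    · exact h.nm.none M hM
    · exact h.nm.not_emerald hEm
  obtain ⟨R₁, hR₁⟩ := ((h.nm.bound W h.contr.crit h.contr.lt).2 h.one_le).resolve_left (by omega)
  obtain ⟨ρ₁, W₁, x₁, hs⟩ := hR₁.exists_split h.contr.crit h.bound h.one_le
  have hP₁ := hs.one_le hR₁ h.one_le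
  have hlt₁ := hs.lt.trans h.contr.lt
  have h4₁ := hs.crit.four_le_card
  have hc₁ := hs.card_eq
  have hUW : supp G \ (R ∪ R₁) = supp W \ (R ∪ R₁) := by
    ext q
    simp only [mem_sdiff, mem_union, not_or]
    exact ⟨fun hq => ⟨(hE.mem_iff hq.2.1).2 hq.1, hq.2⟩, fun hq => ⟨(hE.mem_iff hq.2.1).1 hq.1, hq.2⟩⟩
  have hpu := h.pot_union_le (S := R₁)
  have hp5 := hR₁.pot_le
  have hsub : R ∪ R₁ ⊆ supp G := union_subset h.bad.sub (hR₁.sub.trans h.contr.sub)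
  have h2 : 2 ≤ (R ∪ R₁).card := hR₁.two_le.trans (card_le_card subset_union_right)
  have hiX : R₁ ∩ R ⊆ supp W ∩ R := inter_subset_inter_right hR₁.sub
  by_cases hXR : supp W ∩ R ⊆ R₁
  · have hi : R₁ ∩ R = supp W ∩ R :=
      Subset.antisymm hiX fun q hq => mem_inter.2 ⟨hXR hq, (mem_inter.1 hq).2⟩
    have h6 : 6 ≤ pot W (supp W ∩ R) := by
      rcases pot_card_le_three (W := W) h.contr.ne h.contr.card_le with h | h | h | h <;> omega
    rw [hi] at hpu
    have h1 := h.nm.card_sdiff_le_one hsub h2 (by omega)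
    have h5 : supp W \ R₁ ⊆ supp G \ (R ∪ R₁) := by
      rw [hUW]
      intro q hq
      rw [mem_sdiff] at hq
      rw [mem_sdiff, mem_union]
      exact ⟨hq.1, fun hc => hc.elim (fun hqR => hq.2 (hXR (mem_inter.2 ⟨hq.1, hqR⟩))) hq.2⟩
    have := card_le_card h5
    omega
  -- `R₁` meets the contracted triangle in at most one vertex, as outer vertices have at most one
  -- neighbour in `R₁`
  obtain ⟨b, hbX, hbR₁⟩ := not_subset.1 hXR
  have hi1 : (R₁ ∩ R).card ≤ 1 := by
    rw [card_le_one]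
    intro p hp q hq
    have hpb : b ≠ p := fun e => hbR₁ (e ▸ (mem_inter.1 hp).1)
    have hqb : b ≠ q := fun e => hbR₁ (e ▸ (mem_inter.1 hq).1)
    exact hs.unique hbR₁ (mem_inter.1 hp).1 (mem_inter.1 hq).1 (h.clique b hbX p (hiX hp) hpb)
      (h.clique b hbX q (hiX hq) hqb)
  by_cases hi0 : R₁ ∩ R = ∅
  · exact h.nm.none _ (hE.mono hR0 hR₁ (disjoint_iff_inter_eq_empty.2 hi0))
  obtain ⟨a, ha⟩ := card_eq_one.1 (show (R₁ ∩ R).card = 1 by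
    have := card_pos.2 (nonempty_iff_ne_empty.2 hi0); omega)
  rw [ha, pot_singleton] at hpu
  have haX : a ∈ supp W ∩ R := hiX (by simp [ha])
  have hss : R ⊂ R ∪ R₁ := by
    refine Finset.ssubset_iff_subset_ne.2 ⟨subset_union_left, fun e => ?_⟩
    have h6 : R₁ ∩ R = R₁ := inter_eq_left.2 (e ▸ subset_union_right)
    have h7 := hR₁.four_le
    rw [← h6, ha, card_singleton] at h7
    omega
  have hmax := h.bad.max _ hsub hss (by omega)
  have hle : (supp W \ R₁).card + 1 ≤ (supp W ∩ R).card + 2 := by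
    have h5 : supp W \ R₁ ⊆ (supp W ∩ R).erase a ∪ (supp G \ (R ∪ R₁)) := by
      rw [hUW]
      intro q hq
      rw [mem_sdiff] at hq
      by_cases hqR : q ∈ R
      · refine mem_union_left _ (mem_erase.2 ⟨?_, mem_inter.2 ⟨hq.1, hqR⟩⟩)
        rintro rfl
        have : q ∈ R₁ ∩ R := by simp [ha]
        exact hq.2 (mem_inter.1 this).1
      · exact mem_union_right _ (mem_sdiff.2 ⟨hq.1, fun hc => (mem_union.1 hc).elim hqR hq.2⟩)
    have h6 := (card_le_card h5).trans (card_union_le _ _)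
    rw [card_erase_of_mem haX] at h6
    have := card_pos.2 ⟨a, haX⟩
    omega
  -- a critical graph on five vertices would have a monochromatic set and at least seven vertices
  have h4' : (supp W₁).card = 4 := by
    rcases (h.nm.bound W₁ hs.crit hlt₁).2 hP₁ with h4 | ⟨R₂, hR₂⟩
    · exact h4
    · obtain ⟨ρ₂, W₂, x₂, hs₂⟩ := hR₂.exists_split hs.crit (h.nm.bound.mono hlt₁.le) hP₁
      have h5 := hs₂.crit.four_le_card
      have h6 := hs₂.card_eq
      have h7 := hR₂.four_le
      have h8 := card_sdiff_of_subset hR₂.sub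
      omega
  have hab : a ≠ b := by
    rintro rfl
    have : a ∈ R₁ ∩ R := by simp [ha]
    exact hbR₁ (mem_inter.1 this).1
  rcases hk with hk | hk
  · refine h.false_of_two hR₁ hs hab ?_ ?_ ha h4'
    · symm
      apply eq_of_subset_of_card_le
      · simp only [insert_subset_iff, singleton_subset_iff]
        exact ⟨haX, hbX⟩
      · rw [hk, card_pair hab]
    · rcases h.cases with h | h <;> omega
  · have hXe : ((supp W ∩ R).erase a).card = 2 := by rw [card_erase_of_mem haX, hk]
    have hXo : ∀ q ∈ (supp W ∩ R).erase a, q ∈ supp W ∧ q ∈ R ∧ q ∉ R₁ := by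
      intro q hq
      obtain ⟨hqa, hq⟩ := mem_erase.1 hq
      obtain ⟨hqW, hqR⟩ := mem_inter.1 hq
      refine ⟨hqW, hqR, fun hqR₁ => hqa ?_⟩
      rw [← mem_singleton, ← ha]
      exact mem_inter.2 ⟨hqR₁, hqR⟩
    -- the remaining vertex `f` of `W - R₁` has two neighbours in the contracted triangle
    obtain ⟨f, hf, hfX⟩ := exists_mem_notMem_of_card_lt_card
      (show ((supp W ∩ R).erase a).card < (supp W \ R₁).card by omega)
    obtain ⟨hfW, hfR₁⟩ := mem_sdiff.1 hf
    have hfR : f ∉ R := by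
      intro hfR
      refine hfX (mem_erase.2 ⟨?_, mem_inter.2 ⟨hfW, hfR⟩⟩)
      rintro rfl
      have : f ∈ R₁ ∩ R := by simp [ha]
      exact hfR₁ (mem_inter.1 this).1
    obtain ⟨p, hp, q, hq, hpq⟩ := one_lt_card.1 (show 1 < ((supp W ∩ R).erase a).card by omega)
    have hK := (potG_of_card_four hs.crit h4').2
    have hadj : ∀ t ∈ (supp W ∩ R).erase a, W.Adj f t := by
      intro t ht
      obtain ⟨h1, h5, h6⟩ := hXo t ht
      exact (hs.out f t hfR₁ h6).1 (hK f ((hs.mem_iff hfR₁).2 hfW) t ((hs.mem_iff h6).2 h1)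
        (fun e => hfR (e ▸ h5)))
    exact hpq (h.unique hfR (hXo p hp).2.1 (hXo q hq).2.1 (hadj p hp) (hadj q hq))

end BadContr

/-- Sets of potential at most `6` miss at most two vertices. -/
lemma NM.card_sdiff_le_two (h : NM G) (hR : R ⊆ supp G) (h4 : 4 ≤ R.card) (h6 : pot G R ≤ 6) :
    (supp G \ R).card ≤ 2 := by
  by_contra hcon
  obtain ⟨M, hM, hmax⟩ := exists_max_image ((supp G).powerset.filter fun S =>
    4 ≤ S.card ∧ pot G S ≤ 6 ∧ 3 ≤ (supp G \ S).card) card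
    ⟨R, by simp only [mem_filter, mem_powerset]; exact ⟨hR, h4, h6, by omega⟩⟩
  simp only [mem_filter, mem_powerset] at hM hmax
  obtain ⟨φ, ρ, W, hW⟩ := h.exists_badContr (R := M) ⟨hM.1, hM.2.1, hM.2.2.2, hM.2.2.1, by
    intro S hS hMS hp
    by_contra hc
    have h1 := card_lt_card hMS
    have := hmax S ⟨hS, by omega, hp, by omega⟩
    omega⟩
  exact hW.false

/-! ### Paths of vertices of degree three -/

/-- The potential of the complement of an edge between vertices of degree three. -/
lemma pot_sdiff_edge (hR : R ⊆ supp G) (hyz : G.Adj y z) (hy : (nb G y).card = 3)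
    (hz : (nb G z).card = 3) (hyR : y ∉ R) (hzR : z ∉ R) (hc : (supp G \ R).card ≤ 2) :
    potG G = pot G R - 5 := by
  have hs : supp G \ R = {y, z} := by
    symm
    apply eq_of_subset_of_card_le
    · simp only [insert_subset_iff, singleton_subset_iff, mem_sdiff]
      exact ⟨⟨mem_supp_left hyz, hyR⟩, mem_supp_right hyz, hzR⟩
    · rw [card_pair hyz.ne]; exact hc
  have hU : supp G = insert y (insert z R) := by
    rw [← sdiff_union_of_subset hR, hs, insert_union, ← insert_eq]
  have h1 : y ∉ insert z R := by simp [hyz.ne, hyR]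
  have c1 : ((insert z R).filter (G.Adj y)).card = 3 := by
    rw [filter_adj_eq_nb, hy]
    intro a ha
    have := nb_subset_supp ha
    rw [hU, mem_insert] at this
    exact this.resolve_left (mem_nb.1 ha).ne.symm
  have c2 : (R.filter (G.Adj z)).card = 2 := by
    have : R.filter (G.Adj z) = (nb G z).erase y := by
      ext a
      simp only [mem_filter, mem_erase, mem_nb]
      constructor
      · rintro ⟨ha, hza⟩
        exact ⟨fun e => hyR (e ▸ ha), hza⟩
      · rintro ⟨hay, hza⟩
        have := mem_supp_right hza
        rw [hU, mem_insert, mem_insert] at this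
        exact ⟨(this.resolve_left hay).resolve_left hza.ne.symm, hza⟩
    rw [this, card_erase_of_mem (mem_nb.2 hyz.symm), hz]
  have h2 := pot_insert (G := G) hzR
  have h3 := pot_insert (G := G) h1
  rw [← hU] at h3
  rw [potG]
  omega

lemma Ident.subset (h : Ident G x y u v W) (hx : x ∈ supp G) (hv : v ∈ supp G) :
    insert x (insert v (supp W)) ⊆ supp G :=
  insert_subset hx (insert_subset hv h.sub)

lemma Ident.card_eq (h : Ident G x y u v W) (hxv : x ≠ v) :
    (insert x (insert v (supp W))).card = (supp W).card + 2 := by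
  have := h.x_notMem
  have := h.v_notMem
  rw [card_insert_of_notMem (by simp only [mem_insert, not_or]; exact ⟨hxv, ‹_›⟩),
    card_insert_of_notMem ‹_›]

lemma Ident.lt (h : Ident G x y u v W) (hx : x ∈ supp G) : (supp W).card < (supp G).card :=
  card_lt_card (Finset.ssubset_iff_subset_ne.2 ⟨h.sub, fun e => h.x_notMem (e ▸ hx)⟩)

/-- The configuration of a path `x`, `y`, `z` of vertices of degree three in which the other
neighbours `u`, `v` of `x` are not adjacent, together with an exact identification of them. -/
structure PathIdent (G : SimpleGraph V) (x y z s u v : V) (W : SimpleGraph V) : Prop where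
  nm : NM G
  ident : Ident G x y u v W
  nb_x : nb G x = {y, u, v}
  nb_y : nb G y = {x, z, s}
  card_y : (nb G y).card = 3
  card_z : (nb G z).card = 3
  ne_zx : z ≠ x
  not_xz : ¬ G.Adj x z
  not_sz : ¬ G.Adj s z
  z_notMem : z ∉ supp W
  ne_zv : z ≠ v
  potW : potG W = 2
  compl : ∀ a ∈ supp G, a ≠ x → a ≠ y → a ≠ z → a = v ∨ a ∈ supp W
  adj : ∀ a ∈ supp W, ∀ b ∈ supp W, G.Adj a b → W.Adj a b
  adj_v : ∀ a ∈ supp W, G.Adj v a → W.Adj u a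
  not_both : ∀ a ∈ supp W, ¬ (G.Adj u a ∧ G.Adj v a)

namespace PathIdent

lemma xy (h : PathIdent G x y z s u v W) : G.Adj x y := by rw [← mem_nb, h.nb_x]; simp
lemma yz (h : PathIdent G x y z s u v W) : G.Adj y z := by rw [← mem_nb, h.nb_y]; simp

lemma ne_of_mem (h : PathIdent G x y z s u v W) {t : V} (ht : t ∈ supp W) :
    t ≠ x ∧ t ≠ y ∧ t ≠ z ∧ t ≠ v :=
  ⟨fun e => h.ident.x_notMem (e ▸ ht), fun e => h.ident.y_notMem (e ▸ ht),
    fun e => h.z_notMem (e ▸ ht), fun e => h.ident.v_notMem (e ▸ ht)⟩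

lemma not_adj_x (h : PathIdent G x y z s u v W) {t : V} (ht : t ∈ supp W) (htu : t ≠ u) :
    ¬ G.Adj t x := by
  intro hc
  have : t ∈ nb G x := mem_nb.2 hc.symm
  rw [h.nb_x] at this
  simp only [mem_insert, mem_singleton] at this
  obtain ⟨-, h2, -, h4⟩ := h.ne_of_mem ht
  tauto

lemma eq_s (h : PathIdent G x y z s u v W) {t : V} (ht : t ∈ supp W) (hty : G.Adj t y) : t = s := by
  have : t ∈ nb G y := mem_nb.2 hty.symm
  rw [h.nb_y] at this
  simp only [mem_insert, mem_singleton] at this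
  obtain ⟨h1, -, h3, -⟩ := h.ne_of_mem ht
  tauto

/-- Degrees change only through edges to `y` and `z`. -/
lemma deg (h : PathIdent G x y z s u v W) {t : V} (ht : t ∈ supp W) (htu : t ≠ u) :
    ((nb G t).filter fun q => q ≠ y ∧ q ≠ z).card = (nb W t).card := by
  let f : V → V := fun a => if a = v then u else a
  have hfv : f v = u := if_pos rfl
  have hfn : ∀ a, a ≠ v → f a = a := fun a ha => if_neg ha
  have himg : nb W t = ((nb G t).filter fun q => q ≠ y ∧ q ≠ z).image f := by
    ext a
    rw [mem_nb, mem_image]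
    constructor
    · intro hta
      obtain ⟨-, h2, h3, h4⟩ := h.ne_of_mem (mem_supp_right hta)
      by_cases hau : a = u
      · subst hau
        rcases h.ident.cross t hta.symm with h5 | h5
        · exact ⟨a, mem_filter.2 ⟨mem_nb.2 h5.symm, h2, h3⟩, hfn a h4⟩
        · exact ⟨v, mem_filter.2 ⟨mem_nb.2 h5.symm, by
            rintro rfl
            have h6 := card_le_two (a := v) (b := a)
            have h7 := h.xy
            have h8 : nb G x = {v, a} := by rw [h.nb_x]; ext q; simp; tauto
            have h9 := h.nm.crit.three_le_deg (mem_supp_left h7)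
            rw [h8] at h9
            omega, h.ne_zv.symm⟩, hfv⟩
      · exact ⟨a, mem_filter.2 ⟨mem_nb.2 (h.ident.out t a htu hau hta), h2, h3⟩, hfn a h4⟩
    · rintro ⟨b, hb, rfl⟩
      obtain ⟨hb, hby, hbz⟩ := mem_filter.1 hb
      rw [mem_nb] at hb
      have hbx : b ≠ x := fun e => h.not_adj_x ht htu (e ▸ hb)
      rcases h.compl b (mem_supp_right hb) hbx hby hbz with rfl | hbW
      · rw [hfv]
        exact (h.adj_v t ht hb.symm).symm
      · rw [hfn b (h.ne_of_mem hbW).2.2.2]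
        exact h.adj t ht b hbW hb
  rw [himg, card_image_of_injOn]
  intro a ha b hb hab
  simp only [coe_filter, mem_nb, Set.mem_ofPred_eq] at ha hb
  by_cases hav : a = v <;> by_cases hbv : b = v
  · rw [hav, hbv]
  · rw [hav, hfv, hfn b hbv] at hab
    exact (h.not_both t ht ⟨hab ▸ hb.1.symm, hav ▸ ha.1.symm⟩).elim
  · rw [hbv, hfv, hfn a hav] at hab
    exact (h.not_both t ht ⟨hab ▸ ha.1.symm, hbv ▸ hb.1.symm⟩).elim
  · rwa [hfn a hav, hfn b hbv] at hab

/-- No edge `pq` has `p` adjacent to `y` and `q` adjacent to `z`: some colouring separates `p` from the third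
neighbour of `z`, and it extends to `z`, `x` and `y`. -/
lemma false_of_yz (h : PathIdent G x y z s u v W) {p q : V} (hp : p ∈ supp W) (hq : q ∈ supp W)
    (hpq : G.Adj p q) (hpy : G.Adj p y) (hqz : G.Adj q z) : False := by
  obtain rfl := h.eq_s hp hpy
  obtain ⟨t, hnz, hyt, hqt⟩ := exists_nb_eq' h.card_z h.yz.symm hqz.symm (h.ne_of_mem hq).2.1.symm
  have hzt : G.Adj z t := by rw [← mem_nb, hnz]; simp
  have htx : t ≠ x := by rintro rfl; exact h.not_xz hzt.symm
  have hpt : p ≠ t := by rintro rfl; exact h.not_sz hzt.symm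
  let A := (((supp G).erase y).erase x).erase z
  have hyS := mem_supp_right h.xy
  have hxS := mem_supp_left h.xy
  obtain ⟨c, hc, hne⟩ := h.nm.exists_separating (A := A)
    ((erase_subset _ _).trans ((erase_subset _ _).trans (erase_subset _ _))) hxS
    (by simp [A]) hyS (by simp [A]) h.xy.ne (a := p) (b := t)
    (by
      obtain ⟨h1, h2, h3, h4⟩ := h.ne_of_mem hp
      simp only [A, mem_erase]; exact ⟨h3, h1, h2, h.ident.sub hp⟩)
    (by simp only [A, mem_erase]; exact ⟨hzt.ne.symm, htx, hyt.symm, mem_supp_right hzt⟩) hpt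
  have hpA : p ∈ A := by
    obtain ⟨h1, h2, h3, h4⟩ := h.ne_of_mem hp
    simp only [A, mem_erase]; exact ⟨h3, h1, h2, h.ident.sub hp⟩
  have hqA : q ∈ A := by
    obtain ⟨h1, h2, h3, h4⟩ := h.ne_of_mem hq
    simp only [A, mem_erase]; exact ⟨h3, h1, h2, h.ident.sub hq⟩
  -- `z` can get the colour of `p`, and then `y` has neighbours of two colours only
  obtain ⟨c₁, h1, e1, e1'⟩ := hc.extend_color (v := z) (c p) (by
    intro a ha hza
    have : a ∈ nb G z := mem_nb.2 hza
    rw [hnz] at this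
    simp only [mem_insert, mem_singleton] at this
    rcases this with rfl | rfl | rfl
    · simp [A] at ha
    · exact (hc p hpA a ha hpq).symm
    · exact hne.symm) (by simp [A])
  rw [insert_erase (by simp only [mem_erase]; exact ⟨h.ne_zx, h.yz.ne.symm, mem_supp_right h.yz⟩)] at h1
  obtain ⟨c₂, h2, e2⟩ := h1.extend_erase (S := {u, v})
    (by simp only [mem_erase]; exact ⟨h.xy.ne, hxS⟩) card_le_two (by
    intro a ha _ hxa
    have : a ∈ nb G x := mem_nb.2 hxa
    rw [h.nb_x] at this
    simp only [mem_insert, mem_singleton] at this ⊢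
    rcases this with rfl | h | h
    · simp at ha
    · exact Or.inl h
    · exact Or.inr h)
  have e3 : c₂ p = c₂ z := by
    simp only [A, mem_erase] at hpA
    rw [e2 p (by simp only [mem_erase]; exact ⟨hpA.2.2.1, hpA.2.2.2⟩) hpA.2.1,
      e2 z (by simp only [mem_erase]; exact ⟨h.yz.ne.symm, mem_supp_right h.yz⟩) h.ne_zx, e1,
      e1' p (by simp only [A, mem_erase]; exact hpA)]
  obtain ⟨c₃, h3, -⟩ := h2.extend_of_image (v := y) (by
    refine (card_le_card (t := {c₂ x, c₂ z}) fun k hk => ?_).trans card_le_two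
    obtain ⟨a, ha, rfl⟩ := mem_image.1 hk
    have : a ∈ nb G y := mem_nb.2 (mem_filter.1 ha).2
    rw [h.nb_y] at this
    simp only [mem_insert, mem_singleton] at this ⊢
    rcases this with rfl | rfl | rfl
    · simp
    · simp
    · simp [e3]) (by simp)
  rw [insert_erase hyS] at h3
  exact h.nm.crit.not_pc_supp h3

/-- An emerald of `W` with at most one vertex adjacent to `y` or `z` is reducible. -/
lemma false_of_one (h : PathIdent G x y z s u v W) {p q t : V} (hE : Emerald W p q t) (hp : p ≠ u)
    (hq : q ≠ u) (ht : t ≠ u) (hqy : ¬ G.Adj q y) (hqz : ¬ G.Adj q z) (hty : ¬ G.Adj t y)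
    (htz : ¬ G.Adj t z) : False := by
  have hpW := mem_supp_left hE.de
  have hqW := mem_supp_left hE.ef
  have htW := mem_supp_right hE.ef
  have apq := h.ident.out _ _ hp hq hE.de
  have aqt := h.ident.out _ _ hq ht hE.ef
  have apt := h.ident.out _ _ hp ht hE.df
  have hdeg : ∀ r ∈ supp W, r ≠ u → ¬ G.Adj r y → ¬ G.Adj r z → (nb G r).card = (nb W r).card := by
    intro r hr hru hry hrz
    rw [← h.deg hr hru, filter_true_of_mem]
    intro a ha
    exact ⟨fun e => hry (e ▸ mem_nb.1 ha), fun e => hrz (e ▸ mem_nb.1 ha)⟩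
  have hq3 := (hdeg q hqW hq hqy hqz).trans hE.deg_e
  have ht3 := (hdeg t htW ht hty htz).trans hE.deg_f
  have key : ∀ a b, (y = a ∨ y = b) → (a = y ∨ a = z) → (b = y ∨ b = z) → G.Adj a b → G.Adj p a →
      ¬ G.Adj p b → (nb G a).card = 3 → (nb G b).card = 3 → False := by
    intro a b hyab haz hbz hab hpa hpb ha3 hb3
    have hp4 : (nb G p).card ≤ 4 := by
      have : nb G p ⊆ insert a ((nb G p).filter fun r => r ≠ y ∧ r ≠ z) := by
        intro r hr
        by_cases hra : r = a
        · simp [hra]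
        · have hrb : r ≠ b := fun e => hpb (e ▸ mem_nb.1 hr)
          have hab' := hab.ne
          refine mem_insert_of_mem (mem_filter.2 ⟨hr, ?_, ?_⟩) <;> rintro rfl
          · tauto
          · rcases haz with rfl | rfl <;> rcases hbz with rfl | rfl <;> tauto
      refine (card_le_card this).trans ((card_insert_le _ _).trans ?_)
      rw [h.deg hpW hp, hE.deg_d]
    obtain ⟨q', hnq, hpq', htq'⟩ := exists_nb_eq' hq3 apq.symm aqt apt.ne
    obtain ⟨t', hnt, hpt', hqt'⟩ := exists_nb_eq' ht3 apt.symm aqt.symm apq.ne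
    have hqq' : G.Adj q q' := by rw [← mem_nb, hnq]; simp
    have htt' : G.Adj t t' := by rw [← mem_nb, hnt]; simp
    have hnab : ∀ r, ¬ G.Adj r y → ¬ G.Adj r z → ¬ G.Adj r a ∧ ¬ G.Adj r b := by
      intro r h1 h2
      rcases haz with rfl | rfl <;> rcases hbz with rfl | rfl <;> exact ⟨by assumption, by assumption⟩
    have hne : ∀ r ∈ supp W, r ≠ a ∧ r ≠ b ∧ r ≠ x := by
      intro r hr
      obtain ⟨h1, h2, h3, h4⟩ := h.ne_of_mem hr
      rcases haz with rfl | rfl <;> rcases hbz with rfl | rfl <;> exact ⟨by assumption, by assumption, h1⟩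
    have hax : a ≠ x := by
      rcases haz with rfl | rfl
      exacts [h.xy.ne.symm, h.ne_zx]
    have hbx : b ≠ x := by
      rcases hbz with rfl | rfl
      exacts [h.xy.ne.symm, h.ne_zx]
    obtain ⟨hqa, hqb⟩ := hnab q hqy hqz
    obtain ⟨hta, htb⟩ := hnab t hty htz
    obtain ⟨np1, np2, np3⟩ := hne p hpW
    obtain ⟨nq1, nq2, nq3⟩ := hne q hqW
    obtain ⟨nt1, nt2, nt3⟩ := hne t htW
    -- the vertices `x`, `b`, `a`, `p` can be coloured in this order
    refine h.nm.false_of_extend hnq hnt hpq'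
      (A := ((((((supp G).erase q).erase t).erase p).erase a).erase b).erase x) ?_ ?_ ?_ ?_
    · exact (erase_subset _ _).trans ((erase_subset _ _).trans ((erase_subset _ _).trans
        (erase_subset _ _)))
    · simp only [mem_erase]
      refine ⟨?_, ?_, ?_, hpq'.symm, htq'.symm, hqq'.ne.symm, mem_supp_right hqq'⟩
      · rintro rfl; exact h.not_adj_x hqW hq hqq'
      · rintro rfl; exact hqb hqq'
      · rintro rfl; exact hqa hqq'
    · simp only [mem_erase]
      refine ⟨?_, ?_, ?_, hpt'.symm, htt'.ne.symm, hqt'.symm, mem_supp_right htt'⟩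
      · rintro rfl; exact h.not_adj_x htW ht htt'
      · rintro rfl; exact htb htt'
      · rintro rfl; exact hta htt'
    · intro c hc
      obtain ⟨c₁, h1, e1⟩ := hc.extend_erase (S := {u, v}) (by
        simp only [mem_erase]
        exact ⟨hbx.symm, hax.symm, np3.symm, nt3.symm, nq3.symm, mem_supp_left h.xy⟩) card_le_two (by
        intro r hr _ hxr
        have : r ∈ nb G x := mem_nb.2 hxr
        rw [h.nb_x] at this
        simp only [mem_insert, mem_singleton, mem_erase] at this hr ⊢
        rcases this with rfl | h | h
        · rcases hyab with e | e
          exacts [(hr.2.1 e).elim, (hr.1 e).elim]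
        · exact Or.inl h
        · exact Or.inr h)
      obtain ⟨c₂, h2, e2⟩ := h1.extend_erase (S := (nb G b).erase a) (by
        simp only [mem_erase]
        exact ⟨hab.ne.symm, np2.symm, nt2.symm, nq2.symm, mem_supp_right hab⟩) (by
        rw [card_erase_of_mem (mem_nb.2 hab.symm), hb3]) (by
        intro r hr _ hxr
        simp only [mem_erase] at hr
        exact mem_erase.2 ⟨hr.1, mem_nb.2 hxr⟩)
      obtain ⟨c₃, h3, e3⟩ := h2.extend_erase (S := (nb G a).erase p) (by
        simp only [mem_erase]
        exact ⟨np1.symm, nt1.symm, nq1.symm, mem_supp_left hab⟩) (by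
        rw [card_erase_of_mem (mem_nb.2 hpa.symm), ha3]) (by
        intro r hr _ hxr
        simp only [mem_erase] at hr
        exact mem_erase.2 ⟨hr.1, mem_nb.2 hxr⟩)
      obtain ⟨c₄, h4, e4⟩ := h3.extend_erase (S := ((nb G p).erase q).erase t) (by
        simp only [mem_erase]
        exact ⟨apt.ne, apq.ne, mem_supp_left apq⟩) (by
        rw [card_erase_of_mem (mem_erase.2 ⟨aqt.ne.symm, mem_nb.2 apt⟩),
          card_erase_of_mem (mem_nb.2 apq)]
        omega) (by
        intro r hr _ hpr
        simp only [mem_erase] at hr ⊢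
        exact ⟨hr.1, hr.2.1, mem_nb.2 hpr⟩)
      refine ⟨c₄, h4, fun r hr => ?_⟩
      simp only [mem_erase] at hr
      obtain ⟨t1, t2, t3, t4, t5, t6, t7⟩ := hr
      rw [e4 r (by simp only [mem_erase]; exact ⟨t5, t6, t7⟩) t4,
        e3 r (by simp only [mem_erase]; exact ⟨t4, t5, t6, t7⟩) t3,
        e2 r (by simp only [mem_erase]; exact ⟨t3, t4, t5, t6, t7⟩) t2,
        e1 r (by simp only [mem_erase]; exact ⟨t2, t3, t4, t5, t6, t7⟩) t1]
  by_cases hpy : G.Adj p y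
  · refine key y z (Or.inl rfl) (Or.inl rfl) (Or.inr rfl) h.yz hpy (fun hpz => ?_) h.card_y h.card_z
    exact h.not_sz (h.eq_s hpW hpy ▸ hpz)
  by_cases hpz : G.Adj p z
  · exact key z y (Or.inr rfl) (Or.inr rfl) (Or.inl rfl) h.yz.symm hpz hpy h.card_z h.card_y
  · exact h.nm.not_emerald ⟨apq, aqt, apt, (hdeg p hpW hp hpy hpz).trans hE.deg_d, hq3, ht3⟩

/-- The identified graph has a good configuration off `u`, which survives in `G` up to a few edges to `y`
and `z`. -/
lemma false (h : PathIdent G x y z s u v W) : False := by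
  have hlt := h.ident.lt (mem_supp_left h.xy)
  rcases h.ident.crit.good h.nm.bound hlt (by have := h.potW; omega) u with
    ⟨M, hM, hd⟩ | ⟨d, e, f, hE, hd, he, hf⟩
  · have huM : u ∉ M := by simpa using hd
    have hp : pot G M = pot W M := pot_congr fun a ha b hb =>
      ⟨h.adj a (hM.sub ha) b (hM.sub hb), h.ident.out a b (fun e => huM (e ▸ ha))
        (fun e => huM (e ▸ hb))⟩
    have h1 := h.nm.card_sdiff_le_one (hM.sub.trans h.ident.sub) hM.two_le (hp.trans_le hM.pot_le)
    refine h.xy.ne (card_le_one.1 h1 _ ?_ _ ?_)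
    · exact mem_sdiff.2 ⟨mem_supp_left h.xy, fun hc => h.ident.x_notMem (hM.sub hc)⟩
    · exact mem_sdiff.2 ⟨mem_supp_right h.xy, fun hc => h.ident.y_notMem (hM.sub hc)⟩
  · simp only [mem_singleton] at hd he hf
    have two : ∀ p q t, Emerald W p q t → p ≠ u → q ≠ u → t ≠ u → (G.Adj p y ∨ G.Adj p z) →
        (G.Adj q y ∨ G.Adj q z) → False := by
      intro p q t hE hp hq ht h1 h2
      have hpW := mem_supp_left hE.de
      have hqW := mem_supp_left hE.ef
      have apq := h.ident.out _ _ hp hq hE.de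
      rcases h1 with h1 | h1 <;> rcases h2 with h2 | h2
      · exact apq.ne ((h.eq_s hpW h1).trans (h.eq_s hqW h2).symm)
      · exact h.false_of_yz hpW hqW apq h1 h2
      · exact h.false_of_yz hqW hpW apq.symm h2 h1
      · have htW := mem_supp_right hE.ef
        exact h.nm.noDiamond z t p q (fun e => h.z_notMem (e ▸ htW)) apq h1.symm h2.symm
          (h.ident.out _ _ hp ht hE.df).symm (h.ident.out _ _ hq ht hE.ef).symm
    by_cases hd' : G.Adj d y ∨ G.Adj d z
    · have he' := not_or.1 fun h' => two d e f hE hd he hf hd' h'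
      have hf' := not_or.1 fun h' => two f d e hE.rot.rot hf hd he h' hd'
      exact h.false_of_one hE hd he hf he'.1 he'.2 hf'.1 hf'.2
    by_cases he' : G.Adj e y ∨ G.Adj e z
    · have hf' := not_or.1 fun h' => two e f d hE.rot he hf hd he' h'
      rw [not_or] at hd'
      exact h.false_of_one hE.rot he hf hd hf'.1 hf'.2 hd'.1 hd'.2
    · rw [not_or] at hd' he'
      exact h.false_of_one hE.rot.rot hf hd he hd'.1 hd'.2 he'.1 he'.2

end PathIdent

namespace NM

/-- The identified graph `W` has potential at most `2`, and `supp W` together with `v` and `x` misses `y` and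
`z`. This forces equality in all estimates, and so the identification is exact. -/
lemma false_of_path (h : NM G) (hx : nb G x = {y, u, v}) (hyu : y ≠ u) (hyv : y ≠ v) (huv : u ≠ v)
    (hn : ¬ G.Adj u v) (hy : nb G y = {x, z, s}) (hy3 : (nb G y).card = 3)
    (hz3 : (nb G z).card = 3) (hzx : z ≠ x) (hnsz : ¬ G.Adj s z) : False := by
  have hx3 : (nb G x).card = 3 := by rw [hx, card_eq_three]; exact ⟨y, u, v, hyu, hyv, huv, rfl⟩
  have hxy : G.Adj x y := by rw [← mem_nb, hx]; simp
  have hxv : G.Adj x v := by rw [← mem_nb, hx]; simp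
  have hyz : G.Adj y z := by rw [← mem_nb, hy]; simp
  have hnxz : ¬ G.Adj x z := fun hxz => h.not_emerald ⟨hxy, hyz, hxz, hx3, hy3, hz3⟩
  have hzu : z ≠ u := by rintro rfl; exact hnxz (by rw [← mem_nb, hx]; simp)
  have hzv : z ≠ v := by rintro rfl; exact hnxz hxv
  obtain ⟨W, hI⟩ := h.crit.exists_ident hxy hy3 hx huv hyu.symm hyv.symm hn
  have hzW := hI.deg_three z hz3 hzx hyz.symm hzu hzv
  have hsub := hI.subset (mem_supp_left hxy) (mem_supp_right hxv)
  have hlt := hI.lt (mem_supp_left hxy)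
  have hW2 := (h.bound W hI.crit hlt).1
  have hc := hI.card_eq hxv.ne
  have h4 := hI.crit.four_le_card
  have hpl := hI.pot_le
  have h2 := h.card_sdiff_le_two hsub (by omega) (by omega)
  have hyR : y ∉ insert x (insert v (supp W)) := by
    simp only [mem_insert, not_or]; exact ⟨hxy.ne.symm, hyv, hI.y_notMem⟩
  have hzR : z ∉ insert x (insert v (supp W)) := by
    simp only [mem_insert, not_or]; exact ⟨hzx, hzv, hzW⟩
  have hp := pot_sdiff_edge hsub hyz hy3 hz3 hyR hzR h2
  have hpos := h.pos
  obtain ⟨e1, e2, e3⟩ := hI.exact (by omega)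
  refine PathIdent.false (G := G) (x := x) (y := y) (z := z) (s := s) (u := u) (v := v) (W := W)
    ⟨h, hI, hx, hy, hy3, hz3, hzx, hnxz, hnsz, hzW, hzv, by omega, ?_, e1, e2, e3⟩
  intro a ha hax hay haz
  by_contra hcon
  push Not at hcon
  have h3 : ({a, y, z} : Finset V) ⊆ supp G \ insert x (insert v (supp W)) := by
    simp only [insert_subset_iff, singleton_subset_iff]
    refine ⟨mem_sdiff.2 ⟨ha, ?_⟩, mem_sdiff.2 ⟨mem_supp_left hyz, hyR⟩,
      mem_sdiff.2 ⟨mem_supp_right hyz, hzR⟩⟩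
    simp only [mem_insert, not_or]
    exact ⟨hax, hcon⟩
  have h5 := card_le_card h3
  rw [card_eq_three.2 ⟨a, y, z, hay, haz, hyz.ne, rfl⟩] at h5
  omega

lemma star (h : NM G) : Star G := by
  intro x y z u v hx hy hz hxy hyz hzx hxu hxv huv huy hvy
  by_contra hn
  rw [mem_V3] at hx hy hz
  obtain ⟨s, hny, -, -⟩ := exists_nb_eq' hy hxy.symm hyz hzx.symm
  have hys : G.Adj y s := by rw [← mem_nb, hny]; simp
  have hnx := nb_eq_of_card_three hx hxy hxu hxv huy.symm hvy.symm huv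
  by_cases hsz : G.Adj s z
  · obtain ⟨w, hnz, hyw, hsw⟩ := exists_nb_eq' hz hyz.symm hsz.symm hys.ne
    have hzw : G.Adj z w := by rw [← mem_nb, hnz]; simp
    have hnsw : ¬ G.Adj s w := fun hsw' =>
      h.noDiamond y w s z hyw hsz hys hyz hsw'.symm hzw.symm
    have hnsx : ¬ G.Adj s x := fun hsx =>
      h.noDiamond x z s y hzx.symm hys.symm hsx.symm hxy hsz.symm hyz.symm
    exact h.false_of_path (G := G) (x := z) (y := y) (z := x) (s := s) (u := s) (v := w) hnz hys.ne
      hyw hsw hnsw (by rw [hny]; ext q; simp; tauto) hy hx hzx.symm hnsx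
  · exact h.false_of_path hnx huy.symm hvy.symm huv hn hny hy hz hzx hsz

end NM

lemma not_NM : ¬ NM G := fun h => by
  have h1 := h.crit.potG_neg_of_star h.noDiamond h.star
  have h2 := h.pos
  omega

/-- Critical graphs have potential at most `2`, and those of positive potential other than the
complete graph on four vertices have a monochromatic set. -/
theorem bound (n : ℕ) : Bound V n := by
  induction n with
  | zero => intro W _ h; omega
  | succ n ih =>
    intro W hW hc
    have hB : Bound V (supp W).card := ih.mono (by omega)
    by_cases hP : 1 ≤ potG W
    · by_cases h4 : (supp W).card = 4
      · exact ⟨(potG_of_card_four hW h4).1.le, fun _ => Or.inl h4⟩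
      by_cases hM : ∃ M, Mono W M
      · obtain ⟨M, hM⟩ := hM
        obtain ⟨ρ, W₁, x, hs⟩ := hM.exists_split hW hB hP
        have h1 := (hB W₁ hs.crit hs.lt).1
        have h2 := hs.pot_add
        have h3 := hM.pot_le
        exact ⟨by omega, fun _ => Or.inr ⟨M, hM⟩⟩
      · push Not at hM
        exact (not_NM ⟨hW, hB, hP, h4, hM⟩).elim
    · exact ⟨by omega, fun h => (hP h).elim⟩

/-! ### Triangles and short cycles -/

/-- `G` has a triangle inside `S`. -/
def Tri (G : SimpleGraph V) (S : Finset V) : Prop :=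
  ∃ a ∈ S, ∃ b ∈ S, ∃ c ∈ S, G.Adj a b ∧ G.Adj b c ∧ G.Adj a c

/-- `G` has no triangle and no four-cycle inside `S`. -/
structure NoShort (G : SimpleGraph V) (S : Finset V) : Prop where
  tri : ¬ Tri G S
  four : ∀ a ∈ S, ∀ b ∈ S, ∀ c ∈ S, ∀ d ∈ S, a ≠ b → c ≠ d → G.Adj a c → G.Adj a d → G.Adj b c →
    G.Adj b d → False

lemma Tri.mono (h : Tri G S) (hS : S ⊆ T) : Tri G T := by
  obtain ⟨a, ha, b, hb, c, hc, h⟩ := h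
  exact ⟨a, hS ha, b, hS hb, c, hS hc, h⟩

lemma Tri.mono_graph (h : Tri G S) (hH : ∀ a ∈ S, ∀ b ∈ S, G.Adj a b → H.Adj a b) : Tri H S := by
  obtain ⟨a, ha, b, hb, c, hc, h1, h2, h3⟩ := h
  exact ⟨a, ha, b, hb, c, hc, hH a ha b hb h1, hH b hb c hc h2, hH a ha c hc h3⟩

lemma NoShort.mono (h : NoShort G T) (hS : S ⊆ T) : NoShort G S :=
  ⟨fun ht => h.tri (ht.mono hS), fun a ha b hb c hc d hd =>
    h.four a (hS ha) b (hS hb) c (hS hc) d (hS hd)⟩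

lemma NoShort.mono_graph (h : NoShort H S) (hH : ∀ a ∈ S, ∀ b ∈ S, G.Adj a b → H.Adj a b) :
    NoShort G S :=
  ⟨fun ht => h.tri (ht.mono_graph hH), fun a ha b hb c hc d hd hab hcd h1 h2 h3 h4 =>
    h.four a ha b hb c hc d hd hab hcd (hH a ha c hc h1) (hH a ha d hd h2) (hH b hb c hc h3)
      (hH b hb d hd h4)⟩

lemma Exact.tri {ρ : V → V} (h : Exact G R ρ W) (ht : Tri W (supp W \ R)) :
    Tri G (supp G \ R) := by
  have h1 : supp W \ R ⊆ supp G \ R := fun a ha => by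
    rw [mem_sdiff] at ha ⊢
    exact ⟨(h.mem_iff ha.2).1 ha.1, ha.2⟩
  exact (ht.mono_graph fun a ha b hb =>
    (h.out a b (mem_sdiff.1 ha).2 (mem_sdiff.1 hb).2).1).mono h1

lemma AddEdge.adj_of_ne {a b : V} (h : AddEdge G A a b W) (hx : x ≠ a) (hy : y ≠ a)
    (hxy : W.Adj x y) : G.Adj x y := by
  rcases h.lift x y hxy with h | h | h
  · exact h
  · exact (hx h.1).elim
  · exact (hy h.2).elim

lemma AddEdge.tri {a b : V} (h : AddEdge G A a b W) (ht : Tri W ((supp W).erase a)) :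
    Tri G ((supp W).erase a) :=
  ht.mono_graph fun _ hp _ hq => h.adj_of_ne (ne_of_mem_erase hp) (ne_of_mem_erase hq)

/-- A critical graph of positive potential has a triangle off any given vertex, and a monochromatic set
has triangles outside, and inside off any given boundary vertex. -/
lemma tri_of_pos : ∀ (m : ℕ) (G : SimpleGraph V), (supp G).card = m → Crit G → 1 ≤ potG G →
    (∀ v, Tri G ((supp G).erase v)) ∧ ∀ R, Mono G R → Tri G (supp G \ R) ∧
      ∀ a ∈ bd G R, Tri G (R.erase a) := by
  intro m
  induction m using Nat.strong_induction_on with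
  | _ m ih =>
  intro G hm hG hP
  have hM : ∀ R, Mono G R → Tri G (supp G \ R) ∧ ∀ a ∈ bd G R, Tri G (R.erase a) := by
    intro R hR
    constructor
    · obtain ⟨ρ, W, x, hs⟩ := hR.exists_split hG (bound _) hP
      have h1 := (ih _ (hm ▸ hs.lt) W rfl hs.crit (hs.one_le hR hP)).1 x
      refine hs.toExact.tri (h1.mono fun a ha => ?_)
      rw [mem_erase] at ha
      refine mem_sdiff.2 ⟨ha.2, fun haR => ha.1 ?_⟩
      rw [← mem_singleton, ← hs.inter]
      exact mem_inter.2 ⟨ha.2, haR⟩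
    · intro a ha
      obtain ⟨b, hb, hab⟩ : ∃ b ∈ bd G R, a ≠ b := by
        obtain ⟨p, hp, q, hq, hpq⟩ := hG.exists_bd hR.sub hR.ne hR.two_le
        by_cases hap : a = p
        · exact ⟨q, hq, hap ▸ hpq⟩
        · exact ⟨p, hp, hap⟩
      obtain ⟨W, hW, hPW, hlt⟩ := hR.exists_addEdge hG (bound _) hP ha hb hab
      exact (hW.tri ((ih _ (hm ▸ hlt) W rfl hW.crit hPW).1 a)).mono (erase_subset_erase _ hW.sub)
  refine ⟨fun v => ?_, hM⟩
  rcases (bound _ G hG (Nat.lt_succ_self _)).2 hP with h4 | ⟨R, hR⟩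
  · obtain ⟨t, ht, htc⟩ := exists_subset_card_eq (show 3 ≤ ((supp G).erase v).card by
      have := pred_card_le_card_erase (s := supp G) (a := v); omega)
    obtain ⟨a, b, c, hab, hac, hbc, rfl⟩ := card_eq_three.1 htc
    simp only [insert_subset_iff, singleton_subset_iff] at ht
    have hE := emerald_of_card_four hG h4 (mem_of_mem_erase ht.1) (mem_of_mem_erase ht.2.1)
      (mem_of_mem_erase ht.2.2) hab hbc hac
    exact ⟨a, ht.1, b, ht.2.1, c, ht.2.2, hE.de, hE.ef, hE.df⟩
  · by_cases hv : v ∈ R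
    · refine (hM R hR).1.mono fun a ha => ?_
      rw [mem_sdiff] at ha
      exact mem_erase.2 ⟨fun e => ha.2 (e ▸ hv), ha.1⟩
    · obtain ⟨p, hp, -⟩ := hG.exists_bd hR.sub hR.ne hR.two_le
      refine ((hM R hR).2 p hp).mono fun a ha => ?_
      have ha := mem_of_mem_erase ha
      exact mem_erase.2 ⟨fun e => hv (e ▸ ha), hR.sub ha⟩

lemma Crit.potG_le_two (hG : Crit G) : potG G ≤ 2 := (bound _ G hG (Nat.lt_succ_self _)).1

lemma Crit.exists_mono (hG : Crit G) (hP : 1 ≤ potG G) (h4 : (supp G).card ≠ 4) : ∃ R, Mono G R :=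
  ((bound _ G hG (Nat.lt_succ_self _)).2 hP).resolve_left h4

lemma Crit.tri_erase (hG : Crit G) (hP : 1 ≤ potG G) (v : V) : Tri G ((supp G).erase v) :=
  (tri_of_pos _ G rfl hG hP).1 v

lemma Mono.tri_compl (hR : Mono G R) (hG : Crit G) (hP : 1 ≤ potG G) : Tri G (supp G \ R) :=
  ((tri_of_pos _ G rfl hG hP).2 R hR).1

lemma Mono.tri_erase (hR : Mono G R) (hG : Crit G) (hP : 1 ≤ potG G) {a : V} (ha : a ∈ bd G R) :
    Tri G (R.erase a) :=
  ((tri_of_pos _ G rfl hG hP).2 R hR).2 a ha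

/-- A critical graph of positive potential with more than four vertices has a triangle off any
clique. -/
lemma Crit.tri_sdiff_clique (hG : Crit G) (hP : 1 ≤ potG G) (h4 : (supp G).card ≠ 4)
    (hX : ∀ a ∈ A, ∀ b ∈ A, a ≠ b → G.Adj a b) : Tri G (supp G \ A) := by
  obtain ⟨R, hR⟩ := hG.exists_mono hP h4
  obtain ⟨ρ, W, x, hs⟩ := hR.exists_split hG (bound _) hP
  by_cases hA : A ⊆ R
  · exact (hR.tri_compl hG hP).mono (sdiff_subset_sdiff Subset.rfl hA)
  obtain ⟨q, hq, hqR⟩ := not_subset.1 hA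
  by_cases hr : ∃ r ∈ A, r ∈ R
  · obtain ⟨r, hrA, hrR⟩ := hr
    have hqr : q ≠ r := fun e => hqR (e ▸ hrR)
    have hadj := hX q hq r hrA hqr
    refine (hR.tri_erase hG hP (mem_bd.2 ⟨hrR, q, hqR, hadj.symm⟩)).mono fun a ha => ?_
    obtain ⟨har, haR⟩ := mem_erase.1 ha
    refine mem_sdiff.2 ⟨hR.sub haR, fun haA => har ?_⟩
    exact hs.unique hqR haR hrR (hX q hq a haA (fun e => hqR (e ▸ haR))) hadj
  · push Not at hr
    obtain ⟨p, hp, -⟩ := hG.exists_bd hR.sub hR.ne hR.two_le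
    refine (hR.tri_erase hG hP hp).mono fun a ha => ?_
    have ha := mem_of_mem_erase ha
    exact mem_sdiff.2 ⟨hR.sub ha, fun haA => hr a haA ha⟩

/-- Deleting two edges from a critical graph of positive potential leaves a triangle or a
four-cycle. -/
lemma not_noShort_deleteEdges : ∀ (m : ℕ) (G : SimpleGraph V), (supp G).card = m → Crit G →
    1 ≤ potG G → ∀ e e', ¬ NoShort (G.deleteEdges {e, e'}) univ := by
  intro m
  induction m using Nat.strong_induction_on with
  | _ m ih =>
  intro G hm hG hP e e' hN
  have hadj : ∀ a b, G.Adj a b → s(a, b) ≠ e → s(a, b) ≠ e' → (G.deleteEdges {e, e'}).Adj a b := by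
    intro a b hab h1 h2
    rw [SimpleGraph.deleteEdges_adj]
    exact ⟨hab, by simp [h1, h2]⟩
  by_cases h4 : (supp G).card = 4
  · have hK := (potG_of_card_four hG h4).2
    have htri : ∀ v ∈ supp G, ∃ p ∈ (supp G).erase v, ∃ q ∈ (supp G).erase v, p ≠ q ∧
        (s(p, q) = e ∨ s(p, q) = e') := by
      intro v hv
      by_contra hcon
      push Not at hcon
      obtain ⟨a, b, c, hab, hac, hbc, ht⟩ := card_eq_three.1
        (show ((supp G).erase v).card = 3 by rw [card_erase_of_mem hv, h4])
      have hA : ∀ p ∈ (supp G).erase v, ∀ q ∈ (supp G).erase v, p ≠ q →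
          (G.deleteEdges {e, e'}).Adj p q := fun p hp q hq hpq =>
        hadj p q (hK p (mem_of_mem_erase hp) q (mem_of_mem_erase hq) hpq) (hcon p hp q hq hpq).1
          (hcon p hp q hq hpq).2
      exact hN.tri ⟨a, mem_univ _, b, mem_univ _, c, mem_univ _,
        hA a (by simp [ht]) b (by simp [ht]) hab, hA b (by simp [ht]) c (by simp [ht]) hbc,
        hA a (by simp [ht]) c (by simp [ht]) hac⟩
    -- if one deleted edge is `xy`, then the other one is the opposite edge
    have key : ∀ f f' : Sym2 V, (∀ p q : V, (s(p, q) = e ∨ s(p, q) = e') ↔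
        (s(p, q) = f ∨ s(p, q) = f')) → ∀ x ∈ supp G, ∀ y ∈ supp G, x ≠ y → s(x, y) = f → False := by
      intro f f' hf x hx y hy hxy hxyf
      obtain ⟨p, hp, q, hq, hpq, h1⟩ := htri x hx
      obtain ⟨p', hp', q', hq', hpq', h2⟩ := htri y hy
      rw [hf] at h1 h2
      rw [mem_erase] at hp hq hp' hq'
      have h1' : s(p, q) = f' := h1.resolve_left (fun h => by
        have : x ∈ s(p, q) := by rw [h, ← hxyf]; simp
        rcases Sym2.mem_iff.1 this with h | h
        exacts [hp.1 h.symm, hq.1 h.symm])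
      have h2' : s(p', q') = f' := h2.resolve_left (fun h => by
        have : y ∈ s(p', q') := by rw [h, ← hxyf]; simp
        rcases Sym2.mem_iff.1 this with h | h
        exacts [hp'.1 h.symm, hq'.1 h.symm])
      have hy' : y ∉ s(p, q) := by
        rw [h1', ← h2', Sym2.mem_iff]
        rintro (h | h)
        exacts [hp'.1 h.symm, hq'.1 h.symm]
      rw [Sym2.mem_iff, not_or] at hy'
      have hA : ∀ a b, a ∈ supp G → b ∈ supp G → (a = x ∨ a = y) → (b = p ∨ b = q) →
          (G.deleteEdges {e, e'}).Adj a b := by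
        intro a b ha hb hax hbp
        have hab : a ≠ b := by
          rcases hax with rfl | rfl <;> rcases hbp with rfl | rfl
          exacts [hp.1.symm, hq.1.symm, hy'.1, hy'.2]
        have h3 : ¬ (s(a, b) = e ∨ s(a, b) = e') := by
          rw [hf, ← hxyf, ← h1']
          rintro (h | h)
          · have : b ∈ s(x, y) := by rw [← h]; simp
            rcases Sym2.mem_iff.1 this with rfl | rfl <;> rcases hbp with h' | h'
            exacts [hp.1 h'.symm, hq.1 h'.symm, hy'.1 h', hy'.2 h']
          · have : a ∈ s(p, q) := by rw [← h]; simp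
            rcases Sym2.mem_iff.1 this with rfl | rfl <;> rcases hax with h' | h'
            exacts [hp.1 h', hy'.1 h'.symm, hq.1 h', hy'.2 h'.symm]
        rw [not_or] at h3
        exact hadj a b (hK a ha b hb hab) h3.1 h3.2
      exact hN.four x (mem_univ _) y (mem_univ _) p (mem_univ _) q (mem_univ _) hxy hpq
        (hA _ _ hx hp.2 (Or.inl rfl) (Or.inl rfl)) (hA _ _ hx hq.2 (Or.inl rfl) (Or.inr rfl))
        (hA _ _ hy hp.2 (Or.inr rfl) (Or.inl rfl)) (hA _ _ hy hq.2 (Or.inr rfl) (Or.inr rfl))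
    obtain ⟨v, hv⟩ := hG.supp_nonempty
    obtain ⟨p, hp, q, hq, hpq, h1⟩ := htri v hv
    rcases h1 with h1 | h1
    · exact key e e' (fun _ _ => Iff.rfl) p (mem_of_mem_erase hp) q (mem_of_mem_erase hq) hpq h1
    · exact key e' e (fun _ _ => or_comm) p (mem_of_mem_erase hp) q (mem_of_mem_erase hq) hpq h1
  obtain ⟨R, hR⟩ := hG.exists_mono hP h4
  by_cases hin : (∀ v ∈ e, v ∈ R) ∧ ∀ v ∈ e', v ∈ R
  · refine hN.tri (((hR.tri_compl hG hP).mono_graph fun a ha b hb hab => hadj a b hab ?_ ?_).mono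
      (subset_univ _))
    · rintro rfl; exact (mem_sdiff.1 ha).2 (hin.1 a (by simp))
    · rintro rfl; exact (mem_sdiff.1 ha).2 (hin.2 a (by simp))
  · obtain ⟨a, ha, b, hb, hab⟩ := hG.exists_bd hR.sub hR.ne hR.two_le
    obtain ⟨W, hW, hPW, hlt⟩ := hR.exists_addEdge hG (bound _) hP ha hb hab
    have key : ∀ f g, (∀ p q : V, s(p, q) ≠ f → s(p, q) ≠ g → s(p, q) ≠ e ∧ s(p, q) ≠ e') →
        (¬ ∀ v ∈ f, v ∈ R) → False := by
      intro f g hfg hf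
      refine ih _ (hm ▸ hlt) W rfl hW.crit hPW s(a, b) g (hN.mono_graph ?_)
      intro p _ q _ hpq
      rw [SimpleGraph.deleteEdges_adj] at hpq
      obtain ⟨hpq, hn⟩ := hpq
      simp only [Set.mem_insert_iff, Set.mem_singleton_iff, not_or] at hn
      have hf' : s(p, q) ≠ f := by
        rintro rfl
        refine hf fun v hv => hW.sub ?_
        rcases Sym2.mem_iff.1 hv with rfl | rfl
        exacts [mem_supp_left hpq, mem_supp_right hpq]
      refine hadj p q ?_ (hfg p q hf' hn.2).1 (hfg p q hf' hn.2).2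
      rcases hW.lift p q hpq with h | ⟨rfl, rfl⟩ | ⟨rfl, rfl⟩
      · exact h
      · exact (hn.1 rfl).elim
      · exact (hn.1 Sym2.eq_swap).elim
    rw [not_and_or] at hin
    rcases hin with h | h
    · exact key e e' (fun p q h1 h2 => ⟨h1, h2⟩) h
    · exact key e' e (fun p q h1 h2 => ⟨h2, h1⟩) h

/-- No diamond avoids `w`, no short cycle avoids `w` and `z`, and no diamond that avoids `z` has `w`
as an end of its middle edge. -/
structure NoClose (G : SimpleGraph V) (w z : V) : Prop where
  diamond : ∀ a b c d, a ≠ w → b ≠ w → c ≠ w → d ≠ w → a ≠ b → G.Adj c d → G.Adj a c → G.Adj a d →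
    G.Adj b c → G.Adj b d → False
  short : NoShort G ((univ.erase w).erase z)
  inner : ∀ a b d, w ≠ z → a ≠ z → b ≠ z → d ≠ z → a ≠ b → G.Adj w d → G.Adj a w → G.Adj a d →
    G.Adj b w → G.Adj b d → False

lemma NoShort.of_inter (h : NoShort W (S ∩ supp W)) : NoShort W S := by
  refine ⟨?_, ?_⟩
  · rintro ⟨a, ha, b, hb, c, hc, h1, h2, h3⟩
    exact h.tri ⟨a, mem_inter.2 ⟨ha, mem_supp_left h1⟩, b, mem_inter.2 ⟨hb, mem_supp_left h2⟩, c,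
      mem_inter.2 ⟨hc, mem_supp_right h2⟩, h1, h2, h3⟩
  · intro a ha b hb c hc d hd hab hcd h1 h2 h3 h4
    exact h.four a (mem_inter.2 ⟨ha, mem_supp_left h1⟩) b (mem_inter.2 ⟨hb, mem_supp_left h3⟩) c
      (mem_inter.2 ⟨hc, mem_supp_right h1⟩) d (mem_inter.2 ⟨hd, mem_supp_right h2⟩) hab hcd h1 h2 h3 h4

/-- The step from a monochromatic set `R` to the critical graph in `G[R] + ab`: if `G[R]` has no diamond and
no short cycle off `t`, then no diamond or short cycle of `W` is close to `a` and `t`. -/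
lemma AddEdge.false_of_noShort {a b t : V} (h : AddEdge G R a b W)
    (ih : (supp W).card ≠ 4 → ∀ w z, ¬ NoClose W w z)
    (hD : ∀ p q c d, p ∈ R → q ∈ R → c ∈ R → d ∈ R → p ≠ q → G.Adj c d → G.Adj p c →
        G.Adj p d → G.Adj q c → G.Adj q d → False) (hN : NoShort G (R.erase t)) : False := by
  have hl : ∀ p q, W.Adj p q → (p ≠ b ∨ q ≠ a) → (q ≠ b ∨ p ≠ a) → G.Adj p q := by
    intro p q hpq h1 h2
    rcases h.lift p q hpq with h | h | h <;> tauto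
  have hR : ∀ p q, W.Adj p q → p ∈ R ∧ q ∈ R := fun p q hpq =>
    ⟨h.sub (mem_supp_left hpq), h.sub (mem_supp_right hpq)⟩
  by_cases h4 : (supp W).card = 4
  · have hK := (potG_of_card_four h.crit h4).2
    have haW := mem_supp_left h.adj
    have hbW := mem_supp_right h.adj
    obtain ⟨p, q, hpq, he⟩ := card_eq_two.1 (show (((supp W).erase a).erase b).card = 2 by
      rw [card_erase_of_mem (mem_erase.2 ⟨h.adj.ne.symm, hbW⟩), card_erase_of_mem haW, h4])
    have hp : p ∈ ((supp W).erase a).erase b := by simp [he]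
    have hq : q ∈ ((supp W).erase a).erase b := by simp [he]
    simp only [mem_erase] at hp hq
    have k : ∀ c d, c ∈ supp W → d ∈ supp W → c ≠ d → d ≠ a → d ≠ b → G.Adj c d :=
      fun c d hc hd hcd hda hdb => hl c d (hK c hc d hd hcd) (Or.inr hda) (Or.inl hdb)
    exact hD a b p q (h.sub haW) (h.sub hbW) (h.sub hp.2.2) (h.sub hq.2.2) h.adj.ne
      (k _ _ hp.2.2 hq.2.2 hpq hq.2.1 hq.1) (k _ _ haW hp.2.2 hp.2.1.symm hp.2.1 hp.1)
      (k _ _ haW hq.2.2 hq.2.1.symm hq.2.1 hq.1) (k _ _ hbW hp.2.2 hp.1.symm hp.2.1 hp.1)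
      (k _ _ hbW hq.2.2 hq.1.symm hq.2.1 hq.1)
  refine ih h4 a t ⟨?_, ?_, ?_⟩
  · intro p q c d hp hq hc hd hpq h1 h2 h3 h4 h5
    have k : ∀ p q, p ≠ a → q ≠ a → W.Adj p q → G.Adj p q := fun p q h1 h2 h3 =>
      h.adj_of_ne h1 h2 h3
    exact hD p q c d (hR p c h2).1 (hR q c h4).1 (hR c d h1).1 (hR c d h1).2 hpq (k _ _ hc hd h1)
      (k _ _ hp hc h2) (k _ _ hp hd h3) (k _ _ hq hc h4) (k _ _ hq hd h5)
  · have hs : ((univ.erase a).erase t) ∩ supp W ⊆ (R.erase a).erase t := by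
      intro p hp
      simp only [mem_inter, mem_erase, mem_univ, and_true] at hp ⊢
      exact ⟨hp.1.1, hp.1.2, h.sub hp.2⟩
    refine NoShort.of_inter (((hN.mono (erase_subset_erase _ (erase_subset a R))).mono_graph ?_).mono hs)
    intro p hp q hq hpq
    simp only [mem_erase] at hp hq
    exact h.adj_of_ne hp.2.1 hq.2.1 hpq
  · intro p q d hat hpt hqt hdt hpq h1 h2 h3 h4 h5
    have m : ∀ c, c ∈ R → c ≠ t → c ∈ R.erase t := fun c h1 h2 => mem_erase.2 ⟨h2, h1⟩
    have hap := h2.ne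
    have haq := h4.ne
    have had := h1.ne
    by_cases hbd : b = d
    · subst hbd
      exact hN.four a (m _ (hR _ _ h1).1 hat) b (m _ (hR _ _ h1).2 hdt) p (m _ (hR _ _ h2).1 hpt) q
        (m _ (hR _ _ h4).1 hqt) had hpq (hl p a h2 (Or.inl h3.ne) (Or.inr hap)).symm
        (hl q a h4 (Or.inl h5.ne) (Or.inr haq)).symm (hl p b h3 (Or.inl h3.ne) (Or.inr hap)).symm
        (hl q b h5 (Or.inl h5.ne) (Or.inr haq)).symm
    by_cases hbp : b = p
    · subst hbp
      exact hN.tri ⟨q, m _ (hR _ _ h4).1 hqt, a, m _ (hR _ _ h1).1 hat, d, m _ (hR _ _ h1).2 hdt,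
        hl q a h4 (Or.inl hpq.symm) (Or.inr haq), hl a d h1 (Or.inr had.symm) (Or.inl (Ne.symm hbd)),
        hl q d h5 (Or.inl hpq.symm) (Or.inr haq)⟩
    by_cases hbq : b = q
    · subst hbq
      exact hN.tri ⟨p, m _ (hR _ _ h2).1 hpt, a, m _ (hR _ _ h1).1 hat, d, m _ (hR _ _ h1).2 hdt,
        hl p a h2 (Or.inl hpq) (Or.inr hap), hl a d h1 (Or.inr had.symm) (Or.inl (Ne.symm hbd)),
        hl p d h3 (Or.inl hpq) (Or.inr hap)⟩
    exact hD p q a d (hR _ _ h2).1 (hR _ _ h4).1 (hR _ _ h1).1 (hR _ _ h1).2 hpq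
      (hl a d h1 (Or.inr had.symm) (Or.inl (Ne.symm hbd))) (hl p a h2 (Or.inl (Ne.symm hbp)) (Or.inr hap))
      (hl p d h3 (Or.inl (Ne.symm hbp)) (Or.inr hap)) (hl q a h4 (Or.inl (Ne.symm hbq)) (Or.inr haq))
      (hl q d h5 (Or.inl (Ne.symm hbq)) (Or.inr haq))

/-- A critical graph of positive potential on more than four vertices has a diamond or a short cycle in any
of the positions excluded by `NoClose`. -/
lemma not_noClose : ∀ (m : ℕ) (G : SimpleGraph V), (supp G).card = m → Crit G → 1 ≤ potG G →
    m ≠ 4 → ∀ w z, ¬ NoClose G w z := by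
  intro m
  induction m using Nat.strong_induction_on with
  | _ m ih =>
  intro G hm hG hP h4 w z hN
  obtain ⟨R, hR⟩ := hG.exists_mono hP (hm ▸ h4)
  obtain ⟨a, ha, b, hb, hab⟩ := hG.exists_bd hR.sub hR.ne hR.two_le
  have hmem : ∀ t, t ∈ (univ.erase w).erase z ↔ t ≠ z ∧ t ≠ w := fun t => by simp
  by_cases hwR : w ∈ R <;> by_cases hzR : z ∈ R
  · refine hN.short.tri ((hR.tri_compl hG hP).mono fun t ht => (hmem t).2 ?_)
    exact ⟨fun e => (mem_sdiff.1 ht).2 (e ▸ hzR), fun e => (mem_sdiff.1 ht).2 (e ▸ hwR)⟩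
  rotate_left 2
  · refine hN.short.tri ((hR.tri_erase hG hP ha).mono fun t ht => (hmem t).2 ?_)
    have ht := mem_of_mem_erase ht
    exact ⟨fun e => hzR (e ▸ ht), fun e => hwR (e ▸ ht)⟩
  all_goals
    obtain ⟨W, hW, hPW, hlt⟩ := hR.exists_addEdge hG (bound _) hP ha hb hab
  · have hzn : ∀ t ∈ R, t ≠ z := fun t ht e => hzR (e ▸ ht)
    have hD : ∀ p q c d, p ∈ R → q ∈ R → c ∈ R → d ∈ R → p ≠ q → G.Adj c d → G.Adj p c →
        G.Adj p d → G.Adj q c → G.Adj q d → False := by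
      intro p q c d hp hq hc hd hpq h1 h2 h3 h4 h5
      have hz : z ≠ w := fun e => hzR (e ▸ hwR)
      by_cases hcw : c = w
      · subst hcw
        exact hN.inner p q d hz.symm (hzn p hp) (hzn q hq) (hzn d hd) hpq h1 h2 h3 h4 h5
      by_cases hdw : d = w
      · subst hdw
        exact hN.inner p q c hz.symm (hzn p hp) (hzn q hq) (hzn c hc) hpq h1.symm h3 h2 h5 h4
      by_cases hpw : p = w
      · have hqw : q ≠ w := fun e => hpq (hpw.trans e.symm)
        exact hN.short.tri ⟨q, (hmem _).2 ⟨hzn q hq, hqw⟩, c, (hmem _).2 ⟨hzn c hc, hcw⟩, d,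
          (hmem _).2 ⟨hzn d hd, hdw⟩, h4, h1, h5⟩
      by_cases hqw : q = w
      · exact hN.short.tri ⟨p, (hmem _).2 ⟨hzn p hp, hpw⟩, c, (hmem _).2 ⟨hzn c hc, hcw⟩, d,
          (hmem _).2 ⟨hzn d hd, hdw⟩, h2, h1, h3⟩
      exact hN.diamond p q c d hpw hqw hcw hdw hpq h1 h2 h3 h4 h5
    exact hW.false_of_noShort (fun hc => ih _ (hm ▸ hlt) W rfl hW.crit hPW hc) hD (hN.short.mono fun t ht => by
      rw [mem_erase] at ht; exact (hmem t).2 ⟨hzn t ht.2, ht.1⟩)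
  · have hwn : ∀ t ∈ R, t ≠ w := fun t ht e => hwR (e ▸ ht)
    have hD : ∀ p q c d, p ∈ R → q ∈ R → c ∈ R → d ∈ R → p ≠ q → G.Adj c d → G.Adj p c →
        G.Adj p d → G.Adj q c → G.Adj q d → False := fun p q c d hp hq hc hd =>
      hN.diamond p q c d (hwn p hp) (hwn q hq) (hwn c hc) (hwn d hd)
    exact hW.false_of_noShort (fun hc => ih _ (hm ▸ hlt) W rfl hW.crit hPW hc) hD (hN.short.mono fun t ht => by
      rw [mem_erase] at ht; exact (hmem t).2 ⟨ht.1, hwn t ht.2⟩)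

/-- The number of edges of a graph without short cycles, from the number of paths of length two. -/
lemma NoShort.card_le (h : NoShort G S) : 4 * eIn G S ^ 2 ≤ S.card ^ 2 * (S.card - 1) := by
  set d : V → ℕ := fun v => (S.filter (G.Adj v)).card with hd
  -- the neighbours of the neighbours of `v`, and the neighbours themselves, are all distinct
  have h1 : ∀ v ∈ S, ∑ u ∈ S.filter (G.Adj v), d u ≤ S.card - 1 := by
    intro v hv
    set N := S.filter (G.Adj v) with hN
    have hNm : ∀ u ∈ N, u ∈ S ∧ G.Adj v u := fun u hu => mem_filter.1 hu
    have e1 : ∀ u ∈ N, d u = ((S.filter (G.Adj u)).erase v).card + 1 := by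
      intro u hu
      rw [card_erase_add_one]
      exact mem_filter.2 ⟨hv, (hNm u hu).2.symm⟩
    have hdis : ∀ u ∈ N, ∀ u' ∈ N, u ≠ u' → Disjoint ((S.filter (G.Adj u)).erase v)
        ((S.filter (G.Adj u')).erase v) := by
      intro u hu u' hu' hne
      rw [disjoint_left]
      intro t ht ht'
      simp only [mem_erase, mem_filter] at ht ht'
      exact h.four v hv t ht.2.1 u (hNm u hu).1 u' (hNm u' hu').1 ht.1.symm hne (hNm u hu).2
        (hNm u' hu').2 ht.2.2.symm ht'.2.2.symm
    have hdis2 : Disjoint (N.biUnion fun u => (S.filter (G.Adj u)).erase v) N := by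
      rw [disjoint_left]
      intro t ht htN
      obtain ⟨u, hu, ht⟩ := mem_biUnion.1 ht
      simp only [mem_erase, mem_filter] at ht
      exact h.tri ⟨v, hv, u, (hNm u hu).1, t, ht.2.1, (hNm u hu).2, ht.2.2, (hNm t htN).2⟩
    have hsub : (N.biUnion fun u => (S.filter (G.Adj u)).erase v) ∪ N ⊆ S.erase v := by
      refine union_subset (biUnion_subset.2 fun u hu => erase_subset_erase _ (filter_subset _ _)) ?_
      intro u hu
      exact mem_erase.2 ⟨(hNm u hu).2.ne.symm, (hNm u hu).1⟩
    have hc := card_le_card hsub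
    rw [card_union_of_disjoint hdis2, card_biUnion hdis, card_erase_of_mem hv] at hc
    rw [sum_congr rfl e1, sum_add_distrib]
    simpa using hc
  have h2 : ∑ u ∈ S, d u ^ 2 ≤ S.card * (S.card - 1) := by
    have e1 : ∑ v ∈ S, ∑ u ∈ S.filter (G.Adj v), d u = ∑ u ∈ S, d u ^ 2 := by
      rw [sum_comm' (t' := S) (s' := fun u => S.filter (G.Adj u))]
      · refine sum_congr rfl fun u _ => ?_
        rw [sum_const, smul_eq_mul, sq]
      · intro p q
        simp only [mem_filter, G.adj_comm]
        tauto
    rw [← e1]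
    refine (sum_le_sum h1).trans ?_
    rw [sum_const, smul_eq_mul]
  have h3 := sq_sum_le_card_mul_sum_sq (s := S) (f := d)
  have h4 : ∑ v ∈ S, d v = 2 * eIn G S := sum_deg_in
  rw [h4] at h3
  calc 4 * eIn G S ^ 2 = (2 * eIn G S) ^ 2 := by ring
    _ ≤ S.card * ∑ u ∈ S, d u ^ 2 := h3
    _ ≤ S.card * (S.card * (S.card - 1)) := Nat.mul_le_mul_left _ h2
    _ = S.card ^ 2 * (S.card - 1) := by ring

/-! ### Critical graphs of potential zero -/

lemma AddEdge.symm {a b : V} (h : AddEdge G A a b W) : AddEdge G A b a W :=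
  ⟨h.crit, fun e => h.not_adj e.symm, h.adj.symm, h.sub, fun x y hxy => by
    have := h.lift x y hxy; tauto, h.pot_le, h.exact⟩

/-- The conclusion of `Crit.exists_contr` if all larger proper sets have larger potential. -/
lemma Crit.exists_contr_union (hG : Crit G) (hR : R ⊆ supp G) (hne : R ≠ supp G) (h2 : 2 ≤ R.card)
    (h5 : pot G R ≤ 5) (hT : ∀ T ⊆ supp G, T ≠ supp G → 2 ≤ T.card → pot G R - 3 < pot G T)
    {φ : V → Fin 3} (hφ : PC G R φ) : ∃ ρ W l, Contr G R φ ρ W l ∧ R ∪ supp W = supp G ∧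
      potG G + pot W (supp W ∩ R) + 3 * l = pot G R + potG W := by
  obtain ⟨ρ, W, l, h⟩ := hG.exists_contr hR hne (four_le_card_of_pot_le h2 h5) hφ
  have h1 := h.pot_eq
  have h3 := h.crit.potG_le_two
  have h4 : 5 ≤ pot W (supp W ∩ R) := by
    rcases pot_card_le_three (W := W) h.ne h.card_le with h | h | h | h <;> omega
  have hU : R ∪ supp W = supp G := by
    by_contra hU
    have := hT _ (union_subset hR h.sub) hU (h2.trans (card_le_card subset_union_left))
    omega
  refine ⟨ρ, W, l, h, hU, ?_⟩
  rw [hU] at h1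
  exact h1

/-- A proper set of small potential may be taken of minimal potential, and contracted. -/
lemma Crit.exists_min_contr (hG : Crit G) (hR : R ⊆ supp G) (hne : R ≠ supp G) (h2 : 2 ≤ R.card)
    (h5 : pot G R ≤ 5) : ∃ R' φ ρ W l, R' ⊆ supp G ∧ pot G R' ≤ pot G R ∧
      Contr G R' φ ρ W l ∧ R' ∪ supp W = supp G ∧
      potG G + pot W (supp W ∩ R') + 3 * l = pot G R' + potG W := by
  obtain ⟨M, hM, hmin⟩ := exists_min_image
    ((supp G).powerset.filter fun S => S ≠ supp G ∧ 2 ≤ S.card) (pot G) ⟨R, by simp [hR, hne, h2]⟩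
  have hMR := hmin R (by simp [hR, hne, h2])
  simp only [mem_filter, mem_powerset] at hM hmin
  obtain ⟨hMs, hMne, hM2⟩ := hM
  obtain ⟨v, hv, hvM⟩ := exists_mem_notMem hMs hMne
  obtain ⟨φ, hφ⟩ := hG.exists_pc hv hvM
  obtain ⟨ρ, W, l, h⟩ := hG.exists_contr_union hMs hMne hM2 (by omega)
    (fun T h1 h2 h3 => by have := hmin T ⟨h1, h2, h3⟩; omega) hφ
  exact ⟨M, φ, ρ, W, l, hMs, hMR, h⟩

lemma Exact.tri_of_one {ρ : V → V} (h : Exact G R ρ W) (h1 : (supp W ∩ R).card = 1)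
    (hP : 1 ≤ potG W) : Tri G (supp G \ R) := by
  obtain ⟨x, hx⟩ := card_eq_one.1 h1
  refine h.tri ((h.crit.tri_erase hP x).mono fun a ha => ?_)
  obtain ⟨hax, ha⟩ := mem_erase.1 ha
  refine mem_sdiff.2 ⟨ha, fun haR => hax ?_⟩
  rw [← mem_singleton, ← hx]
  exact mem_inter.2 ⟨ha, haR⟩

lemma Exact.tri_of_clique {ρ : V → V} (h : Exact G R ρ W) (hP : 1 ≤ potG W)
    (h4 : (supp W).card ≠ 4) (hX : ∀ a ∈ supp W ∩ R, ∀ b ∈ supp W ∩ R, a ≠ b → W.Adj a b) :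
    Tri G (supp G \ R) := by
  refine h.tri ?_
  have := h.crit.tri_sdiff_clique hP h4 hX
  rwa [sdiff_inter_self_left] at this

lemma Exact.card_eq {ρ : V → V} (h : Exact G R ρ W) :
    (supp W).card = (supp G \ R).card + (supp W ∩ R).card := by
  have : supp G \ R = supp W \ R := by
    ext q; simp only [mem_sdiff]
    exact ⟨fun hq => ⟨(h.mem_iff hq.2).2 hq.1, hq.2⟩, fun hq => ⟨(h.mem_iff hq.2).1 hq.1, hq.2⟩⟩
  rw [this, card_sdiff_add_card_inter]

/-- Contracting to a single vertex leaves a graph without short cycles off that vertex. -/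
lemma Exact.noShort {ρ : V → V} (h : Exact G R ρ W) (h1 : supp W ∩ R = {x})
    (hN : NoShort G (supp G \ R)) : NoShort W (univ.erase x) := by
  have hs : univ.erase x ∩ supp W ⊆ supp G \ R := by
    intro a ha
    obtain ⟨hax, haW⟩ := mem_inter.1 ha
    have haR : a ∉ R := fun haR => ne_of_mem_erase hax (by
      rw [← mem_singleton, ← h1]; exact mem_inter.2 ⟨haW, haR⟩)
    exact mem_sdiff.2 ⟨(h.mem_iff haR).1 haW, haR⟩
  exact NoShort.of_inter ((hN.mono_graph fun a ha b hb =>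
    (h.out a b (mem_sdiff.1 ha).2 (mem_sdiff.1 hb).2).1).mono hs)

lemma AddEdge.noShort {a b : V} (h : AddEdge G A a b W) (hN : NoShort G A) :
    NoShort W (univ.erase a) := by
  refine NoShort.of_inter (S := univ.erase a) (((hN.mono (erase_subset a A)).mono_graph
    fun p hp q hq => h.adj_of_ne (ne_of_mem_erase hp) (ne_of_mem_erase hq)).mono ?_)
  intro p hp
  obtain ⟨hpa, hpW⟩ := mem_inter.1 hp
  exact mem_erase.2 ⟨ne_of_mem_erase hpa, h.sub hpW⟩

/-- The critical graph in `G[A] + ab` has negative potential, if `G[A]` has no short cycles. -/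
lemma AddEdge.pot_neg {a b : V} (h : AddEdge G A a b W) (hN : NoShort G A)
    (h6 : potG W = 0 → ∀ z, NoShort W (univ.erase z) → (supp W).card = 6) : potG W < 0 := by
  by_contra hP
  by_cases hP1 : 1 ≤ potG W
  · exact hN.tri ((h.tri (h.crit.tri_erase hP1 a)).mono ((erase_subset _ _).trans h.sub))
  · have hP0 : potG W = 0 := by omega
    have hc := h6 hP0 a (h.noShort hN)
    have h1 := h.pot_le
    have h2 := (hN.mono h.sub).card_le
    rw [hP0, pot, hc] at h1
    rw [hc] at h2
    have h3 : 9 ≤ eIn G (supp W) := by push_cast at h1; omega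
    have h4 : 9 ^ 2 ≤ eIn G (supp W) ^ 2 := Nat.pow_le_pow_left h3 2
    norm_num at h2 h4
    omega

/-- A minimal counterexample to the claim that critical graphs of potential `0` without short
cycles off a vertex `z` have six vertices. -/
structure ZeroPot (G : SimpleGraph V) (z : V) : Prop where
  crit : Crit G
  potG_eq : potG G = 0
  short : NoShort G (univ.erase z)
  ih : ∀ (W : SimpleGraph V) z', Crit W → (supp W).card < (supp G).card → potG W = 0 →
    NoShort W (univ.erase z') → (supp W).card = 6
  ne : (supp G).card ≠ 6

namespace ZeroPot

lemma noShort (h : ZeroPot G z) (hz : z ∉ S) : NoShort G S :=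
  h.short.mono fun _ ha => mem_erase.2 ⟨fun e => hz (e ▸ ha), mem_univ _⟩

lemma five_le (h : ZeroPot G z) : 5 ≤ (supp G).card := by
  have := h.crit.four_le_card
  have h1 := fun h4 => (potG_of_card_four h.crit h4).1
  have := h.potG_eq
  by_contra hlt
  have := h1 (by omega)
  omega

lemma three_le_pot (h : ZeroPot G z) (hR : R ⊆ supp G) (hne : R ≠ supp G) (h2 : 2 ≤ R.card) :
    3 ≤ pot G R := by
  by_contra hlt
  obtain ⟨R', φ, ρ, W, l, -, hp, hC, -, he⟩ := h.crit.exists_min_contr hR hne h2 (by omega)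
  have h1 := hC.crit.potG_le_two
  have h0 := h.potG_eq
  rcases pot_card_le_three (W := W) hC.ne hC.card_le with h | h | h | h <;> omega

lemma exists_contr (h : ZeroPot G z) (hR : R ⊆ supp G) (hne : R ≠ supp G) (h2 : 2 ≤ R.card)
    (h5 : pot G R ≤ 5) {φ : V → Fin 3} (hφ : PC G R φ) :
    ∃ ρ W l, Contr G R φ ρ W l ∧ R ∪ supp W = supp G ∧
      pot W (supp W ∩ R) + 3 * l = pot G R + potG W := by
  obtain ⟨ρ, W, l, h1, h3, h4⟩ := h.crit.exists_contr_union hR hne h2 h5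
    (fun T h1 h3 h4 => by have := h.three_le_pot h1 h3 h4; omega) hφ
  have := h.potG_eq
  exact ⟨ρ, W, l, h1, h3, by omega⟩

lemma not_tri (h : ZeroPot G z) (hz : z ∈ R) : ¬ Tri G (supp G \ R) :=
  (h.noShort (S := supp G \ R) fun hc => (mem_sdiff.1 hc).2 hz).tri

/-- A proper set all whose colourings are constant on the boundary contains a critical graph plus an
edge of large potential, and hence `z`. -/
lemma exists_addEdge (h : ZeroPot G z) (hR : R ⊆ supp G) (hne : R ≠ supp G) (h2 : 2 ≤ R.card)
    (hc : ∀ c, PC G R c → ∀ a ∈ bd G R, ∀ b ∈ bd G R, c a = c b) :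
    z ∈ R ∧ ∃ a b W, AddEdge G R a b W ∧ supp W ≠ supp G ∧ (supp W).card < (supp G).card := by
  obtain ⟨v, hv, hvR⟩ := exists_mem_notMem hR hne
  obtain ⟨a, ha, b, hb, hab⟩ := h.crit.exists_bd hR hne h2
  obtain ⟨W, hW⟩ := h.crit.exists_addEdge hv hvR (mem_bd.1 ha).1 (mem_bd.1 hb).1 hab
    (fun c hc' => hc c hc' a ha b hb)
  have hne' : supp W ≠ supp G := fun e => hvR (hW.sub (e ▸ hv))
  have hlt : (supp W).card < (supp G).card :=
    card_lt_card (Finset.ssubset_iff_subset_ne.2 ⟨hW.sub.trans hR, hne'⟩)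
  refine ⟨?_, a, b, W, hW, hne', hlt⟩
  by_contra hz
  have h1 := hW.pot_neg (h.noShort hz) fun hP z' hN => h.ih W z' hW.crit hlt hP hN
  have h3 := h.three_le_pot (hW.sub.trans hR) hne' (by have := hW.crit.four_le_card; omega)
  have h4 := hW.pot_le
  omega

/-- A set of potential `3` contracts to a single vertex for each of its colourings. So it contains `z`, and
there is a triangle outside. -/
lemma four_le_pot (h : ZeroPot G z) (hR : R ⊆ supp G) (hne : R ≠ supp G) (h2 : 2 ≤ R.card) :
    4 ≤ pot G R := by
  by_contra hlt
  have h3 := h.three_le_pot hR hne h2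
  have key : ∀ φ, PC G R φ → Tri G (supp G \ R) ∧ ∀ a ∈ bd G R, ∀ b ∈ bd G R, φ a = φ b := by
    intro φ hφ
    obtain ⟨ρ, W, l, hC, hU, he⟩ := h.exists_contr hR hne h2 (by omega) hφ
    have h1 := hC.crit.potG_le_two
    rcases pot_card_le_three (W := W) hC.ne hC.card_le with h4 | h4 | h4 | h4
    · obtain rfl : l = 0 := by omega
      exact ⟨(hC.toExact hU).tri_of_one h4.1 (by omega), hC.const_of_card_one hU h4.1⟩
    all_goals omega
  obtain ⟨v, hv, hvR⟩ := exists_mem_notMem hR hne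
  obtain ⟨φ, hφ⟩ := h.crit.exists_pc hv hvR
  obtain ⟨hz, -⟩ := h.exists_addEdge hR hne h2 fun c hc => (key c hc).2
  exact h.not_tri hz (key φ hφ).1

/-- The complement of an emerald has potential `3`. -/
lemma not_emerald (h : ZeroPot G z) {d e f : V} : ¬ Emerald G d e f := by
  intro hE
  have hp := hE.pot_sdiff
  have hc : ({d, e, f} : Finset V).card = 3 :=
    card_eq_three.2 ⟨d, e, f, hE.de.ne, hE.df.ne, hE.ef.ne, rfl⟩
  have hs : {d, e, f} ⊆ supp G := by
    simp only [insert_subset_iff, singleton_subset_iff]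
    exact ⟨mem_supp_left hE.de, mem_supp_left hE.ef, mem_supp_right hE.ef⟩
  have hc2 := card_sdiff_of_subset hs
  have h5 := h.five_le
  have := h.four_le_pot (R := supp G \ {d, e, f}) sdiff_subset
    (fun he => by rw [he] at hc2; omega) (by omega)
  have := h.potG_eq
  omega

lemma card_sdiff_le_one_of_mem (h : ZeroPot G z) (hz : z ∈ R) (hR : R ⊆ supp G) (h2 : 2 ≤ R.card)
    (h4 : pot G R ≤ 4) : (supp G \ R).card ≤ 1 := by
  by_cases hne : R = supp G
  · simp [hne]
  have h4' := h.four_le_pot hR hne h2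
  obtain ⟨v, hv, hvR⟩ := exists_mem_notMem hR hne
  obtain ⟨φ, hφ⟩ := h.crit.exists_pc hv hvR
  obtain ⟨ρ, W, l, hC, hU, he⟩ := h.exists_contr hR hne h2 (by omega) hφ
  have h1 := hC.crit.potG_le_two
  have hn := h.not_tri hz
  rcases pot_card_le_three (W := W) hC.ne hC.card_le with h5 | h5 | h5 | h5
  · obtain rfl : l = 0 := by omega
    exact (hn ((hC.toExact hU).tri_of_one h5.1 (by omega))).elim
  · obtain rfl : l = 0 := by omega
    by_cases h6 : (supp W).card = 4
    · have := (hC.toExact hU).card_eq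
      omega
    · exact (hn ((hC.toExact hU).tri_of_clique (by omega) h6 h5.2.2)).elim
  all_goals omega

/-- Each contraction has potential `0` and a single vertex in place of `R`, and so six vertices by
induction. -/
lemma card_sdiff_eq_five (h : ZeroPot G z) (hz : z ∈ R) (hR : R ⊆ supp G) (h2 : 2 ≤ R.card)
    (h5 : pot G R ≤ 5) (h3 : 3 ≤ (supp G \ R).card) :
    (supp G \ R).card = 5 ∧ ∀ c, PC G R c → ∀ a ∈ bd G R, ∀ b ∈ bd G R, c a = c b := by
  have hne : R ≠ supp G := by rintro rfl; simp at h3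
  have h5' : pot G R = 5 := by
    by_contra hc
    have := h.card_sdiff_le_one_of_mem hz hR h2 (by omega)
    omega
  have hn := h.not_tri hz
  have key : ∀ φ, PC G R φ → (supp G \ R).card = 5 ∧ ∀ a ∈ bd G R, ∀ b ∈ bd G R, φ a = φ b := by
    intro φ hφ
    obtain ⟨ρ, W, l, hC, hU, he⟩ := h.exists_contr hR hne h2 (by omega) hφ
    have h1 := hC.crit.potG_le_two
    rcases pot_card_le_three (W := W) hC.ne hC.card_le with h6 | h6 | h6 | h6
    · obtain rfl : l = 0 := by omega
      obtain ⟨x, hx⟩ := card_eq_one.1 h6.1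
      have h7 := h.ih W x hC.crit hC.lt (by omega)
        ((hC.toExact hU).noShort hx (h.noShort fun hc => (mem_sdiff.1 hc).2 hz))
      have := (hC.toExact hU).card_eq
      exact ⟨by omega, hC.const_of_card_one hU h6.1⟩
    · obtain rfl : l = 0 := by omega
      refine (hn ((hC.toExact hU).tri_of_clique (by omega) (fun h4 => ?_) h6.2.2)).elim
      have := (potG_of_card_four hC.crit h4).1
      omega
    · obtain rfl : l = 0 := by omega
      by_cases h7 : (supp W).card = 4
      · have := (hC.toExact hU).card_eq
        omega
      · exact (hn ((hC.toExact hU).tri_of_clique (by omega) h7 h6.2.2)).elim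
    · omega
  obtain ⟨v, hv, hvR⟩ := exists_mem_notMem hR hne
  obtain ⟨φ, hφ⟩ := h.crit.exists_pc hv hvR
  exact ⟨(key φ hφ).1, fun c hc => (key c hc).2⟩

/-- A diamond `{a, b; p, q}` on `z = p` that misses three vertices would miss exactly five, with `z` not
on its boundary. Then `G - z` would have eight vertices and at least twelve edges, too many for a graph
without short cycles. -/
lemma false_of_diamond (h : ZeroPot G z) {a b p q : V} (hab : a ≠ b) (hpq : G.Adj p q)
    (hap : G.Adj a p) (haq : G.Adj a q) (hbp : G.Adj b p) (hbq : G.Adj b q) (hn : ¬ G.Adj a b)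
    (hz : z = p) (h3 : 3 ≤ (supp G \ {a, b, p, q}).card) : False := by
  subst hz
  have hs := diamond_subset_supp hpq hap hbp
  have hc := card_diamond hab hpq hap haq hbp hbq
  have hp := pot_diamond hab hpq hap haq hbp hbq
  rw [if_neg hn] at hp
  obtain ⟨h5, hconst⟩ := h.card_sdiff_eq_five (by simp) hs (by omega) (by omega) h3
  have hU : (supp G).card = 9 := by
    have := card_sdiff_add_card_eq_card hs; omega
  -- `a` has a neighbour outside, and so `z` has none
  have ha : a ∈ bd G {a, b, z, q} := by
    rw [mem_bd]
    refine ⟨by simp, ?_⟩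
    by_contra hcon
    push Not at hcon
    have h6 : nb G a ⊆ {z, q} := by
      intro t ht
      rw [mem_nb] at ht
      by_contra htn
      simp only [mem_insert, mem_singleton, not_or] at htn
      refine hcon t ?_ ht
      simp only [mem_insert, mem_singleton, not_or]
      exact ⟨ht.ne.symm, fun e => hn (e ▸ ht), htn⟩
    have := (card_le_card h6).trans card_le_two
    have := h.crit.three_le_deg (mem_supp_left hap)
    omega
  have hnz : z ∉ bd G {a, b, z, q} := by
    intro hz
    have hne : ({a, b, z, q} : Finset V) ≠ supp G := by
      intro e; rw [e] at h3; simp at h3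
    obtain ⟨v, hv, hvR⟩ := exists_mem_notMem hs hne
    obtain ⟨φ, hφ⟩ := h.crit.exists_pc hv hvR
    exact hφ a (by simp) z (by simp) hap (hconst φ hφ a ha z hz)
  have hd : (((supp G).erase z).filter (G.Adj z)).card ≤ 3 := by
    have h6 : ((supp G).erase z).filter (G.Adj z) ⊆ {a, b, q} := by
      intro t ht
      obtain ⟨-, ht⟩ := mem_filter.1 ht
      by_contra htn
      refine hnz (mem_bd.2 ⟨by simp, t, ?_, ht⟩)
      simp only [mem_insert, mem_singleton, not_or] at htn ⊢
      exact ⟨htn.1, htn.2.1, ht.ne.symm, htn.2.2⟩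
    exact (card_le_card h6).trans card_le_three
  have hzU : z ∈ supp G := mem_supp_left hpq
  have h6 := eIn_insert (G := G) (x := z) (S := (supp G).erase z) (by simp)
  rw [insert_erase hzU] at h6
  have h7 := h.potG_eq
  rw [potG, pot, hU] at h7
  have h8 := (h.noShort (S := (supp G).erase z) (by simp)).card_le
  rw [card_erase_of_mem hzU, hU] at h8
  have h9 : 12 ≤ eIn G ((supp G).erase z) := by push_cast at h7; omega
  have h10 : 12 ^ 2 ≤ eIn G ((supp G).erase z) ^ 2 := Nat.pow_le_pow_left h9 2
  norm_num at h8 h10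
  omega

/-- Otherwise all colourings of `R` are constant on the boundary, and the critical graph `W` in `G[R] + ab`
has potential `2`. It is not complete on four vertices, by `false_of_diamond`; and a monochromatic set
of `W` gives short cycles of `G` off `z`, by the position of `a` and `b`. -/
lemma card_sdiff_le_two_of_mem (h : ZeroPot G z) (hz : z ∈ R) (hR : R ⊆ supp G) (h2 : 2 ≤ R.card)
    (h5 : pot G R ≤ 5) : (supp G \ R).card ≤ 2 := by
  by_contra hcon
  obtain ⟨h55, hconst⟩ := h.card_sdiff_eq_five hz hR h2 h5 (by omega)
  have hne : R ≠ supp G := by rintro rfl; simp at h55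
  obtain ⟨-, a, b, W, hW, hWne, hlt⟩ := h.exists_addEdge hR hne h2 hconst
  have hSs := hW.sub.trans hR
  have hS2 : 2 ≤ (supp W).card := by have := hW.crit.four_le_card; omega
  have hS4 := h.four_le_pot hSs hWne hS2
  have hpl := hW.pot_le
  have hP2 := hW.crit.potG_le_two
  have hUS : (supp G \ R).card ≤ (supp G \ supp W).card :=
    card_le_card (sdiff_subset_sdiff Subset.rfl hW.sub)
  have haW := mem_supp_left hW.adj
  have hbW := mem_supp_right hW.adj
  have hzS : z ∈ supp W := by
    by_contra hzS
    exact (h.noShort (S := (supp W).erase a) fun hc => hzS (mem_of_mem_erase hc)).tri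
      (hW.tri (hW.crit.tri_erase (by omega) a))
  have hPW : potG W = 2 := by
    by_contra hc
    have := h.card_sdiff_le_one_of_mem hzS hSs hS2 (by omega)
    omega
  by_cases h4 : (supp W).card = 4
  · have hK := (potG_of_card_four hW.crit h4).2
    obtain ⟨p, q, hpq, he⟩ := card_eq_two.1 (show (((supp W).erase a).erase b).card = 2 by
      rw [card_erase_of_mem (mem_erase.2 ⟨hW.adj.ne.symm, hbW⟩), card_erase_of_mem haW, h4])
    have hp : p ∈ ((supp W).erase a).erase b := by simp [he]
    have hq : q ∈ ((supp W).erase a).erase b := by simp [he]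
    have hWe : supp W = {a, b, p, q} := by
      rw [← insert_erase haW, ← insert_erase (mem_erase.2 ⟨hW.adj.ne.symm, hbW⟩), he]
    simp only [mem_erase] at hp hq
    have k : ∀ c d, c ∈ supp W → d ∈ supp W → c ≠ d → d ≠ a → d ≠ b → G.Adj c d := by
      intro c d hc hd hcd hda hdb
      rcases hW.lift c d (hK c hc d hd hcd) with h | h | h
      exacts [h, (hdb h.2).elim, (hda h.2).elim]
    have apq := k _ _ hp.2.2 hq.2.2 hpq hq.2.1 hq.1
    have aap := k _ _ haW hp.2.2 hp.2.1.symm hp.2.1 hp.1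
    have aaq := k _ _ haW hq.2.2 hq.2.1.symm hq.2.1 hq.1
    have abp := k _ _ hbW hp.2.2 hp.1.symm hp.2.1 hp.1
    have abq := k _ _ hbW hq.2.2 hq.1.symm hq.2.1 hq.1
    have hab := hW.adj.ne
    have h3 : 3 ≤ (supp G \ {a, b, p, q}).card := by rw [← hWe]; omega
    have hmem : ∀ t, t ≠ z → t ∈ univ.erase z := fun t ht => mem_erase.2 ⟨ht, mem_univ _⟩
    rw [hWe] at hzS
    simp only [mem_insert, mem_singleton] at hzS
    rcases hzS with rfl | rfl | rfl | rfl
    · exact h.short.tri ⟨b, hmem _ hab.symm, p, hmem _ hp.2.1, q, hmem _ hq.2.1, abp, apq, abq⟩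
    · exact h.short.tri ⟨a, hmem _ hab, p, hmem _ hp.1, q, hmem _ hq.1, aap, apq, aaq⟩
    · exact h.false_of_diamond hab apq aap aaq abp abq hW.not_adj rfl h3
    · exact h.false_of_diamond hab apq.symm aaq aap abq abp hW.not_adj rfl
        (by rwa [pair_comm])
  · obtain ⟨R', hR'⟩ := hW.crit.exists_mono (by omega) h4
    have h1W : 1 ≤ potG W := by omega
    -- an end of the added edge in `R'`
    have hin : ∀ c d, AddEdge G R c d W → c ∈ R' → z ∉ R' := by
      intro c d hW' hc hz'
      have h6 : Tri G (supp W \ R') := (hR'.tri_compl hW.crit h1W).mono_graph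
        fun p hp q hq => hW'.adj_of_ne (fun e => (mem_sdiff.1 hp).2 (e ▸ hc))
          (fun e => (mem_sdiff.1 hq).2 (e ▸ hc))
      exact (h.noShort (S := supp W \ R') fun hc => (mem_sdiff.1 hc).2 hz').tri h6
    have hcross : ∀ c d, AddEdge G R c d W → c ∈ R' → d ∉ R' → False := by
      intro c d hW' hc hd
      have hz' := hin c d hW' hc
      have h6 : Tri G (R'.erase c) := (hR'.tri_erase hW.crit h1W
        (mem_bd.2 ⟨hc, d, hd, hW'.adj⟩)).mono_graph
        fun p hp q hq => hW'.adj_of_ne (ne_of_mem_erase hp) (ne_of_mem_erase hq)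
      exact (h.noShort (S := R'.erase c) fun hc => hz' (mem_of_mem_erase hc)).tri h6
    by_cases ha : a ∈ R' <;> by_cases hb : b ∈ R'
    · have hz' := hin a b hW ha
      obtain ⟨a', ha', b', hb', hab'⟩ := hW.crit.exists_bd hR'.sub hR'.ne hR'.two_le
      obtain ⟨W', hW', hPW', -⟩ := hR'.exists_addEdge hW.crit (bound _) h1W ha' hb' hab'
      refine not_noShort_deleteEdges _ W' rfl hW'.crit hPW' s(a, b) s(a', b')
        (NoShort.of_inter ((h.noShort hz').mono_graph ?_ |>.mono ?_))
      · intro p hp q hq hpq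
        rw [SimpleGraph.deleteEdges_adj] at hpq
        obtain ⟨hpq, hn⟩ := hpq
        simp only [Set.mem_insert_iff, Set.mem_singleton_iff, not_or] at hn
        have h6 : W.Adj p q := by
          rcases hW'.lift p q hpq with h | ⟨rfl, rfl⟩ | ⟨rfl, rfl⟩
          exacts [h, (hn.2 rfl).elim, (hn.2 Sym2.eq_swap).elim]
        rcases hW.lift p q h6 with h | ⟨rfl, rfl⟩ | ⟨rfl, rfl⟩
        exacts [h, (hn.1 rfl).elim, (hn.1 Sym2.eq_swap).elim]
      · intro p hp
        exact hW'.sub (supp_mono (SimpleGraph.deleteEdges_le _) (mem_inter.1 hp).2)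
    · exact hcross a b hW ha hb
    · exact hcross b a hW.symm hb ha
    · have hne : ∀ t ∈ R', t ≠ a := fun t ht e => ha (e ▸ ht)
      have hadj : ∀ p ∈ R', ∀ q ∈ R', W.Adj p q → G.Adj p q := fun p hp q hq =>
        hW.adj_of_ne (hne p hp) (hne q hq)
      obtain ⟨e, he, -⟩ := hW.crit.exists_bd hR'.sub hR'.ne hR'.two_le
      have hz' : z ∈ R' := by
        by_contra hz'
        exact (h.noShort hz').tri (((hR'.tri_erase hW.crit h1W he).mono
          (erase_subset _ _)).mono_graph hadj)
      have hp : pot G R' ≤ 5 := (pot_mono_graph hadj).trans hR'.pot_le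
      have h6 : insert a (insert b (supp G \ R)) ⊆ supp G \ R' := by
        intro t ht
        simp only [mem_insert] at ht
        rcases ht with rfl | rfl | ht
        · exact mem_sdiff.2 ⟨hSs haW, ha⟩
        · exact mem_sdiff.2 ⟨hSs hbW, hb⟩
        · obtain ⟨h1, h2⟩ := mem_sdiff.1 ht
          exact mem_sdiff.2 ⟨h1, fun hc => h2 (hW.sub (hR'.sub hc))⟩
      have h7 := card_le_card h6
      rw [card_insert_of_notMem, card_insert_of_notMem] at h7
      · have := h.card_sdiff_eq_five hz' (hR'.sub.trans hSs) hR'.two_le hp (by omega)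
        omega
      · exact fun hc => (mem_sdiff.1 hc).2 (hW.sub hbW)
      · simp only [mem_insert, mem_sdiff, not_or]
        exact ⟨hW.adj.ne, fun hc => hc.2 (hW.sub haW)⟩

lemma not_mono (h : ZeroPot G z) (hM : Mono G R) (h3 : 3 ≤ (supp G \ R).card) : False := by
  obtain ⟨hz, -⟩ := h.exists_addEdge hM.sub hM.ne hM.two_le hM.const
  have := h.card_sdiff_le_two_of_mem hz hM.sub hM.two_le hM.pot_le
  omega

/-- If `z` is not in `R`, then a contraction of `R` leads to a triangle in a graph of potential `2` and to a
good configuration off this triangle, or to four vertices. -/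
lemma card_sdiff_le_one (h : ZeroPot G z) (hR : R ⊆ supp G) (h2 : 2 ≤ R.card)
    (h4 : pot G R ≤ 4) : (supp G \ R).card ≤ 1 := by
  by_cases hne : R = supp G
  · simp [hne]
  by_cases hz : z ∈ R
  · exact h.card_sdiff_le_one_of_mem hz hR h2 h4
  have h4' := h.four_le_pot hR hne h2
  obtain ⟨φ, hφ, a, ha, b, hb, hab⟩ : ∃ φ, PC G R φ ∧ ∃ a ∈ bd G R, ∃ b ∈ bd G R, φ a ≠ φ b := by
    by_contra hcon
    push Not at hcon
    exact hz (h.exists_addEdge hR hne h2 hcon).1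
  obtain ⟨ρ, W, l, hC, hU, he⟩ := h.exists_contr hR hne h2 (by omega) hφ
  have h1 := hC.crit.potG_le_two
  rcases pot_card_le_three (W := W) hC.ne hC.card_le with h5 | h5 | h5 | h5
  · obtain rfl : l = 0 := by omega
    exact (hab (hC.const_of_card_one hU h5.1 a ha b hb)).elim
  · obtain rfl : l = 0 := by omega
    have hE := hC.toExact hU
    by_cases h6 : (supp W).card = 4
    · have := hE.card_eq
      omega
    · have hg := hC.crit.good_of_triangle (bound _) (Nat.lt_succ_self _) (by omega) h6 h5.1
        inter_subset_left h5.2.2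
      rcases hE.good (card_pos.1 (by omega)) (S := ∅) (by simpa using hg) with
        ⟨M, hM, hd⟩ | ⟨d, e, f, hEm, -⟩
      · refine (h.not_mono hM ?_).elim
        rw [union_empty] at hd
        have : R ⊆ supp G \ M := fun t ht => mem_sdiff.2 ⟨hR ht, disjoint_right.1 hd ht⟩
        have := card_le_card this
        have := four_le_card_of_pot_le h2 (show pot G R ≤ 5 by omega)
        omega
      · exact (h.not_emerald hEm).elim
  all_goals omega

lemma noDiamond (h : ZeroPot G z) : NoDiamond G := by
  intro a b c d hab hcd hac had hbc hbd
  have hs := diamond_subset_supp hcd hac hbc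
  have hc := card_diamond hab hcd hac had hbc hbd
  have hp := pot_diamond hab hcd hac had hbc hbd
  have hp5 : pot G {a, b, c, d} ≤ 5 := by rw [hp]; split_ifs <;> norm_num
  have hz : z ∈ ({a, b, c, d} : Finset V) := by
    by_contra hz
    exact (h.noShort hz).tri ⟨a, by simp, c, by simp, d, by simp, hac, hcd, had⟩
  have h2 := h.card_sdiff_le_two_of_mem hz hs (by omega) hp5
  have h3 := card_sdiff_add_card_eq_card hs
  have h4 := h.five_le
  have h5 := h.ne
  have h6 := h.potG_eq
  have h7 : (supp G).card = 5 := by omega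
  rw [potG, pot, h7] at h6
  push_cast at h6
  omega

/-- Identifying two neighbours of a vertex of degree three gives no graph of positive potential. -/
lemma potG_ident (h : ZeroPot G z) (hI : Ident G x y u v W) (hu : G.Adj x u) (hv : G.Adj x v)
    (huv : u ≠ v) (hvz : v ≠ z) : potG W ≤ 0 := by
  by_contra hP
  have huW := hI.mem
  by_cases h4 : (supp W).card = 4
  · have hK := (potG_of_card_four hI.crit h4).2
    obtain ⟨p, q, t, hpq, hpt, hqt, he⟩ := card_eq_three.1 (show ((supp W).erase u).card = 3 by
      rw [card_erase_of_mem huW, h4])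
    have hm : ∀ r ∈ ({p, q, t} : Finset V), r ∈ supp W ∧ r ≠ u := fun r hr => by
      rw [← he, mem_erase] at hr; exact hr.symm
    have hadj : ∀ r ∈ ({p, q, t} : Finset V), ∀ r' ∈ ({p, q, t} : Finset V), r ≠ r' → G.Adj r r' :=
      fun r hr r' hr' hne => hI.out r r' (hm r hr).2 (hm r' hr').2
        (hK r (hm r hr).1 r' (hm r' hr').1 hne)
    have huv' : ∀ r ∈ ({p, q, t} : Finset V), G.Adj u r ∨ G.Adj v r := fun r hr =>
      hI.cross r (hK u huW r (hm r hr).1 (hm r hr).2.symm)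
    have key : ∀ o r r' r'', o = u ∨ o = v → r ∈ ({p, q, t} : Finset V) →
        r' ∈ ({p, q, t} : Finset V) → r'' ∈ ({p, q, t} : Finset V) → r ≠ r' → r ≠ r'' → r' ≠ r'' →
        G.Adj o r → G.Adj o r' → False := by
      intro o r r' r'' ho hr hr' hr'' h1 h2 h3 h5 h6
      refine h.noDiamond o r'' r r' ?_ (hadj _ hr _ hr' h1) h5 h6 (hadj _ hr'' _ hr h2.symm)
        (hadj _ hr'' _ hr' h3.symm)
      rintro rfl
      rcases ho with rfl | rfl
      · exact (hm o hr'').2 rfl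
      · exact hI.v_notMem (hm o hr'').1
    have hp : p ∈ ({p, q, t} : Finset V) := by simp
    have hq : q ∈ ({p, q, t} : Finset V) := by simp
    have ht : t ∈ ({p, q, t} : Finset V) := by simp
    rcases huv' p hp with h1 | h1 <;> rcases huv' q hq with h2 | h2 <;>
      rcases huv' t ht with h3 | h3
    · exact key u p q t (Or.inl rfl) hp hq ht hpq hpt hqt h1 h2
    · exact key u p q t (Or.inl rfl) hp hq ht hpq hpt hqt h1 h2
    · exact key u p t q (Or.inl rfl) hp ht hq hpt hpq hqt.symm h1 h3
    · exact key v q t p (Or.inr rfl) hq ht hp hqt hpq.symm hpt.symm h2 h3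
    · exact key u q t p (Or.inl rfl) hq ht hp hqt hpq.symm hpt.symm h2 h3
    · exact key v p t q (Or.inr rfl) hp ht hq hpt hpq hqt.symm h1 h3
    · exact key v p q t (Or.inr rfl) hp hq ht hpq hpt hqt h1 h2
    · exact key v p q t (Or.inr rfl) hp hq ht hpq hpt hqt h1 h2
  have hmem : ∀ t, t ≠ z → t ∈ univ.erase z := fun t ht => mem_erase.2 ⟨ht, mem_univ _⟩
  refine not_noClose _ W rfl hI.crit (by omega) h4 u z ⟨?_, ?_, ?_⟩
  · intro a b c d ha hb hc hd hab h1 h2 h3 h5 h6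
    exact h.noDiamond a b c d hab (hI.out _ _ hc hd h1) (hI.out _ _ ha hc h2) (hI.out _ _ ha hd h3)
      (hI.out _ _ hb hc h5) (hI.out _ _ hb hd h6)
  · refine (h.short.mono (S := (univ.erase u).erase z) ?_).mono_graph ?_
    · exact erase_subset_erase _ (subset_univ _)
    · intro a ha b hb
      simp only [mem_erase] at ha hb
      exact hI.out a b ha.2.1 hb.2.1
  · -- in `G`, the vertices `a` and `b` are adjacent to the same one of `u` and `v`
    intro a b d huz haz hbz hdz hab h1 h2 h3 h5 h6
    have had := hI.out a d h2.ne h1.ne.symm h3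
    have hbd := hI.out b d h5.ne h1.ne.symm h6
    have hvd : v ≠ d := fun e => hI.v_notMem (e ▸ mem_supp_right h1)
    have key : ∀ o o', o ≠ z → o' ≠ z → o' ≠ d → G.Adj o d → (G.Adj o a ∨ G.Adj o' a) →
        (G.Adj o b ∨ G.Adj o' b) → False := by
      intro o o' ho ho' hod h7 h8 h9
      rcases h8 with h8 | h8
      · exact h.short.tri ⟨o, hmem _ ho, a, hmem _ haz, d, hmem _ hdz, h8, had, h7⟩
      rcases h9 with h9 | h9
      · exact h.short.tri ⟨o, hmem _ ho, b, hmem _ hbz, d, hmem _ hdz, h9, hbd, h7⟩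
      exact h.short.four a (hmem _ haz) b (hmem _ hbz) o' (hmem _ ho') d (hmem _ hdz) hab hod
        h8.symm had h9.symm hbd
    have h8 := hI.cross a h2.symm
    have h9 := hI.cross b h5.symm
    rcases hI.cross d h1 with h7 | h7
    · exact key u v huz hvz hvd h7 h8 h9
    · exact key v u hvz huz h1.ne h7 h8.symm h9.symm

/-- Identifying the ends `u` and `v` gives a set of potential at most `4` that misses two vertices of the
path. -/
lemma star (h : ZeroPot G z) : Star G := by
  have key : ∀ x y t u v, x ∈ V3 G → y ∈ V3 G → t ∈ V3 G → G.Adj x y → G.Adj y t → t ≠ x →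
      G.Adj x u → G.Adj x v → u ≠ v → u ≠ y → v ≠ y → v ≠ z → G.Adj u v := by
    intro x y t u v hx hy ht hxy hyt htx hxu hxv huv huy hvy hvz
    by_contra hn
    rw [mem_V3] at hx hy ht
    have hnx := nb_eq_of_card_three hx hxy hxu hxv huy.symm hvy.symm huv
    obtain ⟨W, hI⟩ := h.crit.exists_ident hxy hy hnx huv huy hvy hn
    have hP := h.potG_ident hI hxu hxv huv hvz
    have hnxt : ¬ G.Adj x t := fun hxt => h.not_emerald ⟨hxy, hyt, hxt, hx, hy, ht⟩
    have htu : t ≠ u := by rintro rfl; exact hnxt hxu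
    have htv : t ≠ v := by rintro rfl; exact hnxt hxv
    have htW := hI.deg_three t ht htx hyt.symm htu htv
    have hsub := hI.subset (mem_supp_left hxy) (mem_supp_right hxv)
    have hc := hI.card_eq hxv.ne
    have hpl := hI.pot_le
    have h1 := h.card_sdiff_le_one hsub (by omega) (by omega)
    refine hyt.ne (card_le_one.1 h1 _ (mem_sdiff.2 ⟨mem_supp_left hyt, ?_⟩) _
      (mem_sdiff.2 ⟨mem_supp_right hyt, ?_⟩))
    · simp only [mem_insert, not_or]; exact ⟨hxy.ne.symm, hvy.symm, hI.y_notMem⟩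
    · simp only [mem_insert, not_or]; exact ⟨htx, htv, htW⟩
  intro x y t u v hx hy ht hxy hyt htx hxu hxv huv huy hvy
  by_cases hvz : v = z
  · exact (key x y t v u hx hy ht hxy hyt htx hxv hxu huv.symm hvy huy
      (fun e => huv (e.trans hvz.symm))).symm
  · exact key x y t u v hx hy ht hxy hyt htx hxu hxv huv huy hvy hvz

end ZeroPot

/-- A critical graph of potential `0` in which all triangles and four-cycles pass through one vertex
has six vertices. -/
lemma Crit.card_eq_six : ∀ (m : ℕ) (G : SimpleGraph V), (supp G).card = m → Crit G → potG G = 0 →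
    ∀ z, NoShort G (univ.erase z) → (supp G).card = 6 := by
  intro m
  induction m using Nat.strong_induction_on with
  | _ m ih =>
  intro G hm hG hP z hN
  by_contra hne
  have h : ZeroPot G z := ⟨hG, hP, hN, fun W z' hW hlt hPW hNW =>
    ih _ (hm ▸ hlt) W rfl hW hPW z' hNW, hne⟩
  have := hG.potG_neg_of_star h.noDiamond h.star
  omega

/-! ### Critical graphs of girth five -/

/-- A critical graph of potential `-1` without triangles and four-cycles. -/
structure NegOne (G : SimpleGraph V) : Prop where
  crit : Crit G
  potG_eq : potG G = -1
  short : NoShort G univ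

namespace NegOne

lemma not_tri (h : NegOne G) : ¬ Tri G S := fun ht => h.short.tri (ht.mono (subset_univ S))

/-- A set of smaller potential contracts to a single vertex of a graph of potential `2`, which has a
triangle off that vertex. -/
lemma three_le_pot (h : NegOne G) (hR : R ⊆ supp G) (hne : R ≠ supp G) (h2 : 2 ≤ R.card) :
    3 ≤ pot G R := by
  by_contra hlt
  obtain ⟨R', φ, ρ, W, l, -, hp, hC, hU, he⟩ := h.crit.exists_min_contr hR hne h2 (by omega)
  have h1 := hC.crit.potG_le_two
  have h0 := h.potG_eq
  rcases pot_card_le_three (W := W) hC.ne hC.card_le with h5 | h5 | h5 | h5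
  · obtain rfl : l = 0 := by omega
    exact h.not_tri ((hC.toExact hU).tri_of_one h5.1 (by omega))
  all_goals omega

lemma exists_contr (h : NegOne G) (hR : R ⊆ supp G) (hne : R ≠ supp G) (h2 : 2 ≤ R.card)
    (h5 : pot G R ≤ 5) {φ : V → Fin 3} (hφ : PC G R φ) :
    ∃ ρ W l, Contr G R φ ρ W l ∧ R ∪ supp W = supp G ∧
      pot W (supp W ∩ R) + 3 * l = pot G R + potG W + 1 := by
  obtain ⟨ρ, W, l, h1, h3, h4⟩ := h.crit.exists_contr_union hR hne h2 h5
    (fun T h1 h3 h4 => by have := h.three_le_pot h1 h3 h4; omega) hφ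
  have := h.potG_eq
  exact ⟨ρ, W, l, h1, h3, by omega⟩

/-- Otherwise `G[R]` with an added edge contains a critical graph of negative potential, whose vertices
form a set of potential at most `2` in `G`. -/
lemma exists_separating (h : NegOne G) (hR : R ⊆ supp G) (hne : R ≠ supp G) (h2 : 2 ≤ R.card) :
    ∃ φ, PC G R φ ∧ ∃ a ∈ bd G R, ∃ b ∈ bd G R, φ a ≠ φ b := by
  by_contra hcon
  push Not at hcon
  obtain ⟨v, hv, hvR⟩ := exists_mem_notMem hR hne
  obtain ⟨a, ha, b, hb, hab⟩ := h.crit.exists_bd hR hne h2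
  obtain ⟨W, hW⟩ := h.crit.exists_addEdge hv hvR (mem_bd.1 ha).1 (mem_bd.1 hb).1 hab
    (fun c hc => hcon c hc a ha b hb)
  have h1 := hW.pot_neg (h.short.mono (subset_univ R))
    fun hP z hN => hW.crit.card_eq_six _ W rfl hP z hN
  have h3 := h.three_le_pot (hW.sub.trans hR) (fun e => hvR (hW.sub (e ▸ hv)))
    (by have := hW.crit.four_le_card; omega)
  have h4 := hW.pot_le
  omega

/-- A contraction has positive potential, and so it has four vertices or `G` has a triangle. -/
lemma card_sdiff_le_one (h : NegOne G) (hR : R ⊆ supp G) (h2 : 2 ≤ R.card) (h3 : pot G R ≤ 3) :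
    (supp G \ R).card ≤ 1 := by
  by_cases hne : R = supp G
  · simp [hne]
  obtain ⟨v, hv, hvR⟩ := exists_mem_notMem hR hne
  obtain ⟨φ, hφ⟩ := h.crit.exists_pc hv hvR
  obtain ⟨ρ, W, l, hC, hU, he⟩ := h.exists_contr hR hne h2 (by omega) hφ
  have h1 := hC.crit.potG_le_two
  have h4 := h.three_le_pot hR hne h2
  rcases pot_card_le_three (W := W) hC.ne hC.card_le with h5 | h5 | h5 | h5
  · obtain rfl : l = 0 := by omega
    exact (h.not_tri ((hC.toExact hU).tri_of_one h5.1 (by omega))).elim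
  · obtain rfl : l = 0 := by omega
    by_cases h6 : (supp W).card = 4
    · have := (hC.toExact hU).card_eq
      omega
    · exact (h.not_tri ((hC.toExact hU).tri_of_clique (by omega) h6 h5.2.2)).elim
  all_goals omega

/-- A contraction along a colouring that is not constant on the boundary has positive potential, and so it
has four vertices or `G` has a triangle. -/
lemma card_sdiff_le_two (h : NegOne G) (hR : R ⊆ supp G) (h2 : 2 ≤ R.card) (h3 : pot G R ≤ 4) :
    (supp G \ R).card ≤ 2 := by
  by_cases hne : R = supp G
  · simp [hne]
  obtain ⟨φ, hφ, a, ha, b, hb, hab⟩ := h.exists_separating hR hne h2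
  obtain ⟨ρ, W, l, hC, hU, he⟩ := h.exists_contr hR hne h2 (by omega) hφ
  have h1 := hC.crit.potG_le_two
  have key : l = 0 → 1 ≤ potG W → (∀ a ∈ supp W ∩ R, ∀ b ∈ supp W ∩ R, a ≠ b → W.Adj a b) →
      2 ≤ (supp W ∩ R).card → (supp G \ R).card ≤ 2 := by
    rintro rfl hP hcl hc
    by_cases h6 : (supp W).card = 4
    · have := (hC.toExact hU).card_eq
      omega
    · exact (h.not_tri ((hC.toExact hU).tri_of_clique hP h6 hcl)).elim
  rcases pot_card_le_three (W := W) hC.ne hC.card_le with h5 | h5 | h5 | h5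
  · by_cases hl : l = 0
    · subst hl
      exact (hab (hC.const_of_card_one hU h5.1 a ha b hb)).elim
    · omega
  · exact key (by omega) (by omega) h5.2.2 (by omega)
  · exact key (by omega) (by omega) h5.2.2 (by omega)
  · omega

/-- The graph obtained by an identification has no triangle off the new vertex `u`, and so its potential
is not positive. -/
lemma potG_ident (h : NegOne G) (hI : Ident G x y u v W) : potG W ≤ 0 := by
  by_contra hP
  refine h.not_tri (((hI.crit.tri_erase (by omega) u).mono_graph ?_).mono (subset_univ _))
  exact fun a ha b hb => hI.out a b (ne_of_mem_erase ha) (ne_of_mem_erase hb)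

/-- If `y` has two neighbours `x` and `t` of degree three, then the other two neighbours of `x` can be
identified. The result has potential `0` and six vertices, and so `G` has ten vertices and at least
seventeen edges, too many for a graph without short cycles. -/
lemma card_nb_V3_le_one (h : NegOne G) (hy : y ∈ V3 G) : (nb G y ∩ V3 G).card ≤ 1 := by
  by_contra hlt
  obtain ⟨x, hx, t, ht, hxt⟩ := one_lt_card.1 (not_le.1 hlt)
  simp only [mem_inter, mem_nb, mem_V3] at hx ht hy
  obtain ⟨hyx, hx⟩ := hx
  obtain ⟨hyt, ht⟩ := ht
  have tri : ∀ {a b c}, G.Adj a b → G.Adj b c → ¬ G.Adj a c := fun hab hbc hac =>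
    h.short.tri ⟨_, mem_univ _, _, mem_univ _, _, mem_univ _, hab, hbc, hac⟩
  obtain ⟨u, v, hnx, hyu, hyv, huv⟩ := exists_nb_eq hx hyx.symm
  have hxu : G.Adj x u := by rw [← mem_nb, hnx]; simp
  have hxv : G.Adj x v := by rw [← mem_nb, hnx]; simp
  obtain ⟨W, hI⟩ := h.crit.exists_ident hyx.symm hy hnx huv hyu.symm hyv.symm (tri hxu.symm hxv)
  have hP := h.potG_ident hI
  have htu : t ≠ u := by rintro rfl; exact tri hyx hxu hyt
  have htv : t ≠ v := by rintro rfl; exact tri hyx hxv hyt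
  have htW := hI.deg_three t ht hxt.symm hyt.symm htu htv
  have hsub := hI.subset (mem_supp_right hyx) (mem_supp_right hxv)
  have hc := hI.card_eq hxv.ne
  have hpl := hI.pot_le
  have hyR : y ∉ insert x (insert v (supp W)) := by
    simp only [mem_insert, not_or]; exact ⟨hyx.ne, hyv, hI.y_notMem⟩
  have htR : t ∉ insert x (insert v (supp W)) := by
    simp only [mem_insert, not_or]; exact ⟨hxt.symm, htv, htW⟩
  have h2 : 1 < (supp G \ insert x (insert v (supp W))).card := one_lt_card.2
    ⟨y, mem_sdiff.2 ⟨mem_supp_left hyx, hyR⟩, t, mem_sdiff.2 ⟨mem_supp_right hyt, htR⟩, hyt.ne⟩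
  have h3 : 4 ≤ pot G (insert x (insert v (supp W))) := by
    by_contra hc
    have := h.card_sdiff_le_one hsub (by omega) (by omega)
    omega
  have h4 := h.card_sdiff_le_two hsub (by omega) (by omega)
  have hN : NoShort W (univ.erase u) := (h.short.mono (subset_univ _)).mono_graph
    fun a ha b hb => hI.out a b (ne_of_mem_erase ha) (ne_of_mem_erase hb)
  have h6 := hI.crit.card_eq_six _ W rfl (by omega) u hN
  have h10 : (supp G).card = 10 := by
    have := card_sdiff_add_card_eq_card hsub; omega
  have h7 := (h.short.mono (subset_univ (supp G))).card_le
  have h8 := h.potG_eq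
  rw [potG, pot, h10] at h8
  rw [h10] at h7
  have h9 : 17 ≤ eIn G (supp G) := by push_cast at h8; omega
  have h11 : 17 ^ 2 ≤ eIn G (supp G) ^ 2 := Nat.pow_le_pow_left h9 2
  norm_num at h7 h11
  omega

end NegOne

/-- If `S` has edges, then the deletion of some vertex reduces their number. -/
lemma exists_eIn_erase (h : eIn G S ≠ 0) : ∃ v ∈ S, eIn G (S.erase v) < eIn G S := by
  by_contra hcon
  push Not at hcon
  have h1 : ∀ v ∈ S, (S.filter (G.Adj v)).card = 0 := by
    intro v hv
    have h2 := eIn_insert (G := G) (notMem_erase v S)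
    rw [insert_erase hv] at h2
    have h3 := hcon v hv
    have h4 : (S.erase v).filter (G.Adj v) = S.filter (G.Adj v) := by
      ext a
      simp only [mem_filter, mem_erase]
      exact ⟨fun ha => ⟨ha.1.2, ha.2⟩, fun ha => ⟨⟨ha.2.ne.symm, ha.1⟩, ha.2⟩⟩
    rw [h4] at h2
    omega
  have h2 := sum_deg_in (G := G) (S := S)
  rw [sum_eq_zero h1] at h2
  omega

lemma not_adj_of_eIn_eq_zero (h : eIn G S = 0) (hx : x ∈ S) (hy : y ∈ S) : ¬ G.Adj x y := by
  intro hxy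
  have h2 := sum_deg_in (G := G) (S := S)
  rw [h, mul_zero, sum_eq_zero_iff] at h2
  have : y ∈ S.filter (G.Adj x) := mem_filter.2 ⟨hy, hxy⟩
  rw [card_eq_zero.1 (h2 x hx)] at this
  exact notMem_empty _ this

/-- A set with at most two edges has a colouring with almost all colours zero. -/
lemma exists_pc_of_eIn_le_two (h : eIn G S ≤ 2) : ∃ c, PC G S c ∧
    (∀ a ∈ S, ∀ b ∈ S, c a = c b → c a ≠ 0 → a = b) ∧ (eIn G S ≤ 1 → ∀ a ∈ S, c a ≠ 2) := by
  have h0 : ∀ T, eIn G T = 0 → PC G T (fun _ => 0) := fun T hT a ha b hb hab =>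
    (not_adj_of_eIn_eq_zero hT ha hb hab).elim
  by_cases h1 : eIn G S = 0
  · exact ⟨_, h0 S h1, fun a _ b _ _ h => (h rfl).elim, fun _ _ _ => by decide⟩
  obtain ⟨v, hv, hlt⟩ := exists_eIn_erase h1
  have hv1 : ∀ T : Finset V, eIn G (T.erase v) = 0 → v ∈ T →
      ∃ c, PC G T c ∧ c v = 1 ∧ ∀ a ∈ T, a ≠ v → c a = 0 := by
    intro T hT hvT
    obtain ⟨c, h3, h4, h5⟩ := (h0 _ hT).extend_color (v := v) 1 (fun _ _ _ => by decide) (by simp)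
    rw [insert_erase hvT] at h3
    exact ⟨c, h3, h4, fun a ha hav => h5 a (mem_erase.2 ⟨hav, ha⟩)⟩
  by_cases h2 : eIn G (S.erase v) = 0
  · obtain ⟨c, h3, h4, h5⟩ := hv1 S h2 hv
    refine ⟨c, h3, fun a ha b hb hab ha0 => ?_, fun _ a ha => ?_⟩
    · have hav : a = v := by by_contra hne; exact ha0 (h5 a ha hne)
      have hbv : b = v := by by_contra hne; exact ha0 (hab.trans (h5 b hb hne))
      rw [hav, hbv]
    · by_cases hav : a = v
      · rw [hav, h4]; decide
      · rw [h5 a ha hav]; decide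
  · obtain ⟨w, hw, hlt'⟩ := exists_eIn_erase h2
    obtain ⟨hwv, hwS⟩ := mem_erase.1 hw
    obtain ⟨c, h3, h4, h5⟩ := hv1 (S.erase w) (by rw [erase_right_comm]; omega)
      (mem_erase.2 ⟨hwv.symm, hv⟩)
    have h02 : ∀ a ∈ S.erase w, c a ≠ 2 := fun a ha => by
      by_cases hav : a = v
      · rw [hav, h4]; decide
      · rw [h5 a ha hav]; decide
    obtain ⟨c', h6, h7, h8⟩ := h3.extend_color (v := w) 2 (fun a ha _ => h02 a ha) (by simp)
    rw [insert_erase hwS] at h6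
    refine ⟨c', h6, fun a ha b hb hab ha0 => ?_, fun h9 => by omega⟩
    by_cases haw : a = w <;> by_cases hbw : b = w
    · rw [haw, hbw]
    · rw [haw, h7, h8 b (mem_erase.2 ⟨hbw, hb⟩)] at hab
      exact (h02 b (mem_erase.2 ⟨hbw, hb⟩) hab.symm).elim
    · rw [hbw, h7, h8 a (mem_erase.2 ⟨haw, ha⟩)] at hab
      exact (h02 a (mem_erase.2 ⟨haw, ha⟩) hab).elim
    · have ha' := mem_erase.2 ⟨haw, ha⟩
      have hb' := mem_erase.2 ⟨hbw, hb⟩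
      rw [h8 a ha'] at hab ha0
      rw [h8 b hb'] at hab
      have hav : a = v := by by_contra hne; exact ha0 (h5 a ha' hne)
      have hbv : b = v := by by_contra hne; exact ha0 (hab.trans (h5 b hb' hne))
      rw [hav, hbv]

namespace NegOne

/-- By counting, there are few edges between the vertices of degree at least four. -/
lemma eIn_V4_le (h : NegOne G) : eIn G (V4 G) ≤ 2 ∧
    (2 ≤ eIn G (V4 G) → ∀ v ∈ V3 G, (nb G v ∩ V3 G).card = 1) := by
  have h1 := four_mul_potG (G := G)
  rw [h.potG_eq] at h1
  have h2 : ∑ v ∈ V4 G, ((nb G v ∩ V4 G).card : ℤ) = 2 * eIn G (V4 G) := by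
    have h3 := sum_deg_in (G := G) (S := V4 G)
    rw [sum_congr rfl (g := fun v => (nb G v ∩ V4 G).card)] at h3
    · exact_mod_cast h3
    · intro v _
      congr 1
      ext a
      simp only [mem_filter, mem_inter, mem_nb]
      exact and_comm
  have h3 : 0 ≤ ∑ v ∈ V4 G, (((nb G v).card : ℤ) - 4) := by
    refine sum_nonneg fun v hv => ?_
    have := h.crit.four_le_of_mem_V4 hv
    omega
  have h4 : ∀ v ∈ V3 G, ((nb G v ∩ V3 G).card : ℤ) - 1 ≤ 0 := fun v hv => by
    have := h.card_nb_V3_le_one hv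
    omega
  have h5 := sum_nonpos h4
  refine ⟨by omega, fun h6 v hv => ?_⟩
  have h7 : ∑ v ∈ V3 G, (((nb G v ∩ V3 G).card : ℤ) - 1) = 0 := by omega
  have := (sum_eq_zero_iff_of_nonpos h4).1 h7 v hv
  omega

/-- The vertices of degree at least four are coloured first. An edge between vertices of degree three
has no common neighbour, and so its two ends see no common colour other than zero. -/
lemma false (h : NegOne G) : False := by
  obtain ⟨h2, h1⟩ := h.eIn_V4_le
  obtain ⟨c, hc, huniq, hc2⟩ := exists_pc_of_eIn_le_two h2
  let C : V → Finset (Fin 3) := fun x => ((V4 G).filter (G.Adj x)).image c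
  have hCmem : ∀ {x a}, a ∈ V4 G → G.Adj x a → c a ∈ C x := fun ha hxa =>
    mem_image_of_mem _ (mem_filter.2 ⟨ha, hxa⟩)
  have hC : ∀ x ∈ V3 G, (C x).card ≤ 2 := by
    intro x hx
    by_cases h3 : (nb G x ∩ V3 G).card = 1
    · have h4 := card_nb_eq_add (G := G) (v := x)
      rw [mem_V3.1 hx, h3] at h4
      have h5 : (V4 G).filter (G.Adj x) ⊆ nb G x ∩ V4 G := fun a ha => by
        obtain ⟨ha, hxa⟩ := mem_filter.1 ha
        exact mem_inter.2 ⟨mem_nb.2 hxa, ha⟩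
      refine card_image_le.trans ((card_le_card h5).trans ?_)
      omega
    · have h4 : eIn G (V4 G) ≤ 1 := by
        by_contra hlt
        exact h3 (h1 (by omega) x hx)
      have h5 : C x ⊆ {0, 1} := by
        intro k hk
        obtain ⟨a, ha, rfl⟩ := mem_image.1 hk
        have := hc2 h4 a (mem_filter.1 ha).1
        revert this
        generalize c a = k
        revert k
        decide
      exact (card_le_card h5).trans card_le_two
  have hCC : ∀ x y, G.Adj x y → C x ∩ C y ⊆ {0} := by
    intro x y hxy k hk
    obtain ⟨hkx, hky⟩ := mem_inter.1 hk
    obtain ⟨a, ha, hak⟩ := mem_image.1 hkx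
    obtain ⟨b, hb, hbk⟩ := mem_image.1 hky
    obtain ⟨ha, hxa⟩ := mem_filter.1 ha
    obtain ⟨hb, hyb⟩ := mem_filter.1 hb
    rw [mem_singleton]
    by_contra hk0
    obtain rfl := huniq a ha b hb (hak.trans hbk.symm) (hak ▸ hk0)
    exact h.short.tri ⟨x, mem_univ _, y, mem_univ _, a, mem_univ _, hxy, hyb, hxa⟩
  have hf : ∀ x ∈ V3 G, ∃ k, k ∉ C x := by
    intro x hx
    by_contra hcon
    push Not at hcon
    have h3 : (univ : Finset (Fin 3)) ⊆ C x := fun k _ => hcon k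
    have := card_le_card h3
    have := hC x hx
    simp at *
    omega
  choose! f hf using hf
  have hdis : ∀ {a}, a ∈ V3 G → a ∉ V4 G := fun ha ha' => disjoint_left.1 disjoint_V3_V4 ha ha'
  -- the vertices that see two colours have only one choice
  let B := (V3 G).filter fun x => 2 ≤ (C x).card
  have hB3 : ∀ {a}, a ∈ B → a ∈ V3 G := fun ha => (mem_filter.1 ha).1
  let c₁ : V → Fin 3 := fun a => if a ∈ V4 G then c a else f a
  have h4 : ∀ a ∈ V4 G, c₁ a = c a := fun a ha => if_pos ha
  have h3 : ∀ a ∈ V3 G, c₁ a = f a := fun a ha => if_neg (hdis ha)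
  have hc₁ : PC G (V4 G ∪ B) c₁ := by
    intro a ha b hb hab
    rcases mem_union.1 ha with ha | ha <;> rcases mem_union.1 hb with hb | hb
    · rw [h4 a ha, h4 b hb]; exact hc a ha b hb hab
    · rw [h4 a ha, h3 b (hB3 hb)]
      exact fun e => hf b (hB3 hb) (e ▸ hCmem ha hab.symm)
    · rw [h4 b hb, h3 a (hB3 ha)]
      exact fun e => hf a (hB3 ha) (e ▸ hCmem hb hab)
    · rw [h3 a (hB3 ha), h3 b (hB3 hb)]
      intro e
      have h5 : C a ∪ C b ⊆ univ.erase (f a) := by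
        intro k hk
        refine mem_erase.2 ⟨?_, mem_univ _⟩
        rintro rfl
        rcases mem_union.1 hk with hk | hk
        · exact hf a (hB3 ha) hk
        · exact hf b (hB3 hb) (e ▸ hk)
      have h6 := card_le_card h5
      rw [card_erase_of_mem (mem_univ _), card_univ, Fintype.card_fin] at h6
      have h7 := card_le_card (hCC a b hab)
      rw [card_singleton] at h7
      have h8 := card_union_add_card_inter (C a) (C b)
      have h9 := (mem_filter.1 ha).2
      have h10 := (mem_filter.1 hb).2
      omega
  obtain ⟨c₂, hc₂, -⟩ := hc₁.extend_matching (B := V3 G \ B)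
    (disjoint_union_left.2 ⟨disjoint_V3_V4.symm.mono_right sdiff_subset, disjoint_sdiff⟩) (by
      intro v hv
      obtain ⟨hv3, hvB⟩ := mem_sdiff.1 hv
      have h5 : (C v).card ≤ 1 := by
        by_contra hlt
        exact hvB (mem_filter.2 ⟨hv3, by omega⟩)
      have h6 : ((V4 G ∪ B).filter (G.Adj v)).image c₁ ⊆ C v ∪ (nb G v ∩ B).image c₁ := by
        intro k hk
        obtain ⟨a, ha, rfl⟩ := mem_image.1 hk
        obtain ⟨ha, hva⟩ := mem_filter.1 ha
        rcases mem_union.1 ha with ha | ha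
        · rw [h4 a ha]; exact mem_union_left _ (hCmem ha hva)
        · exact mem_union_right _ (mem_image_of_mem _ (mem_inter.2 ⟨mem_nb.2 hva, ha⟩))
      have h7 := (card_le_card h6).trans (card_union_le _ _)
      have h8 := card_image_le (s := nb G v ∩ B) (f := c₁)
      have h9 := h.card_nb_V3_le_one hv3
      have h10 : nb G v ∩ V3 G = nb G v ∩ B ∪ nb G v ∩ (V3 G \ B) := by
        rw [← inter_union_distrib_left, union_sdiff_of_subset (filter_subset _ _)]
      rw [h10, card_union_of_disjoint (disjoint_of_subset_left inter_subset_right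
        (disjoint_of_subset_right inter_subset_right disjoint_sdiff))] at h9
      omega)
  rw [union_assoc, union_sdiff_of_subset (filter_subset _ _), union_comm, V3_union_V4] at hc₂
  exact h.crit.not_pc_supp hc₂

end NegOne

/-- A critical graph without triangles and four-cycles has potential at most `-2`. -/
theorem Crit.potG_le_neg_two (hG : Crit G) (hN : NoShort G univ) : potG G ≤ -2 := by
  by_contra hlt
  have h1 : ¬ 1 ≤ potG G := fun hP => by
    obtain ⟨v, -⟩ := hG.supp_nonempty
    exact hN.tri ((hG.tri_erase hP v).mono (subset_univ _))
  have h2 : potG G ≠ -1 := fun hP => NegOne.false ⟨hG, hP, hN⟩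
  have h0 : potG G = 0 := by omega
  obtain ⟨v, -⟩ := hG.supp_nonempty
  have h6 := hG.card_eq_six _ G rfl h0 v (hN.mono (subset_univ _))
  have h3 := (hN.mono (subset_univ (supp G))).card_le
  rw [potG, pot, h6] at h0
  rw [h6] at h3
  have h4 : 9 ≤ eIn G (supp G) := by push_cast at h0; omega
  have h5 : 9 ^ 2 ≤ eIn G (supp G) ^ 2 := Nat.pow_le_pow_left h4 2
  norm_num at h3 h5
  omega

/-! ### Four-critical graphs -/

lemma crit_of_isFourCritical (h : G.IsFourCritical) : Crit G := by
  refine ⟨fun c hc => h.1 ⟨SimpleGraph.Coloring.mk c fun {a b} hab => pc_univ_iff.1 hc a b hab⟩,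
    fun H hH hne => ?_⟩
  have h1 : SimpleGraph.toSubgraph H hH ≠ ⊤ := fun e => hne (congrArg SimpleGraph.Subgraph.spanningCoe e)
  obtain ⟨c⟩ := h.2 _ h1
  exact ⟨fun v => c ⟨v, Set.mem_univ v⟩, pc_univ_iff.2 fun a b hab => c.valid hab⟩

/-- A `4`-critical graph has no isolated vertex, since such a vertex could be deleted. -/
lemma supp_eq_univ_of_isFourCritical (h : G.IsFourCritical) : supp G = univ := by
  rw [eq_univ_iff_forall]
  intro v
  by_contra hv
  have h1 : (⊤ : G.Subgraph).deleteVerts {v} ≠ ⊤ := fun e => by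
    have : v ∈ ((⊤ : G.Subgraph).deleteVerts {v}).verts := by rw [e]; trivial
    simp at this
  obtain ⟨c⟩ := h.2 _ h1
  have hne : ∀ {a b}, G.Adj a b → a ≠ v := fun hab e => hv (e ▸ mem_supp_left hab)
  refine h.1 ⟨SimpleGraph.Coloring.mk
    (fun a => if ha : a ≠ v then c ⟨a, by simpa using ha⟩ else 0) fun {a b} hab => ?_⟩
  rw [dif_pos (hne hab), dif_pos (hne hab.symm)]
  exact c.valid (by simp [hab, hne hab, hne hab.symm])

lemma noShort_of_five_le_egirth (h : 5 ≤ G.egirth) : NoShort G univ := by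
  rw [SimpleGraph.le_egirth] at h
  refine ⟨?_, ?_⟩
  · rintro ⟨a, -, b, -, c, -, hab, hbc, hac⟩
    have := h a (.cons hab (.cons hbc (.cons hac.symm .nil))) (by
      simp [SimpleGraph.Walk.cons_isCycle_iff, hab.ne, hbc.ne, hac.ne, hab.ne.symm,
        hac.ne.symm])
    simp at this
    exact absurd this (by decide)
  · intro a _ b _ c _ d _ hab hcd hac had hbc hbd
    have := h a (.cons hac (.cons hbc.symm (.cons hbd (.cons had.symm .nil)))) (by
      simp [SimpleGraph.Walk.cons_isCycle_iff, hab, hab.symm, hcd, hac.ne, hac.ne.symm,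
        had.ne, had.ne.symm, hbc.ne.symm, hbd.ne])
    simp at this
    exact absurd this (by decide)

lemma card_edgeFinset_eq_eIn [Fintype G.edgeSet] : G.edgeFinset.card = eIn G univ := by
  rw [eIn]
  congr 1
  ext e
  simp

end
end FourCrit

theorem mainTheorem2 {V : Type*} [Fintype V] (G : SimpleGraph V) [Fintype G.edgeSet]
    (hcrit : G.IsFourCritical) (hgirth : 5 ≤ G.egirth) :
    (5 * (Fintype.card V : ℝ) + 2) / 3 ≤ (G.edgeFinset.card : ℝ) := by
  have h1 := (FourCrit.crit_of_isFourCritical hcrit).potG_le_neg_two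
    (FourCrit.noShort_of_five_le_egirth hgirth)
  rw [FourCrit.potG, FourCrit.pot, FourCrit.supp_eq_univ_of_isFourCritical hcrit,
    Finset.card_univ, ← FourCrit.card_edgeFinset_eq_eIn] at h1
  have h2 : (5 * (Fintype.card V : ℝ) - 3 * (G.edgeFinset.card : ℝ)) ≤ -2 := by exact_mod_cast h1
  linarith
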